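/- Notation. Let $\mathcal O$ be the ring of holomorphic functions on $\mathbb C^n$ and let $D=\{\Delta=0\}\subseteq\mathbb C^n$ be a reduced divisor with global defining equation $\Delta\in\mathcal O$ (that is, $\Delta\neq0$ and every $f\in\mathcal O$ vanishing on $D$ is divisible by $\Delta$). Let $\Gamma(\mathbb C^n,\mathrm{Der}(-\log D))$ be the $\mathcal O$-module of holomorphic vector fields $\delta$ on $\mathbb C^n$ with $\delta(\Delta)\in\mathcal O\cdot\Delta$, and let $\Gamma(\mathbb C^n,\Omega^\bullet(\log D))$ be the complex (with the exterior derivative $d$) of holomorphic forms $\omega$ on $\mathbb C^n\setminus D$ such that $\Delta\omega$ and $\Delta\,d\omega$ extend to holomorphic forms on $\mathbb C^n$. Call $D$ a linear free divisor if $\Gamma(\mathbb C^n,\mathrm{Der}(-\log D))$ has an $\mathcal O$-basis $\delta_1,\dots,\delta_n$ whose members have linear coefficients with respect to $\partial_1,\dots,\partial_n$. Let $L_D$ be the Lie algebra of all $xA\partial^t=\sum_{i,j}x_ia_{ij}\partial_j\in\Gamma(\mathbb C^n,\mathrm{Der}(-\log D))$, $A=(a_{ij})\in\mathbb C^{n\times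 n}$. Let $G_D=\{A\in GL_n(\mathbb C)\mid A(D)=D\}$, with identity component $G_D^\circ$ and Lie algebra $\mathfrak g_D$. Let $H^*_A(L;\mathbb C)$ be the Lie algebra (Chevalley–Eilenberg) cohomology with trivial coefficients $\mathbb C$, and $H^*(X;\mathbb C)$ the singular cohomology of a topological space $X$. One says that the global logarithmic comparison theorem (GLCT) holds for $D$ if $H^*(\Gamma(\mathbb C^n,\Omega^\bullet(\log D)))\cong H^*(\mathbb C^n\setminus D;\mathbb C)$ as graded vector spaces. Statement. Let $D\subseteq\mathbb C^n$ be a linear free divisor. Then: (1) The inclusion of the subcomplex $\Gamma(\mathbb C^n,\Omega^\bullet(\log D))_0$ of forms that are homogeneous of degree $0$ (with $\deg x_i=\deg dx_i=1$) into $\Gamma(\mathbb C^n,\Omega^\bullet(\log D))$ is a quasi-isomorphism. (2) For $\omega\in\Gamma(\mathbb C^n,\Omega^k(\log D))_0$ and $\chi_1,\dots,\chi_k\in L_D$ the function $\omega(\chi_1,\dots,\chi_k)$ is constant on $\mathbb C^n\setminus D$, and sending $\omega$ to $(\chi_1,\dots,\chi_k)\mapsto\omega(\chi_1,\dots,\chi_k)$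 is an isomorphism of complexes from $\Gamma(\mathbb C^n,\Omega^\bullet(\log D))_0$ to the Chevalley–Eilenberg complex of $L_D$ with coefficients in $\mathbb C$. (3) $H^k(\Gamma(\mathbb C^n,\Omega^\bullet(\log D)))\cong H^k_A(L_D;\mathbb C)$ for every $k\ge 0$. (4) GLCT holds for $D$ if and only if $H^k(G_D^\circ;\mathbb C)\cong H^k_A(\mathfrak g_D;\mathbb C)$ for every $k\ge0$. -/

import Mathlib

open CategoryTheory

attribute [local instance] LieRing.ofAssociativeRing

noncomputable section

namespace LFD

section ChevalleyEilenberg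

variable (L : Type) [LieRing L] [LieAlgebra ℂ L]

/-- Contraction of an alternating form with `x` in the first slot. -/
abbrev ceInsert {L : Type} [LieRing L] [LieAlgebra ℂ L] {m : ℕ} (x : L) (ω : L [⋀^Fin (m + 1)]→ₗ[ℂ] ℂ) :
    L [⋀^Fin m]→ₗ[ℂ] ℂ := ω.curryLeft x

/-- Auxiliary form of the differential below, used only to see that it is alternating. -/
def ceDiffAux (m : ℕ) (ω : L [⋀^Fin (m + 1)]→ₗ[ℂ] ℂ) : L [⋀^Fin (m + 2)]→ₗ[ℂ] ℂ :=
  -(1 / 2 : ℂ) • AlternatingMap.alternatizeUncurryFin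
    (AlternatingMap.alternatizeUncurryFinLM ∘ₗ
      LinearMap.mk₂ ℂ (fun x y : L => ω.curryLeft ⁅x, y⁆) (by simp) (by simp) (by simp) (by simp))

theorem ceDiffAux_apply (m : ℕ) (ω : L [⋀^Fin (m + 1)]→ₗ[ℂ] ℂ) (v : Fin (m + 2) → L) :
    ceDiffAux L m ω v = -∑ i : Fin (m + 1), ∑ j ≥ i, (-1) ^ (i + j : ℕ) *
      ω (Matrix.vecCons ⁅v i.castSucc, v j.succ⁆ (j.removeNth (i.castSucc.removeNth v))) := by
  simp only [ceDiffAux, AlternatingMap.smul_apply]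
  rw [AlternatingMap.alternatizeUncurryFin_alternatizeUncurryFinLM_comp_apply]
  rw [neg_smul, Finset.smul_sum]
  congr 1
  refine Finset.sum_congr rfl fun i _ => ?_
  rw [Finset.smul_sum]
  refine Finset.sum_congr rfl fun j _ => ?_
  have h : ⁅v j.succ, v i.castSucc⁆ = -⁅v i.castSucc, v j.succ⁆ := (lie_skew _ _).symm
  simp only [LinearMap.mk₂_apply, h, map_neg,
    AlternatingMap.neg_apply, AlternatingMap.curryLeft_apply_apply]
  simp only [zsmul_eq_mul, smul_eq_mul]
  push_cast
  ring

/-- The Chevalley--Eilenberg differential (trivial coefficients) in degree `m + 1`: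
`(d ω)(v₀, …, v_{m+1}) = ∑_{a < b} (-1)^(a+b) ω([v_a, v_b], v₀, …, v̂_a, …, v̂_b, …, v_{m+1})`.
The pairs `a < b` are encoded as `a = i.castSucc`, `b = j.succ` with `i ≤ j`, so that
`(-1)^(a+b) = -(-1)^(i+j)`. -/
def ceDiffSucc (m : ℕ) (ω : L [⋀^Fin (m + 1)]→ₗ[ℂ] ℂ) : L [⋀^Fin (m + 2)]→ₗ[ℂ] ℂ where
  toFun v := -∑ i : Fin (m + 1), ∑ j ≥ i, (-1) ^ (i + j : ℕ) *
    ω (Matrix.vecCons ⁅v i.castSucc, v j.succ⁆ (j.removeNth (i.castSucc.removeNth v)))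
  map_update_add' v i x y := by
    have := Subsingleton.elim (‹DecidableEq (Fin (m + 2))›) (instDecidableEqFin _)
    subst this
    simpa only [ceDiffAux_apply] using (ceDiffAux L m ω).map_update_add v i x y
  map_update_smul' v i c x := by
    have := Subsingleton.elim (‹DecidableEq (Fin (m + 2))›) (instDecidableEqFin _)
    subst this
    simpa only [ceDiffAux_apply] using (ceDiffAux L m ω).map_update_smul v i c x
  map_eq_zero_of_eq' v i j h hij := by
    simpa only [ceDiffAux_apply] using (ceDiffAux L m ω).map_eq_zero_of_eq v h hij

theorem ceDiffSucc_apply (m : ℕ) (ω : L [⋀^Fin (m + 1)]→ₗ[ℂ] ℂ) (v : Fin (m + 2) → L) :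
    ceDiffSucc L m ω v = -∑ i : Fin (m + 1), ∑ j ≥ i, (-1) ^ (i + j : ℕ) *
      ω (Matrix.vecCons ⁅v i.castSucc, v j.succ⁆ (j.removeNth (i.castSucc.removeNth v))) := rfl

/-- The Chevalley--Eilenberg differential with trivial coefficients `ℂ`; it is zero in degree `0`. -/
def ceDiff : ∀ k : ℕ, (L [⋀^Fin k]→ₗ[ℂ] ℂ) →ₗ[ℂ] (L [⋀^Fin (k + 1)]→ₗ[ℂ] ℂ)
  | 0 => 0
  | m + 1 =>
    { toFun := ceDiffSucc L m
      map_add' := fun a b => by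
        ext v
        simp only [ceDiffSucc_apply, AlternatingMap.add_apply, mul_add, Finset.sum_add_distrib,
          neg_add]
      map_smul' := fun c a => by
        ext v
        simp only [ceDiffSucc_apply, AlternatingMap.smul_apply, smul_eq_mul, Finset.mul_sum,
          mul_neg, RingHom.id_apply, mul_left_comm] }

variable {L}
/-- Lie derivative on cochains (used only to prove that the differential squares to zero). -/
def ceLie (x : L) : ∀ k : ℕ, (L [⋀^Fin k]→ₗ[ℂ] ℂ) → (L [⋀^Fin k]→ₗ[ℂ] ℂ)
  | 0 => fun _ => 0
  | _ + 1 => fun ω => -AlternatingMap.alternatizeUncurryFin (ω.curryLeft ∘ₗ LieAlgebra.ad ℂ L x)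

theorem ceLie_succ_apply (x : L) (m : ℕ) (ω : L [⋀^Fin (m + 1)]→ₗ[ℂ] ℂ) (v : Fin (m + 1) → L) :
    ceLie x (m + 1) ω v = -∑ j : Fin (m + 1), (-1) ^ (j : ℕ) *
      ω (Matrix.vecCons ⁅x, v j⁆ (j.removeNth v)) := by
  simp only [ceLie, AlternatingMap.neg_apply, AlternatingMap.alternatizeUncurryFin_apply,
    zsmul_eq_mul, LinearMap.comp_apply, LieAlgebra.ad_apply, AlternatingMap.curryLeft_apply_apply]
  simp

theorem ceSwap {m : ℕ} (ω : L [⋀^Fin (m + 2)]→ₗ[ℂ] ℂ) (a b : L) (v : Fin m → L) :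
    ω (Matrix.vecCons a (Matrix.vecCons b v)) = -ω (Matrix.vecCons b (Matrix.vecCons a v)) := by
  have h := ω.map_swap (Matrix.vecCons b (Matrix.vecCons a v)) (i := 0) (j := 1) (by simp)
  rw [← h]
  congr 1
  ext i
  refine Fin.cases ?_ (fun i => ?_) i
  · simp
  · refine Fin.cases ?_ (fun i => ?_) i
    · simp
    · simp only [Function.comp_apply]
      rw [Equiv.swap_apply_of_ne_of_ne (by simp) (by
        intro h; simpa using congrArg Fin.val h)]
      simp

theorem removeNth_succ_vecCons {α : Type} {m : ℕ} (j : Fin (m + 1)) (a : α) (v : Fin (m + 1) → α) :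
    j.succ.removeNth (Matrix.vecCons a v : Fin (m + 2) → α) = Matrix.vecCons a (j.removeNth v) := by
  ext i
  refine Fin.cases ?_ (fun i => ?_) i <;> simp [Fin.removeNth]

theorem ceInsert_ceLie (x y : L) (m : ℕ) (ω : L [⋀^Fin (m + 1)]→ₗ[ℂ] ℂ) :
    ceInsert y (ceLie x (m + 1) ω) = ceLie x m (ceInsert y ω) - ceInsert ⁅x, y⁆ ω := by
  ext v
  simp only [AlternatingMap.curryLeft_apply_apply, AlternatingMap.sub_apply, ceLie_succ_apply]
  rw [Fin.sum_univ_succ]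
  cases m with
  | zero => simp [ceLie]
  | succ m =>
    simp only [ceLie_succ_apply, Matrix.cons_val_zero, Matrix.cons_val_succ,
      removeNth_succ_vecCons, AlternatingMap.curryLeft_apply_apply]
    simp only [ceSwap ω _ y]
    simp [pow_succ]
    ring

theorem ceInsert_ceDiff (x : L) (m : ℕ) (ω : L [⋀^Fin (m + 1)]→ₗ[ℂ] ℂ) :
    ceInsert x (ceDiff L (m + 1) ω) = ceLie x (m + 1) ω - ceDiff L m (ceInsert x ω) := by
  ext v
  simp only [AlternatingMap.curryLeft_apply_apply, AlternatingMap.sub_apply, ceLie_succ_apply]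
  change ceDiffSucc L m ω _ = _
  rw [ceDiffSucc_apply, Fin.sum_univ_succ]
  cases m with
  | zero => simp [ceDiff]
  | succ m =>
    change _ = _ - ceDiffSucc L m _ _
    rw [ceDiffSucc_apply]
    have hI : ∀ (N : ℕ) (i : Fin N) (f : Fin N → ℂ),
        ∑ j ≥ i, f j = ∑ j, if i ≤ j then f j else 0 := fun N i f => by
      rw [← Finset.sum_filter]
      exact Finset.sum_congr (by ext; simp) fun _ _ => rfl
    simp only [hI, Fin.zero_le, if_true]
    rw [neg_add, sub_eq_add_neg, neg_neg]
    congr 1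
    · simp [Fin.removeNth_zero]
    · rw [← Finset.sum_neg_distrib]
      refine Finset.sum_congr rfl fun i _ => ?_
      rw [Fin.sum_univ_succ, if_neg (by simp), zero_add, ← Finset.sum_neg_distrib]
      refine Finset.sum_congr rfl fun j _ => ?_
      simp only [Fin.succ_le_succ_iff]
      split_ifs with h
      · simp only [← Fin.succ_castSucc, removeNth_succ_vecCons, Matrix.cons_val_succ,
          AlternatingMap.curryLeft_apply_apply]
        rw [ceSwap ω x]
        have hp : (-1 : ℂ) ^ ((i : ℕ) + 1 + ((j : ℕ) + 1)) = (-1) ^ ((i : ℕ) + j) := by ring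
        simp [hp]
      · simp

theorem ceInsert_injective {m : ℕ} {ω η : L [⋀^Fin (m + 1)]→ₗ[ℂ] ℂ}
    (h : ∀ x, ceInsert x ω = ceInsert x η) : ω = η := by
  ext v
  have := congrArg (fun f => f (Matrix.vecTail v)) (h (v 0))
  simpa only [AlternatingMap.curryLeft_apply_apply, Matrix.cons_head_tail,
    show Matrix.vecCons (v 0) (Matrix.vecTail v) = v from Matrix.cons_head_tail v] using this

theorem ceLie_add (x : L) (m : ℕ) (ω η : L [⋀^Fin m]→ₗ[ℂ] ℂ) :
    ceLie x m (ω + η) = ceLie x m ω + ceLie x m η := by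
  cases m with
  | zero => simp [ceLie]
  | succ m => ext v; simp [ceLie_succ_apply, mul_add, Finset.sum_add_distrib]; ring

theorem ceLie_neg (x : L) (m : ℕ) (ω : L [⋀^Fin m]→ₗ[ℂ] ℂ) :
    ceLie x m (-ω) = -ceLie x m ω := by
  cases m with
  | zero => simp [ceLie]
  | succ m => ext v; simp [ceLie_succ_apply]

theorem ceLie_sub (x : L) (m : ℕ) (ω η : L [⋀^Fin m]→ₗ[ℂ] ℂ) :
    ceLie x m (ω - η) = ceLie x m ω - ceLie x m η := by
  rw [sub_eq_add_neg, ceLie_add, ceLie_neg, sub_eq_add_neg]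

theorem ceInsert_sub {m : ℕ} (x : L) (ω η : L [⋀^Fin (m + 1)]→ₗ[ℂ] ℂ) :
    ceInsert x (ω - η) = ceInsert x ω - ceInsert x η := by
  ext v; simp

theorem ceLie_comm (x y : L) (m : ℕ) (ω : L [⋀^Fin m]→ₗ[ℂ] ℂ) :
    ceLie x m (ceLie y m ω) - ceLie y m (ceLie x m ω) = ceLie ⁅x, y⁆ m ω := by
  induction m with
  | zero => simp [ceLie]
  | succ m ih =>
    refine ceInsert_injective fun z => ?_
    have hj : ceInsert ⁅⁅x, y⁆, z⁆ ω = ceInsert ⁅x, ⁅y, z⁆⁆ ω - ceInsert ⁅y, ⁅x, z⁆⁆ ω := by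
      simp only [ceInsert]
      rw [← map_sub, lie_lie]
    rw [ceInsert_sub]
    simp only [ceInsert_ceLie, ceLie_sub]
    rw [hj, ← ih]
    abel

theorem ceDiff_ceLie (x : L) (m : ℕ) (ω : L [⋀^Fin m]→ₗ[ℂ] ℂ) :
    ceDiff L m (ceLie x m ω) = ceLie x (m + 1) (ceDiff L m ω) := by
  induction m with
  | zero => ext v; simp [ceLie_succ_apply, ceDiff]
  | succ m ih =>
    refine ceInsert_injective fun z => ?_
    rw [ceInsert_ceDiff, ceInsert_ceLie, ceInsert_ceLie, ceInsert_ceDiff, ceInsert_ceDiff,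
      map_sub, ih, ceLie_sub, ← ceLie_comm]
    abel

theorem ceDiff_ceDiff (m : ℕ) (ω : L [⋀^Fin m]→ₗ[ℂ] ℂ) :
    ceDiff L (m + 1) (ceDiff L m ω) = 0 := by
  induction m with
  | zero => exact map_zero (ceDiff L 1)
  | succ m ih =>
    refine ceInsert_injective fun z => ?_
    rw [ceInsert_ceDiff, ceInsert_ceDiff, map_sub, ih, ceDiff_ceLie, sub_zero, sub_self]
    ext v
    simp

/-- The Chevalley--Eilenberg complex of `L` with trivial coefficients `ℂ`. -/
def ceComplex (L : Type) [LieRing L] [LieAlgebra ℂ L] : CochainComplex (ModuleCat.{0} ℂ) ℕ :=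
  CochainComplex.of (fun k => ModuleCat.of ℂ (L [⋀^Fin k]→ₗ[ℂ] ℂ))
    (fun k => ModuleCat.ofHom (ceDiff L k))
    (fun k => by
      rw [← ModuleCat.ofHom_comp,
        LinearMap.ext (f := ceDiff L (k + 1) ∘ₗ ceDiff L k) (g := 0) (ceDiff_ceDiff k)]
      rfl)

end ChevalleyEilenberg

/-- The ring `Γ(ℂⁿ, 𝒪)` of holomorphic functions on `ℂⁿ`. -/
def entireFunctions (n : ℕ) : Subalgebra ℂ ((Fin n → ℂ) → ℂ) where
  carrier := {f | AnalyticOnNhd ℂ f Set.univ}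
  mul_mem' hf hg := hf.mul hg
  add_mem' hf hg := hf.add hg
  algebraMap_mem' _ := analyticOnNhd_const

/-- `Δ` is a global defining equation of a reduced divisor: `Δ ≠ 0`, and `Δ` generates the ideal of
all holomorphic functions that vanish on `{Δ = 0}`. -/
structure IsReducedEquation {n : ℕ} (Δ : entireFunctions n) : Prop where
  ne_zero : Δ ≠ 0
  dvd_of_vanishing : ∀ f : entireFunctions n, (∀ x, Δ.1 x = 0 → f.1 x = 0) → Δ ∣ f

/-- The divisor `D = {Δ = 0} ⊆ ℂⁿ`. -/
def divisorSet {n : ℕ} (Δ : entireFunctions n) : Set (Fin n → ℂ) := {x | Δ.1 x = 0}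

/-- `Γ(ℂⁿ, Der(-log D))`: the holomorphic vector fields `v` on `ℂⁿ` with `v(Δ) ∈ 𝒪 · Δ`,
as a module over the ring of holomorphic functions. -/
def logVectorFields {n : ℕ} (Δ : entireFunctions n) :
    Submodule (entireFunctions n) ((Fin n → ℂ) → (Fin n → ℂ)) where
  carrier := {v | AnalyticOnNhd ℂ v Set.univ ∧
    ∃ α : entireFunctions n, ∀ x, fderiv ℂ Δ.1 x (v x) = α.1 x * Δ.1 x}
  add_mem' := by
    rintro v w ⟨hv, α, hα⟩ ⟨hw, β, hβ⟩
    exact ⟨hv.add hw, α + β, fun x => by simp [hα, hβ, add_mul]⟩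
  zero_mem' := ⟨analyticOnNhd_const, 0, fun x => by simp⟩
  smul_mem' := by
    rintro f v ⟨hv, α, hα⟩
    refine ⟨f.2.smul hv, f * α, fun x => ?_⟩
    have : (f • v) x = f.1 x • v x := rfl
    simp [this, hα, mul_assoc]

/-- The vector field `x A ∂ᵗ = ∑ x_i a_{ij} ∂_j` with linear coefficients. -/
def linearField {n : ℕ} (A : Matrix (Fin n) (Fin n) ℂ) : (Fin n → ℂ) → (Fin n → ℂ) :=
  fun x => Matrix.vecMul x A

/-- `D` is a linear free divisor: the module `Γ(ℂⁿ, Der(-log D))` has a basis `δ₁, …, δₙ` of vector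
fields with linear coefficients. -/
def IsLinearFree {n : ℕ} (Δ : entireFunctions n) : Prop :=
  ∃ b : Module.Basis (Fin n) (entireFunctions n) (logVectorFields Δ),
    ∀ i, ∃ A : Matrix (Fin n) (Fin n) ℂ, (b i : (Fin n → ℂ) → (Fin n → ℂ)) = linearField A

def linearFieldCLM {n : ℕ} (A : Matrix (Fin n) (Fin n) ℂ) : (Fin n → ℂ) →L[ℂ] (Fin n → ℂ) :=
  LinearMap.toContinuousLinearMap (Matrix.vecMulLinear A)

theorem linearFieldCLM_apply {n : ℕ} (A : Matrix (Fin n) (Fin n) ℂ) (x : Fin n → ℂ) :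
    linearFieldCLM A x = linearField A x := rfl

theorem fderiv_dir_linearField {n : ℕ} {f : (Fin n → ℂ) → ℂ} (hf : AnalyticOnNhd ℂ f Set.univ)
    (A : Matrix (Fin n) (Fin n) ℂ) (x w : Fin n → ℂ) :
    fderiv ℂ (fun y => fderiv ℂ f y (linearField A y)) x w =
      fderiv ℂ (fderiv ℂ f) x w (linearField A x) + fderiv ℂ f x (linearField A w) := by
  have h1 : DifferentiableAt ℂ (fderiv ℂ f) x :=
    ((hf.fderiv) x (Set.mem_univ x)).differentiableAt
  have h2 : HasFDerivAt (fun y => linearField A y) (linearFieldCLM A) x :=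
    (linearFieldCLM A).hasFDerivAt
  rw [(h1.hasFDerivAt.clm_apply h2).fderiv]
  simp [linearFieldCLM_apply, add_comm]

/-- The Lie algebra `L_D` of global logarithmic vector fields of degree zero, a vector field
`x A ∂ᵗ` being identified with its matrix `A`; the commutator of matrices is then the bracket of
vector fields. -/
def linearLogFields {n : ℕ} (Δ : entireFunctions n) :
    LieSubalgebra ℂ (Matrix (Fin n) (Fin n) ℂ) where
  carrier := {A | linearField A ∈ logVectorFields Δ}
  add_mem' := by
    intro A B hA hB
    have : linearField (A + B) = linearField A + linearField B := by
      ext1 x; exact Matrix.vecMul_add A B x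
    change linearField (A + B) ∈ logVectorFields Δ
    exact this ▸ add_mem hA hB
  zero_mem' := by
    have : linearField (0 : Matrix (Fin n) (Fin n) ℂ) = 0 := by
      ext1 x; exact Matrix.vecMul_zero x
    change linearField 0 ∈ logVectorFields Δ
    exact this ▸ zero_mem _
  smul_mem' := by
    intro c A hA
    have : linearField (c • A) = (algebraMap ℂ (entireFunctions n) c) • linearField A := by
      ext1 x; exact Matrix.vecMul_smul x c A
    change linearField (c • A) ∈ logVectorFields Δ
    exact this ▸ Submodule.smul_mem _ _ hA
  lie_mem' := by
    rintro A B ⟨-, α, hα⟩ ⟨-, β, hβ⟩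
    have hmem : ∀ (γ : entireFunctions n) (C : Matrix (Fin n) (Fin n) ℂ),
        AnalyticOnNhd ℂ (fun x => fderiv ℂ γ.1 x (linearField C x)) Set.univ := fun γ C =>
      fun x hx =>
      (ContinuousLinearMap.analyticAt_bilinear (ContinuousLinearMap.apply ℂ ℂ).flip _).comp₂
        (γ.2.fderiv x hx) ((linearFieldCLM C).analyticAt x)
    refine ⟨fun x _ => (linearFieldCLM _).analyticAt x,
      ⟨_, hmem β A⟩ - ⟨_, hmem α B⟩, fun x => ?_⟩
    have hd : ∀ γ : entireFunctions n, DifferentiableAt ℂ γ.1 x := fun γ =>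
      (γ.2 x (Set.mem_univ x)).differentiableAt
    have hsym : IsSymmSndFDerivAt ℂ Δ.1 x :=
      ((Δ.2 x (Set.mem_univ x)).contDiffAt (n := ⊤)).isSymmSndFDerivAt (by simp)
    have e1 := fderiv_dir_linearField Δ.2 B x (linearField A x)
    have e2 := fderiv_dir_linearField Δ.2 A x (linearField B x)
    rw [funext hβ, fderiv_fun_mul (hd β) (hd Δ)] at e1
    rw [funext hα, fderiv_fun_mul (hd α) (hd Δ)] at e2
    have hb : linearField ⁅A, B⁆ x = linearField B (linearField A x) -
        linearField A (linearField B x) := by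
      simp [linearField, Ring.lie_def, Matrix.vecMul_sub, Matrix.vecMul_vecMul]
    have hs := hsym.eq (linearField A x) (linearField B x)
    simp only [add_apply, smul_apply, smul_eq_mul,
      hα, hβ] at e1 e2
    rw [hb, map_sub]
    change _ = (fderiv ℂ β.1 x (linearField A x) - fderiv ℂ α.1 x (linearField B x)) * Δ.1 x
    linear_combination -hs - e1 + e2

/-- Differential `k`-forms on `ℂⁿ` (arbitrary functions, no regularity). -/
abbrev FormOn (n k : ℕ) : Type := (Fin n → ℂ) → (Fin n → ℂ) [⋀^Fin k]→L[ℂ] ℂ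

theorem extDeriv_analyticAt {n k : ℕ} {ω : FormOn n k} {x : Fin n → ℂ} (h : AnalyticAt ℂ ω x) :
    AnalyticAt ℂ (extDeriv ω) x := by
  exact ((ContinuousAlternatingMap.alternatizeUncurryFinCLM (n := k) ℂ (Fin n → ℂ) ℂ).analyticAt _).comp
    h.fderiv

theorem compl_divisor_nhds {n : ℕ} (Δ : entireFunctions n) {x : Fin n → ℂ} (hx : Δ.1 x ≠ 0) :
    ∀ᶠ y in nhds x, Δ.1 y ≠ 0 :=
  (Δ.2 x (Set.mem_univ x)).continuousAt.eventually_ne hx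

/-- `Γ(ℂⁿ, Ωᵏ(log D))`: the forms `ω` holomorphic on `ℂⁿ ∖ D` such that `Δ ω` and `Δ dω` extend to
holomorphic forms on `ℂⁿ`. A form on `ℂⁿ ∖ D` is represented by its extension by `0` to `D`. -/
def logForms {n : ℕ} (Δ : entireFunctions n) (k : ℕ) : Submodule ℂ (FormOn n k) where
  carrier := {ω | (∀ x, Δ.1 x = 0 → ω x = 0) ∧
    (∀ x, Δ.1 x ≠ 0 → AnalyticAt ℂ ω x) ∧
    (∃ η : FormOn n k, AnalyticOnNhd ℂ η Set.univ ∧ ∀ x, Δ.1 x ≠ 0 → Δ.1 x • ω x = η x) ∧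
    (∃ θ : FormOn n (k + 1), AnalyticOnNhd ℂ θ Set.univ ∧
      ∀ x, Δ.1 x ≠ 0 → Δ.1 x • extDeriv ω x = θ x)}
  add_mem' := by
    rintro ω₁ ω₂ ⟨h1, h2, ⟨η₁, h3, h4⟩, θ₁, h5, h6⟩ ⟨k1, k2, ⟨η₂, k3, k4⟩, θ₂, k5, k6⟩
    refine ⟨fun x hx => by simp [h1 x hx, k1 x hx], fun x hx => (h2 x hx).add (k2 x hx),
      ⟨η₁ + η₂, h3.add k3, fun x hx => by simp [← h4 x hx, ← k4 x hx]⟩,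
      θ₁ + θ₂, h5.add k5, fun x hx => ?_⟩
    rw [extDeriv_add (h2 x hx).differentiableAt (k2 x hx).differentiableAt]
    simp [← h6 x hx, ← k6 x hx]
  zero_mem' := by
    refine ⟨fun _ _ => rfl, fun x _ => analyticAt_const, ⟨0, analyticOnNhd_const, by simp⟩,
      0, analyticOnNhd_const, fun x _ => ?_⟩
    have : extDeriv (0 : FormOn n k) x = 0 := by
      simpa using extDeriv_smul (x := x) (0 : ℂ) (0 : FormOn n k)
    simp [this]
  smul_mem' := by
    rintro c ω ⟨h1, h2, ⟨η, h3, h4⟩, θ, h5, h6⟩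
    refine ⟨fun x hx => by simp [h1 x hx], fun x hx => analyticAt_const.smul (h2 x hx),
      ⟨c • η, fun x hx => analyticAt_const.smul (h3 x hx), fun x hx => by
        simp [← h4 x hx, smul_comm c]⟩,
      c • θ, fun x hx => analyticAt_const.smul (h5 x hx), fun x hx => ?_⟩
    rw [extDeriv_smul, smul_comm, h6 x hx]
    rfl

/-- The exterior derivative on `ℂⁿ ∖ D`, extended by `0` to `D`. -/
def logExtDeriv {n : ℕ} (Δ : entireFunctions n) {k : ℕ} (ω : FormOn n k) : FormOn n (k + 1) :=
  fun x => if Δ.1 x = 0 then 0 else extDeriv ω x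

theorem logExtDeriv_eventuallyEq {n : ℕ} (Δ : entireFunctions n) {k : ℕ} (ω : FormOn n k)
    {x : Fin n → ℂ} (hx : Δ.1 x ≠ 0) : logExtDeriv Δ ω =ᶠ[nhds x] extDeriv ω := by
  filter_upwards [compl_divisor_nhds Δ hx] with y hy
  simp [logExtDeriv, hy]

theorem extDeriv_logExtDeriv {n : ℕ} (Δ : entireFunctions n) {k : ℕ} {ω : FormOn n k}
    {x : Fin n → ℂ} (hx : Δ.1 x ≠ 0) (hω : AnalyticAt ℂ ω x) :
    extDeriv (logExtDeriv Δ ω) x = 0 := by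
  rw [(logExtDeriv_eventuallyEq Δ ω hx).extDeriv_eq]
  exact extDeriv_extDeriv_apply (hω.contDiffAt (n := ⊤)) (by simp)

theorem logExtDeriv_mem {n : ℕ} (Δ : entireFunctions n) {k : ℕ} {ω : FormOn n k}
    (hω : ω ∈ logForms Δ k) : logExtDeriv Δ ω ∈ logForms Δ (k + 1) := by
  obtain ⟨-, h2, -, θ, h5, h6⟩ := hω
  refine ⟨fun x hx => by simp [logExtDeriv, hx], fun x hx => ?_,
    ⟨θ, h5, fun x hx => by simp [logExtDeriv, hx, h6 x hx]⟩,
    0, analyticOnNhd_const, fun x hx => ?_⟩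
  · exact (extDeriv_analyticAt (h2 x hx)).congr (logExtDeriv_eventuallyEq Δ ω hx).symm
  · rw [extDeriv_logExtDeriv Δ hx (h2 x hx)]; simp

/-- The exterior derivative `Γ(ℂⁿ, Ωᵏ(log D)) → Γ(ℂⁿ, Ωᵏ⁺¹(log D))`. -/
def logD {n : ℕ} (Δ : entireFunctions n) (k : ℕ) : logForms Δ k →ₗ[ℂ] logForms Δ (k + 1) where
  toFun ω := ⟨logExtDeriv Δ ω.1, logExtDeriv_mem Δ ω.2⟩
  map_add' ω₁ ω₂ := by
    ext1; funext x
    by_cases hx : Δ.1 x = 0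
    · simp [logExtDeriv, hx]
    · simp only [logExtDeriv, hx, if_false, Submodule.coe_add, Pi.add_apply]
      exact extDeriv_add (ω₁.2.2.1 x hx).differentiableAt (ω₂.2.2.1 x hx).differentiableAt
  map_smul' c ω := by
    ext1; funext x
    by_cases hx : Δ.1 x = 0
    · simp only [logExtDeriv, hx, if_true, Submodule.coe_smul, Pi.smul_apply, RingHom.id_apply]
      exact (smul_zero (A := (Fin n → ℂ) [⋀^Fin (k + 1)]→L[ℂ] ℂ) c).symm
    · simp only [logExtDeriv, hx, if_false, Submodule.coe_smul, Pi.smul_apply, RingHom.id_apply]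
      exact extDeriv_smul c _

theorem logD_logD {n : ℕ} (Δ : entireFunctions n) (k : ℕ) (ω : logForms Δ k) :
    logD Δ (k + 1) (logD Δ k ω) = 0 := by
  ext1; funext x
  by_cases hx : Δ.1 x = 0
  · simp [logD, logExtDeriv, hx]
  · have := extDeriv_logExtDeriv Δ hx (ω.2.2.1 x hx)
    simpa [logD, logExtDeriv, hx] using this

/-- The complex `Γ(ℂⁿ, Ω^•(log D))`. -/
def logComplex {n : ℕ} (Δ : entireFunctions n) : CochainComplex (ModuleCat.{0} ℂ) ℕ :=
  CochainComplex.of (fun k => ModuleCat.of ℂ (logForms Δ k)) (fun k => ModuleCat.ofHom (logD Δ k))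
    (fun k => by
      rw [← ModuleCat.ofHom_comp]
      have : logD Δ (k + 1) ∘ₗ logD Δ k = 0 := LinearMap.ext (logD_logD Δ k)
      rw [this]; rfl)

/-- `Γ(ℂⁿ, Ωᵏ(log D))₀`: the logarithmic forms that are homogeneous of degree zero, where `x_i` and
`dx_i` have degree one, that is, that are invariant under pullback by `x ↦ t x`, `t ∈ ℂ^×`. -/
def degZeroForms {n : ℕ} (Δ : entireFunctions n) (k : ℕ) : Submodule ℂ (FormOn n k) where
  carrier := {ω | ω ∈ logForms Δ k ∧ ∀ (t : ℂ) (x : Fin n → ℂ),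
    t ≠ 0 → Δ.1 x ≠ 0 → Δ.1 (t • x) ≠ 0 → t ^ k • ω (t • x) = ω x}
  add_mem' h1 h2 := ⟨add_mem h1.1 h2.1, fun t x ht hx htx => by
    simp [← h1.2 t x ht hx htx, ← h2.2 t x ht hx htx]⟩
  zero_mem' := ⟨zero_mem _, fun t x _ _ _ => by simp⟩
  smul_mem' c ω h := ⟨Submodule.smul_mem _ c h.1, fun t x ht hx htx => by
    simp [← h.2 t x ht hx htx, smul_comm c]⟩

theorem degZeroForms_le {n : ℕ} (Δ : entireFunctions n) (k : ℕ) :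
    degZeroForms Δ k ≤ logForms Δ k := fun _ h => h.1

theorem logExtDeriv_mem_degZeroForms {n : ℕ} (Δ : entireFunctions n) (k : ℕ) {ω : FormOn n k}
    (hω : ω ∈ degZeroForms Δ k) : logExtDeriv Δ ω ∈ degZeroForms Δ (k + 1) := by
  refine ⟨logExtDeriv_mem Δ hω.1, fun t x ht hx htx => ?_⟩
  have hev : ω =ᶠ[nhds x] fun y => t ^ k • ω (t • y) := by
    have hc : ContinuousAt (fun y : Fin n → ℂ => t • y) x := by fun_prop
    filter_upwards [compl_divisor_nhds Δ hx, hc.eventually (compl_divisor_nhds Δ htx)] with y hy hty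
    exact (hω.2 t y ht hy hty).symm
  have hf : fderiv ℂ ω x = t ^ (k + 1) • fderiv ℂ ω (t • x) := by
    rw [hev.fderiv_eq]
    have hd : HasFDerivAt (fun y => t ^ k • ω (t • y)) _ x :=
      (((hω.1.2.1 _ htx).differentiableAt.hasFDerivAt).comp x
        ((hasFDerivAt_id x).const_smul t)).const_smul (t ^ k)
    rw [hd.fderiv]
    ext1 v
    simp [pow_succ, smul_smul]
  simp only [logExtDeriv, hx, htx, if_false, extDeriv, hf]
  exact (ContinuousAlternatingMap.alternatizeUncurryFin_smul ..).symm

/-- The exterior derivative on forms of degree zero. -/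
def degZeroD {n : ℕ} (Δ : entireFunctions n) (k : ℕ) :
    degZeroForms Δ k →ₗ[ℂ] degZeroForms Δ (k + 1) where
  toFun ω := ⟨logExtDeriv Δ ω.1, logExtDeriv_mem_degZeroForms Δ k ω.2⟩
  map_add' ω₁ ω₂ := by
    have h := congrArg Subtype.val ((logD Δ k).map_add
      (Submodule.inclusion (degZeroForms_le Δ k) ω₁)
      (Submodule.inclusion (degZeroForms_le Δ k) ω₂))
    exact Subtype.ext h
  map_smul' c ω := by
    have h := congrArg Subtype.val ((logD Δ k).map_smul c
      (Submodule.inclusion (degZeroForms_le Δ k) ω))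
    exact Subtype.ext h

theorem degZeroD_degZeroD {n : ℕ} (Δ : entireFunctions n) (k : ℕ) (ω : degZeroForms Δ k) :
    degZeroD Δ (k + 1) (degZeroD Δ k ω) = 0 := by
  have h := congrArg Subtype.val (logD_logD Δ k (Submodule.inclusion (degZeroForms_le Δ k) ω))
  exact Subtype.ext h

/-- The complex `Γ(ℂⁿ, Ω^•(log D))₀`. -/
def degZeroComplex {n : ℕ} (Δ : entireFunctions n) : CochainComplex (ModuleCat.{0} ℂ) ℕ :=
  CochainComplex.of (fun k => ModuleCat.of ℂ (degZeroForms Δ k))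
    (fun k => ModuleCat.ofHom (degZeroD Δ k))
    (fun k => by
      rw [← ModuleCat.ofHom_comp, LinearMap.ext (f := degZeroD Δ (k + 1) ∘ₗ degZeroD Δ k) (g := 0)
        (degZeroD_degZeroD Δ k)]
      rfl)

/-- The inclusion `Γ(ℂⁿ, Ω^•(log D))₀ → Γ(ℂⁿ, Ω^•(log D))`. -/
def degZeroInclusion {n : ℕ} (Δ : entireFunctions n) : degZeroComplex Δ ⟶ logComplex Δ :=
  CochainComplex.ofHom
    (fun k => ModuleCat.ofHom (Submodule.inclusion (degZeroForms_le Δ k)))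
    (fun k => by
      simp only [degZeroComplex, logComplex, CochainComplex.of_d]
      rfl)

/-- The singular cochain complex of `X` with complex coefficients (the dual of the singular chains). -/
def singularCochainComplex (X : Type) [TopologicalSpace X] : CochainComplex (ModuleCat.{0} ℂ) ℕ :=
  let K := ((AlgebraicTopology.singularChainComplexFunctor (ModuleCat.{0} ℂ)).obj
    (ModuleCat.of ℂ ℂ)).obj (TopCat.of X)
  CochainComplex.of (fun k => ModuleCat.of ℂ (Module.Dual ℂ (K.X k)))
    (fun k => ModuleCat.ofHom (K.d (k + 1) k).hom.dualMap)
    (fun k => by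
      rw [← ModuleCat.ofHom_comp, LinearMap.dualMap_comp_dualMap, ← ModuleCat.hom_comp,
        K.d_comp_d]
      ext : 1
      exact LinearMap.ext fun f => LinearMap.ext fun x => map_zero f)

/-- The group `G_D = {A ∈ GLₙ(ℂ) | A(D) = D}`. -/
def stabilizerGroup {n : ℕ} (D : Set (Fin n → ℂ)) : Subgroup (GL (Fin n) ℂ) where
  carrier := {g | (fun x => Matrix.mulVec g.1 x) '' D = D}
  mul_mem' := by
    intro g h hg hh
    change _ '' D = D at hg hh
    change (fun x => Matrix.mulVec (g * h).1 x) '' D = D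
    conv_rhs => rw [← hg, ← hh, Set.image_image]
    simp [Matrix.mulVec_mulVec]
  one_mem' := by simp
  inv_mem' := by
    intro g hg
    change _ '' D = D at hg
    change (fun x => Matrix.mulVec (g⁻¹).1 x) '' D = D
    conv_lhs => rw [← hg, Set.image_image]
    simp [Matrix.mulVec_mulVec]

/-- The identity component of `G_D`. -/
abbrev identityComponent {n : ℕ} (D : Set (Fin n → ℂ)) : Subgroup (stabilizerGroup D) :=
  Subgroup.connectedComponentOfOne (stabilizerGroup D)

/-- The Lie algebra of a closed (complex algebraic) subgroup `G` of `GLₙ(ℂ)`: all `A` with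
`exp(tA) ∈ G` for every real `t`. For such a group this set is already a complex Lie algebra,
so that passing to the span only packages it; a group and its identity component have the same
Lie algebra. -/
def linearGroupLieAlgebra {n : ℕ} (G : Subgroup (GL (Fin n) ℂ)) :
    LieSubalgebra ℂ (Matrix (Fin n) (Fin n) ℂ) :=
  LieSubalgebra.lieSpan ℂ _
    {A | ∀ t : ℝ, ∃ g ∈ G, (g : Matrix (Fin n) (Fin n) ℂ) = NormedSpace.exp ((t : ℂ) • A)}

/-- `H^k(Γ(ℂⁿ, Ω^•(log D)))`. -/
def logCohomology {n : ℕ} (Δ : entireFunctions n) (k : ℕ) : ModuleCat.{0} ℂ :=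
  (logComplex Δ).homology k

/-- The Lie algebra cohomology `H^k_A(L; ℂ)` with trivial coefficients. -/
def lieCohomology (L : Type) [LieRing L] [LieAlgebra ℂ L] (k : ℕ) : ModuleCat.{0} ℂ :=
  (ceComplex L).homology k

/-- The singular cohomology `H^k(X; ℂ)`. -/
def singularCohomology (X : Type) [TopologicalSpace X] (k : ℕ) : ModuleCat.{0} ℂ :=
  (singularCochainComplex X).homology k

/-- The global logarithmic comparison theorem holds for `D`:
`H^*(Γ(ℂⁿ, Ω^•(log D))) ≅ H^*(ℂⁿ ∖ D; ℂ)` as graded vector spaces. -/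
def SatisfiesGLCT {n : ℕ} (Δ : entireFunctions n) : Prop :=
  ∀ k, Nonempty (logCohomology Δ k ≅ singularCohomology ↥(divisorSet Δ)ᶜ k)

end LFD

end

open LFD

/-!
Contraction with a basis of linear logarithmic fields identifies a logarithmic `k`-form with an
alternating map on `L_D` with entire values, and the exterior derivative with the
Chevalley-Eilenberg differential. The Euler field is a central element of `L_D` that acts on the
homogeneous part of degree `m` of the coefficients as multiplication by `m`. By Cartan's formula,
contraction with it, divided by the degree, is a homotopy that retracts the complex onto degree `0`,
where the coefficients are constants: this gives (1)-(3).

For (4), the transposed matrices of `L_D` are the Lie algebra of `G_D`. All orbits of `G_D°` in the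
connected complement of `D` are open, so `G_D°` acts transitively on it. The isotropy group is
algebraic and discrete, hence finite, and the orbit map is a finite covering with deck
transformations right translations in the path connected group `G_D°`. The transfer shows that such
a covering induces isomorphisms in complex cohomology.
-/

noncomputable section

namespace LFD

section AlternatingMaps

variable {𝕜 E F ι : Type*} [NontriviallyNormedField 𝕜] [CompleteSpace 𝕜]
  [NormedAddCommGroup E] [NormedSpace 𝕜 E] [FiniteDimensional 𝕜 E]
  [NormedAddCommGroup F] [NormedSpace 𝕜 F] [Finite ι]

theorem continuous_multilinearMap_of_finiteDimensional (φ : MultilinearMap 𝕜 (fun _ : ι => E) F) :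
    Continuous φ := by
  classical
  have := Fintype.ofFinite ι
  let b := Module.finBasis 𝕜 E
  have expansion : (φ : (ι → E) → F) = fun v => ∑ r : ι → Fin (Module.finrank 𝕜 E),
      (∏ i, b.coord (r i) (v i)) • φ fun i => b (r i) := by
    funext v
    conv_lhs => rw [show v = fun i => ∑ j, b.coord j (v i) • b j from
      funext fun i => (b.sum_repr (v i)).symm]
    exact (φ.map_sum _).trans (Finset.sum_congr rfl fun r _ => φ.map_smul_univ _ _)
  have hcoord (j) : Continuous (b.coord j) := LinearMap.continuous_of_finiteDimensional _
  rw [expansion]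
  fun_prop

/-- An alternating map on a finite dimensional space, with its automatic continuity. -/
def toContinuousAlternatingMap (φ : E [⋀^ι]→ₗ[𝕜] F) : E [⋀^ι]→L[𝕜] F :=
  { φ with cont := continuous_multilinearMap_of_finiteDimensional φ.toMultilinearMap }

instance finiteDimensional_continuousAlternatingMap [FiniteDimensional 𝕜 F] :
    FiniteDimensional 𝕜 (E [⋀^ι]→L[𝕜] F) :=
  let toMultilinear : (E [⋀^ι]→L[𝕜] F) →ₗ[𝕜] MultilinearMap 𝕜 (fun _ : ι => E) F :=
    { toFun := fun ω => ω.toMultilinearMap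
      map_add' := fun _ _ => rfl
      map_smul' := fun _ _ => rfl }
  .of_injective toMultilinear fun _ _ h =>
    ContinuousAlternatingMap.ext fun v => congrArg (fun φ => φ v) h

end AlternatingMaps

section Analytic

variable {𝕜 X E F ι : Type*} [NontriviallyNormedField 𝕜] [NormedAddCommGroup X] [NormedSpace 𝕜 X]
  [NormedAddCommGroup E] [NormedSpace 𝕜 E] [NormedAddCommGroup F] [NormedSpace 𝕜 F] [Fintype ι]

theorem analyticAt_alternatingMap_apply {ω : X → E [⋀^ι]→L[𝕜] F} {v : ι → X → E} {x : X}
    (hω : AnalyticAt 𝕜 ω x) (hv : ∀ i, AnalyticAt 𝕜 (v i) x) :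
    AnalyticAt 𝕜 (fun y => ω y fun i => v i y) x := by
  let toMultilinear : (E [⋀^ι]→L[𝕜] F) →L[𝕜] ContinuousMultilinearMap 𝕜 (fun _ : ι => E) F :=
    ContinuousAlternatingMap.toContinuousMultilinearMapCLM 𝕜
  exact (toMultilinear.analyticAt_uncurry_of_multilinear (x := (ω x, fun i => v i x))).comp_of_eq
    (hω.prod (.pi hv)) rfl

theorem analyticAt_of_forall_apply [CompleteSpace 𝕜] [FiniteDimensional 𝕜 E]
    [FiniteDimensional 𝕜 F] {ω : X → E [⋀^ι]→L[𝕜] F} {x : X}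
    (h : ∀ v, AnalyticAt 𝕜 (fun y => ω y v) x) : AnalyticAt 𝕜 ω x := by
  classical
  let b := Module.finBasis 𝕜 E
  let coords : (E [⋀^ι]→L[𝕜] F) →ₗ[𝕜] (ι → Fin (Module.finrank 𝕜 E)) → F :=
    { toFun := fun ω r => ω fun i => b (r i)
      map_add' := fun _ _ => rfl
      map_smul' := fun _ _ => rfl }
  have injective : Function.Injective coords := fun ω η h =>
    ContinuousAlternatingMap.toAlternatingMap_injective
      (b.ext_alternating fun r _ => congrFun h r)
  obtain ⟨g, hg⟩ := coords.exists_leftInverse_of_injective (LinearMap.ker_eq_bot.2 injective)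
  have factor : ω = fun y => LinearMap.toContinuousLinearMap g (coords (ω y)) :=
    funext fun y => (LinearMap.congr_fun hg (ω y)).symm
  rw [factor]
  exact (ContinuousLinearMap.analyticAt _ _).comp (analyticAt_pi_iff.2 fun r => h _)

end Analytic

section Segment

variable {E F : Type*} [NormedAddCommGroup E] [NormedAddCommGroup F]

theorem eq_zero_of_norm_fderiv_le_on_segment [NormedSpace ℝ E] [NormedSpace ℝ F] {u : E → F}
    (hu : Differentiable ℝ u) {x y : E} {K : ℝ}
    (hK : ∀ z ∈ segment ℝ x y, ‖fderiv ℝ u z (y - x)‖ ≤ K * ‖u z‖) (hx : u x = 0) : u y = 0 := by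
  let γ : ℝ → E := AffineMap.lineMap x y
  have hderiv (t : ℝ) : HasDerivAt (fun t => u (γ t)) (fderiv ℝ u (γ t) (y - x)) t :=
    (hu (γ t)).hasFDerivAt.comp_hasDerivAt t AffineMap.hasDerivAt_lineMap
  have h1 := eq_zero_of_abs_deriv_le_mul_abs_self_of_eq_zero_right (f := fun t => u (γ t)) (a := 0)
    (b := 1) (fun t _ => (hderiv t).continuousAt.continuousWithinAt)
    (fun t _ => (hderiv t).hasDerivWithinAt) (by simpa [γ] using hx)
    (fun t ht => hK _ (by
      rw [segment_eq_image_lineMap]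
      exact Set.mem_image_of_mem _ (Set.Ico_subset_Icc_self ht))) 1 (by simp)
  simpa [γ] using h1

/-- The logarithmic derivative of `u` would be bounded near a zero of `u` where `f ≠ 0`. -/
theorem eventually_eq_zero_of_dvd_mul_fderiv [NormedSpace ℂ E] {u f : E → ℂ}
    (hu : Differentiable ℂ u) (hf : Continuous f)
    (h : ∀ v : E, ∃ g : E → ℂ, Continuous g ∧ ∀ x, fderiv ℂ u x v * f x = u x * g x) {x : E}
    (hx : u x = 0) (hfx : f x ≠ 0) : ∀ᶠ y in nhds x, u y = 0 := by
  let _ : NormedSpace ℝ E := .restrictScalars ℝ ℂ E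
  obtain ⟨r, hr, hball⟩ := Metric.eventually_nhds_iff_ball.1 (hf.continuousAt.eventually_ne hfx)
  filter_upwards [Metric.ball_mem_nhds x hr] with y hy
  obtain ⟨g, hg, hfg⟩ := h (y - x)
  have hne : ∀ z ∈ segment ℝ x y, f z ≠ 0 := fun z hz =>
    hball z ((convex_ball x r).segment_subset (Metric.mem_ball_self hr) hy hz)
  have hcompact : IsCompact (segment ℝ x y) := by
    rw [segment_eq_image_lineMap]
    exact isCompact_Icc.image AffineMap.lineMap_continuous
  obtain ⟨K, hK⟩ := hcompact.exists_bound_of_continuousOn (hg.continuousOn.div hf.continuousOn hne)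
  refine eq_zero_of_norm_fderiv_le_on_segment (hu.restrictScalars ℝ) (K := K) (fun z hz => ?_) hx
  have quotient : fderiv ℂ u z (y - x) = g z / f z * u z := by
    have := hfg z
    field_simp [hne z hz]
    linear_combination this
  rw [((hu z).hasFDerivAt.restrictScalars ℝ).fderiv, ContinuousLinearMap.coe_restrictScalars',
    quotient, norm_mul]
  exact mul_le_mul_of_nonneg_right (hK z hz) (norm_nonneg _)

end Segment

section EntireFunctions

variable {n : ℕ} {Δ : entireFunctions n}

theorem entire_differentiable (f : entireFunctions n) : Differentiable ℂ f.1 :=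
  fun x => (f.2 x (Set.mem_univ x)).differentiableAt

theorem entire_continuous (f : entireFunctions n) : Continuous f.1 :=
  (entire_differentiable f).continuous

theorem eq_zero_of_eventually_eq_zero {f : entireFunctions n} {x : Fin n → ℂ}
    (h : ∀ᶠ y in nhds x, f.1 y = 0) : f = 0 :=
  Subtype.ext <| funext fun y =>
    f.2.eqOn_zero_of_preconnected_of_eventuallyEq_zero isPreconnected_univ (Set.mem_univ x) h
      (Set.mem_univ y)

theorem fderiv_apply_analyticOnNhd (f : entireFunctions n)
    {v : (Fin n → ℂ) → (Fin n → ℂ)} (hv : AnalyticOnNhd ℂ v Set.univ) :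
    AnalyticOnNhd ℂ (fun x => fderiv ℂ f.1 x (v x)) Set.univ := fun x hx =>
  (ContinuousLinearMap.analyticAt_bilinear (ContinuousLinearMap.apply ℂ ℂ).flip _).comp₂
    (f.2.fderiv x hx) (hv x hx)

theorem dense_compl_divisorSet (h : Δ ≠ 0) : Dense (divisorSet Δ)ᶜ := by
  intro x
  rw [mem_closure_iff_frequently]
  exact fun hx => h (eq_zero_of_eventually_eq_zero
    (hx.mono fun y hy => not_not.1 hy))

theorem eq_of_eq_off_divisorSet (h : Δ ≠ 0) {F : Type*} [TopologicalSpace F] [T2Space F]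
    {f g : (Fin n → ℂ) → F} (hf : Continuous f) (hg : Continuous g)
    (hfg : ∀ x, Δ.1 x ≠ 0 → f x = g x) : f = g :=
  Continuous.ext_on (dense_compl_divisorSet h) hf hg hfg

theorem vanishes_of_dvd_mul_fderiv (hΔ : Δ ≠ 0) {f : (Fin n → ℂ) → ℂ} (hf : Continuous f)
    (h : ∀ v : Fin n → ℂ, ∃ g : (Fin n → ℂ) → ℂ, Continuous g ∧
      ∀ x, fderiv ℂ Δ.1 x v * f x = Δ.1 x * g x) {x : Fin n → ℂ} (hx : Δ.1 x = 0) : f x = 0 :=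
  by_contra fun hfx => hΔ <| eq_zero_of_eventually_eq_zero <|
    eventually_eq_zero_of_dvd_mul_fderiv (entire_differentiable Δ) hf h hx hfx

theorem IsReducedEquation.exists_eq_smul_of_vanishes (hΔ : IsReducedEquation Δ) {W : Type*}
    [NormedAddCommGroup W] [NormedSpace ℂ W] [FiniteDimensional ℂ W] {η : (Fin n → ℂ) → W}
    (hη : AnalyticOnNhd ℂ η Set.univ) (h : ∀ x, Δ.1 x = 0 → η x = 0) :
    ∃ θ : (Fin n → ℂ) → W, AnalyticOnNhd ℂ θ Set.univ ∧ ∀ x, η x = Δ.1 x • θ x := by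
  let b := Module.finBasis ℂ W
  have hcoord (i) : AnalyticOnNhd ℂ (fun x => b.coord i (η x)) Set.univ := fun x hx =>
    ((LinearMap.toContinuousLinearMap (b.coord i)).analyticAt _).comp (hη x hx)
  choose d hd using fun i => hΔ.dvd_of_vanishing ⟨_, hcoord i⟩ fun x hx => by simp [h x hx]
  refine ⟨fun x => ∑ i, (d i).1 x • b i, fun x hx =>
    Finset.analyticAt_fun_sum _ fun i _ => ((d i).2 x hx).smul analyticAt_const, fun x => ?_⟩
  rw [← b.sum_repr (η x), Finset.smul_sum]
  refine Finset.sum_congr rfl fun i _ => ?_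
  rw [smul_smul]
  exact congrArg (· • b i) (congrFun (congrArg Subtype.val (hd i)) x)

end EntireFunctions

section Taylor

variable {E F : Type*} [NormedAddCommGroup E] [NormedSpace ℂ E] [NormedAddCommGroup F]
  [NormedSpace ℂ F] {f : E → F}

theorem iteratedDeriv_comp_smul_zero (hf : AnalyticOnNhd ℂ f Set.univ) (x : E) (m : ℕ) :
    iteratedDeriv m (fun z : ℂ => f (z • x)) 0 = iteratedFDeriv ℂ m f 0 fun _ => x := by
  have := ContinuousLinearMap.iteratedFDeriv_comp_right
    ((ContinuousLinearMap.id ℂ ℂ).smulRight x) (hf.contDiff (n := m)) (0 : ℂ) le_rfl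
  rw [iteratedDeriv_eq_iteratedFDeriv,
    show (fun z : ℂ => f (z • x)) = f ∘ (ContinuousLinearMap.id ℂ ℂ).smulRight x from rfl, this]
  simp

theorem hasDerivAt_comp_smul (hf : AnalyticOnNhd ℂ f Set.univ) (x : E) (z : ℂ) :
    HasDerivAt (fun z : ℂ => f (z • x)) (fderiv ℂ f (z • x) x) z :=
  (hf _ (Set.mem_univ (z • x))).differentiableAt.hasFDerivAt.comp_hasDerivAt z
    (by simpa using (hasDerivAt_id z).smul_const x)

variable [CompleteSpace F]

theorem norm_iteratedFDeriv_le_of_bound (hf : AnalyticOnNhd ℂ f Set.univ) {R C ρ : ℝ} (hρ : 0 < ρ)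
    (hC : ∀ y ∈ Metric.closedBall 0 R, ‖f y‖ ≤ C) (j : ℕ) :
    ∀ x ∈ Metric.closedBall (0 : E) (R - j * ρ), ‖iteratedFDeriv ℂ j f x‖ ≤ C * (2 / ρ) ^ j := by
  induction j with
  | zero => intro x hx; simpa using hC x (by simpa using hx)
  | succ j ih =>
    intro x hx
    have hsub {y} (hy : y ∈ Metric.closedBall x ρ) :
        y ∈ Metric.closedBall (0 : E) (R - j * ρ) := by
      rw [mem_closedBall_zero_iff] at hx ⊢
      rw [mem_closedBall_iff_norm] at hy
      have := norm_le_norm_add_norm_sub' y x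
      push_cast at hx
      linarith
    have hx' := ih x (hsub (Metric.mem_closedBall_self hρ.le))
    rw [← norm_fderiv_iteratedFDeriv, pow_succ, ← mul_assoc, mul_div_assoc', mul_comm _ (2 : ℝ)]
    refine Complex.norm_fderiv_le_div_of_mapsTo_ball
      (fun y _ => (hf.iteratedFDeriv j y
        (Set.mem_univ y)).differentiableAt.differentiableWithinAt) (fun y hy => ?_) hρ
    rw [mem_closedBall_iff_norm]
    linarith [norm_sub_le (iteratedFDeriv ℂ j f y) (iteratedFDeriv ℂ j f x),
      ih y (hsub (Metric.ball_subset_closedBall hy))]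

/-- Cauchy's estimate is applied `m` times, on balls of radius proportional to `1 / m`. -/
theorem norm_iteratedFDeriv_zero_mul_pow_le (hf : AnalyticOnNhd ℂ f Set.univ) {r C : ℝ}
    (hr : 0 < r) (hC : ∀ y ∈ Metric.closedBall 0 (2 * r * Real.exp 1), ‖f y‖ ≤ C) (m : ℕ) :
    ‖iteratedFDeriv ℂ m f 0‖ * r ^ m ≤ C * m.factorial := by
  rcases m.eq_zero_or_pos with rfl | hm
  · simpa using hC 0 (Metric.mem_closedBall_self (by positivity))
  have hC0 : 0 ≤ C := (norm_nonneg _).trans (hC 0 (Metric.mem_closedBall_self (by positivity)))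
  have hm' : (0 : ℝ) < m := mod_cast hm
  have stirling : (m : ℝ) ^ m / Real.exp 1 ^ m ≤ m.factorial := by
    have := Real.pow_div_factorial_le_exp (m : ℝ) hm'.le m
    rw [← mul_one (m : ℝ), Real.exp_nat_mul, mul_one, div_le_iff₀ (by positivity)] at this
    rwa [div_le_iff₀ (by positivity), mul_comm]
  calc ‖iteratedFDeriv ℂ m f 0‖ * r ^ m
      ≤ C * (2 / (2 * r * Real.exp 1 / m)) ^ m * r ^ m := by
        gcongr
        refine norm_iteratedFDeriv_le_of_bound hf (by positivity) hC m 0 ?_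
        rw [mul_div_cancel₀ _ hm'.ne', sub_self]
        simp
    _ = C * ((m : ℝ) ^ m / Real.exp 1 ^ m) := by
        rw [mul_assoc, ← mul_pow, ← div_pow]
        congr 2
        field_simp
    _ ≤ C * m.factorial := by gcongr

theorem hasSum_taylor_of_entire (hf : AnalyticOnNhd ℂ f Set.univ) (x : E) :
    HasSum (fun m : ℕ => (m.factorial : ℂ)⁻¹ • iteratedFDeriv ℂ m f 0 fun _ => x) (f x) := by
  simpa [iteratedDeriv_comp_smul_zero hf] using Complex.hasSum_taylorSeries_of_entire
    (fun z => (hasDerivAt_comp_smul hf x z).differentiableAt) 0 1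

theorem hasSum_fderiv_self_of_entire (hf : AnalyticOnNhd ℂ f Set.univ) (x : E) :
    HasSum (fun m : ℕ => (m.factorial : ℂ)⁻¹ • iteratedFDeriv ℂ (m + 1) f 0 fun _ => x)
      (fderiv ℂ f x x) := by
  have hline : Differentiable ℂ fun z : ℂ => f (z • x) :=
    fun z => (hasDerivAt_comp_smul hf x z).differentiableAt
  have := Complex.hasSum_taylorSeries_of_entire
    (hline.contDiff.differentiable_deriv_two) 0 1
  simpa [← iteratedDeriv_succ', iteratedDeriv_comp_smul_zero hf,
    (hasDerivAt_comp_smul hf x 1).deriv] using this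

theorem eq_apply_zero_of_fderiv_self_eq_zero (hf : AnalyticOnNhd ℂ f Set.univ)
    (h : ∀ x, fderiv ℂ f x x = 0) (x : E) : f x = f 0 := by
  have hline : Differentiable ℂ fun z : ℂ => f (z • x) :=
    fun z => (hasDerivAt_comp_smul hf x z).differentiableAt
  have hne : ∀ z ∈ ({0}ᶜ : Set ℂ), deriv (fun z : ℂ => f (z • x)) z = 0 := fun z hz => by
    rw [(hasDerivAt_comp_smul hf x z).deriv]
    simpa [map_smul, show z ≠ 0 from hz] using h (z • x)
  have hderiv := (hline.contDiff (n := 1)).continuous_deriv_one.ext_on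
    (dense_compl_singleton (0 : ℂ)) continuous_const hne
  simpa using is_const_of_deriv_eq_zero hline (congrFun hderiv) 1 0

/-- The power series at the origin whose derivative along the Euler field `∑ x_i ∂_i` is the Taylor
series of `f - f 0`; its constant term is `0` because `0⁻¹ = 0`. -/
def eulerSeries (f : E → F) : FormalMultilinearSeries ℂ E F := fun m =>
  ((m : ℂ)⁻¹ * (m.factorial : ℂ)⁻¹) • iteratedFDeriv ℂ m f 0

theorem eulerSeries_radius [ProperSpace E] (hf : AnalyticOnNhd ℂ f Set.univ) :
    (eulerSeries f).radius = ⊤ := by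
  refine ENNReal.eq_top_of_forall_nnreal_le fun r => ?_
  refine le_trans (by exact_mod_cast le_self_add : (r : ENNReal) ≤ ((r + 1 : NNReal) : ENNReal)) ?_
  obtain ⟨C, hC⟩ := (isCompact_closedBall (0 : E)
    (2 * ((r + 1 : NNReal) : ℝ) * Real.exp 1)).exists_bound_of_continuousOn
    (hf.continuousOn.mono (Set.subset_univ _))
  refine FormalMultilinearSeries.le_radius_of_bound _ C fun m => ?_
  calc ‖eulerSeries f m‖ * ((r + 1 : NNReal) : ℝ) ^ m
      = (m : ℝ)⁻¹ * ((m.factorial : ℝ)⁻¹ *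
        (‖iteratedFDeriv ℂ m f 0‖ * ((r + 1 : NNReal) : ℝ) ^ m)) := by
        simp only [eulerSeries, norm_smul, norm_mul, norm_inv, Complex.norm_natCast, mul_assoc]
    _ ≤ 1 * ((m.factorial : ℝ)⁻¹ * (C * m.factorial)) := by
        refine mul_le_mul (Nat.cast_inv_le_one m) ?_ (by positivity) zero_le_one
        exact mul_le_mul_of_nonneg_left
          (norm_iteratedFDeriv_zero_mul_pow_le hf (by positivity) hC m) (by positivity)
    _ = C := by field_simp

theorem exists_fderiv_self_eq_sub [ProperSpace E] (hf : AnalyticOnNhd ℂ f Set.univ) :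
    ∃ g : E → F, AnalyticOnNhd ℂ g Set.univ ∧ (∀ x, fderiv ℂ g x x = f x - f 0) ∧ g 0 = 0 := by
  have hs := (eulerSeries f).hasFPowerSeriesOnBall (by rw [eulerSeries_radius hf]; simp)
  rw [eulerSeries_radius hf] at hs
  have hg : AnalyticOnNhd ℂ (eulerSeries f).sum Set.univ := by
    simpa only [Metric.eball_top] using hs.analyticOnNhd
  have coeff (m : ℕ) (x : E) : (iteratedFDeriv ℂ m (eulerSeries f).sum 0 fun _ => x) =
      (m : ℂ)⁻¹ • iteratedFDeriv ℂ m f 0 fun _ => x := by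
    have hm : (m.factorial : ℂ) ≠ 0 := by exact_mod_cast m.factorial_ne_zero
    rw [← hs.factorial_smul x m, eulerSeries, ← Nat.cast_smul_eq_nsmul ℂ, smul_apply, smul_smul]
    congr 1
    field_simp
  refine ⟨(eulerSeries f).sum, hg, fun x => ?_, by simpa using coeff 0 0⟩
  have terms (m : ℕ) : ((m + 1).factorial : ℂ)⁻¹ • (iteratedFDeriv ℂ (m + 1) f 0 fun _ => x) =
      (m.factorial : ℂ)⁻¹ • iteratedFDeriv ℂ (m + 1) (eulerSeries f).sum 0 fun _ => x := by
    rw [coeff, smul_smul, Nat.factorial_succ, Nat.cast_mul, mul_inv_rev]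
  have tail := (hasSum_nat_add_iff' 1).2 (hasSum_taylor_of_entire hf x)
  simp only [terms] at tail
  simpa using (hasSum_fderiv_self_of_entire hg x).unique tail

end Taylor

section ExpConjugation

open NormedSpace

theorem hasSum_exp_apply {V : Type*} [NormedAddCommGroup V] [NormedSpace ℂ V] [CompleteSpace V]
    (T : V →L[ℂ] V) (v : V) :
    HasSum (fun k : ℕ => (k.factorial : ℂ)⁻¹ • (T ^ k) v) (exp T v) := by
  simpa using! (ContinuousLinearMap.apply ℂ V v).hasSum (exp_series_hasSum_exp' (𝕂 := ℂ) T)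

theorem exp_apply_mem {V : Type*} [NormedAddCommGroup V] [NormedSpace ℂ V] [CompleteSpace V]
    {T : V →L[ℂ] V} {K : Submodule ℂ V} (hK : IsClosed (K : Set V)) (hT : ∀ v ∈ K, T v ∈ K)
    {v : V} (hv : v ∈ K) : exp T v ∈ K := by
  have hpow : ∀ k : ℕ, (T ^ k) v ∈ K := fun k => by
    induction k with
    | zero => simpa
    | succ k ih => rw [pow_succ', mul_apply_eq_comp]; exact hT _ ih
  exact hK.mem_of_tendsto (hasSum_exp_apply T v) (Filter.Eventually.of_forall fun s =>
    Submodule.sum_mem _ fun k _ => Submodule.smul_mem _ _ (hpow k))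

variable {R : Type*} [NormedRing R] [NormedAlgebra ℂ R] [CompleteSpace R]

theorem exp_mulLeft_apply (X B : R) : exp (ContinuousLinearMap.mul ℂ R X) B = exp X * B := by
  have hpow (k : ℕ) : (ContinuousLinearMap.mul ℂ R X ^ k) B = X ^ k * B := by
    induction k with
    | zero => simp
    | succ k ih => rw [pow_succ', mul_apply_eq_comp, ih]; simp [pow_succ', mul_assoc]
  have h := hasSum_exp_apply (ContinuousLinearMap.mul ℂ R X) B
  simp only [hpow] at h
  exact h.unique (by simpa using! (exp_series_hasSum_exp' (𝕂 := ℂ) X).mul_right B)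

theorem exp_mulRight_apply (X B : R) :
    exp ((ContinuousLinearMap.mul ℂ R).flip X) B = B * exp X := by
  have hpow (k : ℕ) : ((ContinuousLinearMap.mul ℂ R).flip X ^ k) B = B * X ^ k := by
    induction k with
    | zero => simp
    | succ k ih => rw [pow_succ', mul_apply_eq_comp, ih]; simp [pow_succ, mul_assoc]
  have h := hasSum_exp_apply ((ContinuousLinearMap.mul ℂ R).flip X) B
  simp only [hpow] at h
  exact h.unique (by simpa using! (exp_series_hasSum_exp' (𝕂 := ℂ) X).mul_left B)

/-- Conjugation by `exp X` is the exponential of `ad X`, the sum of the commuting operators of left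
multiplication by `X` and right multiplication by `-X`. -/
theorem exp_mul_mul_exp_neg_mem {K : Submodule ℂ R} (hK : IsClosed (K : Set R)) {X : R}
    (hX : ∀ B ∈ K, X * B - B * X ∈ K) {B : R} (hB : B ∈ K) : exp X * B * exp (-X) ∈ K := by
  let : NormedAlgebra ℚ (R →L[ℂ] R) := .restrictScalars ℚ ℂ _
  have hcomm : Commute (ContinuousLinearMap.mul ℂ R X)
      ((ContinuousLinearMap.mul ℂ R).flip (-X)) := by
    ext B; simp [mul_assoc]
  have h := exp_apply_mem (T := ContinuousLinearMap.mul ℂ R X +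
    (ContinuousLinearMap.mul ℂ R).flip (-X)) hK (fun B hB => by
      simpa [sub_eq_add_neg] using hX B hB) hB
  rwa [exp_add_of_commute hcomm, mul_apply_eq_comp, exp_mulRight_apply, exp_mulLeft_apply,
    ← mul_assoc] at h

end ExpConjugation

section MatrixExp

open Matrix NormedSpace

open scoped Matrix.Norms.Operator

variable {m : Type*} [Fintype m] [DecidableEq m]

theorem matrix_exp_conj_mem {K : Submodule ℂ (Matrix m m ℂ)} {X : Matrix m m ℂ}
    (hX : ∀ B ∈ K, X * B - B * X ∈ K) {B : Matrix m m ℂ} (hB : B ∈ K) :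
    exp X * B * exp (-X) ∈ K :=
  exp_mul_mul_exp_neg_mem K.closed_of_finiteDimensional hX hB

theorem matrix_exp_continuous : Continuous (exp : Matrix m m ℂ → Matrix m m ℂ) :=
  let : NormedAlgebra ℚ (Matrix m m ℂ) := .restrictScalars ℚ ℂ _
  exp_continuous

theorem matrix_exp_mul_exp_neg (A : Matrix m m ℂ) : exp A * exp (-A) = 1 := by
  rw [← Matrix.exp_add_of_commute _ _ (Commute.refl A).neg_right, add_neg_cancel, exp_zero]

theorem hasDerivAt_exp_mulVec (A : Matrix m m ℂ) (x : m → ℂ) :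
    HasDerivAt (fun t : ℝ => exp ((t : ℂ) • A) *ᵥ x) (A *ᵥ x) 0 := by
  let evalAtx : Matrix m m ℂ →L[ℝ] (m → ℂ) :=
    LinearMap.toContinuousLinearMap (((Matrix.mulVecBilin ℂ ℂ).flip x).restrictScalars ℝ)
  convert! evalAtx.hasFDerivAt.comp_hasDerivAt 0 (hasDerivAt_exp_smul_const (𝕂 := ℝ) A 0) using 1
  change A *ᵥ x = (exp ((0 : ℝ) • A) * A) *ᵥ x
  simp

theorem hasStrictFDerivAt_exp_mulVec {ι : Type*} [Fintype ι] (B : ι → Matrix m m ℂ) (x : m → ℂ) :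
    HasStrictFDerivAt (fun c : ι → ℂ => exp (∑ i, c i • B i) *ᵥ x)
      (LinearMap.toContinuousLinearMap
        (∑ i, (LinearMap.proj i : (ι → ℂ) →ₗ[ℂ] ℂ).smulRight (B i *ᵥ x))) 0 := by
  let evalAtx : Matrix m m ℂ →L[ℂ] (m → ℂ) :=
    LinearMap.toContinuousLinearMap ((Matrix.mulVecBilin ℂ ℂ).flip x)
  let combination : (ι → ℂ) →L[ℂ] Matrix m m ℂ :=
    LinearMap.toContinuousLinearMap (∑ i, (LinearMap.proj i : (ι → ℂ) →ₗ[ℂ] ℂ).smulRight (B i))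
  have hcomb (c : ι → ℂ) : combination c = ∑ i, c i • B i := by simp [combination]
  have hexp := hasStrictFDerivAt_exp_zero (𝕂 := ℂ) (𝔸 := Matrix m m ℂ)
  rw [← map_zero combination] at hexp
  have h := evalAtx.hasStrictFDerivAt.comp (0 : ι → ℂ)
    (hexp.comp (0 : ι → ℂ) combination.hasStrictFDerivAt)
  refine (h.congr_fderiv ?_).congr_of_eventuallyEq (Filter.Eventually.of_forall fun c => ?_)
  · ext1 c
    change combination c *ᵥ x = _
    simp [hcomb, Matrix.sum_mulVec, Matrix.smul_mulVec]
  · change exp (combination c) *ᵥ x = _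
    rw [hcomb]

end MatrixExp

section CountableAlgebraicSet

open MvPolynomial

variable {k : Type*} [Field k] [IsAlgClosed k]

theorem exists_algHom_of_isIntegral {A σ : Type*} [Finite σ] [CommRing A] [Algebra k A]
    [Algebra.FiniteType k A] {g : MvPolynomial σ k →ₐ[k] A} (hg : Function.Injective g)
    (hi : g.toRingHom.IsIntegral) (y : σ → k) : ∃ ψ : A →ₐ[k] k, ∀ i, ψ (g (X i)) = y i := by
  let evalAty : MvPolynomial σ k →ₐ[k] k := aeval y
  have hmax : (RingHom.ker evalAty).IsMaximal :=
    RingHom.ker_isMaximal_of_surjective evalAty fun c => ⟨C c, by simp [evalAty]⟩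
  let : Algebra (MvPolynomial σ k) A := g.toRingHom.toAlgebra
  have : Algebra.IsIntegral (MvPolynomial σ k) A := ⟨hi⟩
  obtain ⟨Q, hQ, hcomap⟩ := Ideal.exists_ideal_over_maximal_of_isIntegral (S := A)
    (RingHom.ker evalAty) (by
      rw [show RingHom.ker (algebraMap (MvPolynomial σ k) A) = ⊥ from
        (RingHom.injective_iff_ker_eq_bot _).1 hg]
      exact bot_le)
  let : Field (A ⧸ Q) := Ideal.Quotient.field Q
  have : Module.Finite k (A ⧸ Q) := finite_of_finite_type_of_isJacobsonRing k (A ⧸ Q)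
  let e : k ≃ₐ[k] A ⧸ Q := AlgEquiv.ofBijective (Algebra.ofId k (A ⧸ Q))
    (IsAlgClosed.algebraMap_bijective_of_isIntegral (k := k) (K := A ⧸ Q))
  refine ⟨e.symm.toAlgHom.comp (Ideal.Quotient.mkₐ k Q), fun i => ?_⟩
  have hmem : X i - C (y i) ∈ RingHom.ker evalAty := by simp [evalAty, RingHom.mem_ker]
  rw [← hcomap, Ideal.mem_comap] at hmem
  have hquot : Ideal.Quotient.mkₐ k Q (g (X i - C (y i))) = 0 :=
    Ideal.Quotient.eq_zero_iff_mem.2 hmem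
  rw [map_sub, map_sub, sub_eq_zero, show g (C (y i)) = algebraMap k A (y i) from g.commutes _,
    AlgHom.commutes] at hquot
  change e.symm (Ideal.Quotient.mkₐ k Q (g (X i))) = y i
  rw [hquot, AlgEquiv.commutes]
  rfl

/-- By Noether normalization, an algebra of positive dimension has at least as many points as the
base field. -/
theorem finite_algHom_of_countable [Uncountable k] {A : Type*} [CommRing A] [Algebra k A]
    [Algebra.FiniteType k A] [Countable (A →ₐ[k] k)] : Finite (A →ₐ[k] k) := by
  cases subsingleton_or_nontrivial A with
  | inl _ => exact .of_subsingleton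
  | inr _ =>
    obtain ⟨s, g, hinj, hfin⟩ := exists_finite_inj_algHom_of_fg k A
    obtain rfl | hs := s.eq_zero_or_pos
    · have : Module.Finite k A := by
        have h := hfin.comp (AlgHom.Finite.of_surjective (Algebra.ofId k _) (C_surjective (Fin 0)))
        rw [show g.comp (Algebra.ofId k _) = Algebra.ofId k A from Subsingleton.elim _ _] at h
        exact RingHom.finite_algebraMap.1 h
      infer_instance
    · have hsurj : Function.Surjective fun ψ : A →ₐ[k] k => ψ (g (X ⟨0, hs⟩)) := fun c =>
        (exists_algHom_of_isIntegral hinj hfin.to_isIntegral fun _ => c).imp fun _ hψ => hψ _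
      exact (not_countable (α := k) hsurj.countable).elim

theorem finite_zeroLocus_of_countable [Uncountable k] {σ : Type*} [Finite σ]
    {P : Set (MvPolynomial σ k)} (h : {z : σ → k | ∀ p ∈ P, eval z p = 0}.Countable) :
    {z : σ → k | ∀ p ∈ P, eval z p = 0}.Finite := by
  let point (ψ : (MvPolynomial σ k ⧸ Ideal.span P) →ₐ[k] k) : σ → k :=
    fun i => ψ (Ideal.Quotient.mkₐ k _ (X i))
  have eval_point (ψ) (p : MvPolynomial σ k) :
      eval (point ψ) p = ψ (Ideal.Quotient.mkₐ k _ p) := by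
    rw [← aeval_eq_eval]
    exact congrArg (fun f => f p) (aeval_unique (ψ.comp (Ideal.Quotient.mkₐ k _))).symm
  have injective : Function.Injective point := fun ψ χ h =>
    Ideal.Quotient.algHom_ext _ (algHom_ext fun i => congrFun h i)
  have range : Set.range point = {z : σ → k | ∀ p ∈ P, eval z p = 0} := by
    refine Set.Subset.antisymm ?_ fun z hz => ?_
    · rintro _ ⟨ψ, rfl⟩ p hp
      rw [eval_point, Ideal.Quotient.mkₐ_eq_mk,
        Ideal.Quotient.eq_zero_iff_mem.2 (Ideal.subset_span hp), map_zero]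
    · have hle : Ideal.span P ≤ RingHom.ker (aeval z : MvPolynomial σ k →ₐ[k] k) :=
        Ideal.span_le.2 fun p hp => by simpa [RingHom.mem_ker, aeval_eq_eval] using hz p hp
      exact ⟨Ideal.Quotient.liftₐ _ (aeval z) hle, funext (aeval_X z)⟩
  rw [← range] at h ⊢
  have : Countable ((MvPolynomial σ k ⧸ Ideal.span P) →ₐ[k] k) :=
    have := h.to_subtype
    (Set.rangeFactorization_injective.2 injective).countable
  have := finite_algHom_of_countable (k := k) (A := MvPolynomial σ k ⧸ Ideal.span P)
  exact Set.finite_range point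

end CountableAlgebraicSet

section LinearFrame

variable {n : ℕ} {Δ : entireFunctions n}

theorem linearField_analyticOnNhd (A : Matrix (Fin n) (Fin n) ℂ) :
    AnalyticOnNhd ℂ (linearField A) Set.univ :=
  fun x _ => (linearFieldCLM A).analyticAt x

theorem linearField_injective :
    Function.Injective (linearField : Matrix (Fin n) (Fin n) ℂ → _) := by
  intro A B h
  ext i j
  simpa [linearField] using congrFun (congrFun h (Pi.single i 1)) j

theorem linearField_one (x : Fin n → ℂ) : linearField (1 : Matrix (Fin n) (Fin n) ℂ) x = x :=
  Matrix.vecMul_one x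

theorem mem_logVectorFields_iff (hΔ : IsReducedEquation Δ) {v : (Fin n → ℂ) → (Fin n → ℂ)} :
    v ∈ logVectorFields Δ ↔ AnalyticOnNhd ℂ v Set.univ ∧
      ∀ x, Δ.1 x = 0 → fderiv ℂ Δ.1 x (v x) = 0 := by
  refine ⟨fun ⟨h1, α, hα⟩ => ⟨h1, fun x hx => by rw [hα, hx, mul_zero]⟩, fun ⟨h1, h2⟩ => ⟨h1, ?_⟩⟩
  obtain ⟨α, hα⟩ := hΔ.dvd_of_vanishing ⟨_, fderiv_apply_analyticOnNhd Δ h1⟩ h2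
  exact ⟨α, fun x => (congrFun (congrArg Subtype.val hα) x).trans (mul_comm _ _)⟩

theorem mem_linearLogFields_iff (hΔ : IsReducedEquation Δ) {A : Matrix (Fin n) (Fin n) ℂ} :
    A ∈ linearLogFields Δ ↔ ∀ x, Δ.1 x = 0 → fderiv ℂ Δ.1 x (linearField A x) = 0 :=
  (mem_logVectorFields_iff hΔ).trans (and_iff_right (linearField_analyticOnNhd A))

theorem smul_const_mem_logVectorFields (v : Fin n → ℂ) :
    (fun x => Δ.1 x • v) ∈ logVectorFields Δ :=
  ⟨fun x hx => (Δ.2 x hx).smul analyticAt_const,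
    ⟨_, fderiv_apply_analyticOnNhd Δ (v := fun _ => v) analyticOnNhd_const⟩, fun x => by
      simp [mul_comm]⟩

/-- Evaluation of the linear logarithmic vector fields at a point. -/
def evalField (Δ : entireFunctions n) (x : Fin n → ℂ) :
    linearLogFields Δ →ₗ[ℂ] (Fin n → ℂ) where
  toFun A := linearField A.1 x
  map_add' A B := Matrix.vecMul_add A.1 B.1 x
  map_smul' c A := Matrix.vecMul_smul x c A.1

theorem evalField_apply (x : Fin n → ℂ) (A : linearLogFields Δ) :
    evalField Δ x A = linearField A.1 x := rfl

theorem evalField_smul (t : ℂ) (x : Fin n → ℂ) : evalField Δ (t • x) = t • evalField Δ x :=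
  LinearMap.ext fun A => Matrix.smul_vecMul t x A.1

theorem evalField_analyticOnNhd (A : linearLogFields Δ) :
    AnalyticOnNhd ℂ (fun x => evalField Δ x A) Set.univ := linearField_analyticOnNhd A.1

theorem exists_fderiv_evalField_eq_mul (A : linearLogFields Δ) :
    ∃ α : entireFunctions n, ∀ x, fderiv ℂ Δ.1 x (evalField Δ x A) = α.1 x * Δ.1 x := A.2.2

/-- A basis of `L_D` that generates the module of logarithmic vector fields. -/
structure LinearFrame (Δ : entireFunctions n) where
  basis : Module.Basis (Fin n) ℂ (linearLogFields Δ)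
  span : ∀ w ∈ logVectorFields Δ, ∃ c : Fin n → entireFunctions n,
    ∀ x, w x = ∑ i, (c i).1 x • evalField Δ x (basis i)

section Existence

variable {A : Fin n → linearLogFields Δ}

theorem exists_span_of_basis {b : Module.Basis (Fin n) (entireFunctions n) (logVectorFields Δ)}
    (hA : ∀ i, (b i).1 = linearField (A i).1) {w : (Fin n → ℂ) → (Fin n → ℂ)}
    (hw : w ∈ logVectorFields Δ) :
    ∃ c : Fin n → entireFunctions n, ∀ x, w x = ∑ i, (c i).1 x • evalField Δ x (A i) := by
  refine ⟨b.repr ⟨w, hw⟩, fun x => ?_⟩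
  have h := congrFun (congrArg Subtype.val (b.sum_repr ⟨w, hw⟩)) x
  rw [AddSubmonoidClass.coe_finsetSum, Finset.sum_apply] at h
  refine h.symm.trans (Finset.sum_congr rfl fun i _ => ?_)
  rw [evalField_apply, ← hA i]
  rfl

theorem linearIndependent_of_basis
    {b : Module.Basis (Fin n) (entireFunctions n) (logVectorFields Δ)}
    (hA : ∀ i, (b i).1 = linearField (A i).1) : LinearIndependent ℂ A := by
  rw [Fintype.linearIndependent_iff]
  intro g hg i
  have relation : b.equivFun.symm (fun i => algebraMap ℂ (entireFunctions n) (g i)) = 0 := by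
    apply Subtype.ext
    funext x
    rw [b.equivFun_symm_apply, AddSubmonoidClass.coe_finsetSum, Finset.sum_apply]
    have hx := congrArg (evalField Δ x) hg
    rw [map_sum, map_zero] at hx
    refine Eq.trans (Finset.sum_congr rfl fun i _ => ?_) hx
    rw [map_smul, evalField_apply, ← hA i]
    rfl
  have h := congrFun (b.equivFun.symm.map_eq_zero_iff.1 relation) i
  exact congrFun (congrArg Subtype.val h) 0

/-- Both sides are homogeneous of degree one in `x`, so the coefficients may be frozen at `0`. -/
theorem eq_sum_of_span {c : Fin n → entireFunctions n} {B : linearLogFields Δ}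
    (hc : ∀ x, evalField Δ x B = ∑ i, (c i).1 x • evalField Δ x (A i)) :
    B = ∑ i, (c i).1 0 • A i := by
  refine Subtype.ext (linearField_injective (funext fun x => ?_))
  have hne : ∀ t ∈ ({0}ᶜ : Set ℂ),
      evalField Δ x B = ∑ i, (c i).1 (t • x) • evalField Δ x (A i) := fun t ht => by
    have := hc (t • x)
    simp only [evalField_smul, LinearMap.smul_apply, smul_comm _ t, ← Finset.smul_sum] at this
    exact smul_right_injective _ ht this
  have hcont : Continuous fun t : ℂ => ∑ i, (c i).1 (t • x) • evalField Δ x (A i) :=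
    continuous_finsetSum _ fun i _ =>
      ((entire_continuous (c i)).comp (by fun_prop)).smul continuous_const
  have := congrFun (Continuous.ext_on (dense_compl_singleton (0 : ℂ)) continuous_const hcont hne) 0
  rw [← evalField_apply, ← evalField_apply, map_sum]
  simpa only [zero_smul, map_smul] using this

theorem IsLinearFree.nonempty_frame (hD : IsLinearFree Δ) : Nonempty (LinearFrame Δ) := by
  obtain ⟨b, hb⟩ := hD
  choose M hM using hb
  let A (i : Fin n) : linearLogFields Δ := ⟨M i, show linearField (M i) ∈ logVectorFields Δ from
    hM i ▸ (b i).2⟩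
  have hspan : ⊤ ≤ Submodule.span ℂ (Set.range A) := by
    rintro B -
    obtain ⟨c, hc⟩ := exists_span_of_basis (A := A) hM B.2
    rw [eq_sum_of_span (B := B) hc]
    exact Submodule.sum_mem _ fun i _ => Submodule.smul_mem _ _ (Submodule.subset_span ⟨i, rfl⟩)
  refine ⟨.mk (linearIndependent_of_basis (A := A) hM) hspan, fun w hw => ?_⟩
  simpa only [Module.Basis.mk_apply] using exists_span_of_basis (A := A) hM hw

end Existence

namespace LinearFrame

variable (S : LinearFrame Δ)

/-- The coefficients of the logarithmic field `Δ ∂_j` in the frame. -/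
def cofCoeff (j : Fin n) : Fin n → entireFunctions n :=
  (S.span _ (smul_const_mem_logVectorFields (Pi.single j 1))).choose

theorem smul_single_eq_sum_cofCoeff (j : Fin n) (x : Fin n → ℂ) :
    Δ.1 x • Pi.single j 1 = ∑ i, (S.cofCoeff j i).1 x • evalField Δ x (S.basis i) :=
  (S.span _ (smul_const_mem_logVectorFields (Pi.single j 1))).choose_spec x

/-- The inverse of `evalField Δ x`, multiplied by `Δ x`; it is entire in `x`. -/
def cof (x : Fin n → ℂ) : (Fin n → ℂ) →ₗ[ℂ] linearLogFields Δ :=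
  ∑ j, (LinearMap.proj j).smulRight (∑ i, (S.cofCoeff j i).1 x • S.basis i)

theorem evalField_cof (x v : Fin n → ℂ) : evalField Δ x (S.cof x v) = Δ.1 x • v := by
  simp only [cof, LinearMap.sum_apply, LinearMap.smulRight_apply, LinearMap.proj_apply, map_sum,
    map_smul, ← smul_single_eq_sum_cofCoeff]
  conv_rhs => rw [pi_eq_sum_univ' v, Finset.smul_sum]
  exact Finset.sum_congr rfl fun j _ => smul_comm _ _ _

theorem cof_analytic (v : Fin n → ℂ) (i : Fin n) :
    AnalyticOnNhd ℂ (fun x => S.basis.repr (S.cof x v) i) Set.univ := fun x hx => by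
  simp only [cof, LinearMap.sum_apply, LinearMap.smulRight_apply, LinearMap.proj_apply, map_sum,
    map_smul, Finsupp.coe_finsetSum, Finset.sum_apply, Finsupp.smul_apply,
    Module.Basis.repr_self, Finsupp.single_apply, smul_eq_mul, mul_ite, mul_one, mul_zero,
    Finset.sum_ite_eq', Finset.mem_univ, if_true]
  exact Finset.analyticAt_fun_sum _ fun j _ => analyticAt_const.mul ((S.cofCoeff j i).2 x hx)

include S

theorem finiteDimensional : FiniteDimensional ℂ (linearLogFields Δ) := .of_basis S.basis

theorem evalField_injective_iff_surjective {x : Fin n → ℂ} :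
    Function.Injective (evalField Δ x) ↔ Function.Surjective (evalField Δ x) :=
  have := S.finiteDimensional
  LinearMap.injective_iff_surjective_of_finrank_eq_finrank
    (by rw [Module.finrank_eq_card_basis S.basis]; simp)

theorem evalField_bijective {x : Fin n → ℂ} (hx : Δ.1 x ≠ 0) :
    Function.Bijective (evalField Δ x) := by
  have hs : Function.Surjective (evalField Δ x) := fun v =>
    ⟨(Δ.1 x)⁻¹ • S.cof x v, by rw [map_smul, S.evalField_cof, inv_smul_smul₀ hx]⟩
  exact ⟨S.evalField_injective_iff_surjective.2 hs, hs⟩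

theorem cof_evalField {x : Fin n → ℂ} (hx : Δ.1 x ≠ 0) (A : linearLogFields Δ) :
    S.cof x (evalField Δ x A) = Δ.1 x • A :=
  (S.evalField_bijective hx).1 (by rw [S.evalField_cof, map_smul])

omit S in
/-- The Saito matrix, whose rows are the values of the fields of the frame. -/
def saitoMatrix (S : LinearFrame Δ) (x : Fin n → ℂ) : Matrix (Fin n) (Fin n) ℂ :=
  Matrix.of fun i => evalField Δ x (S.basis i)

theorem continuous_saitoMatrix : Continuous S.saitoMatrix :=
  continuous_matrix fun i j =>
    (continuous_apply j).comp (linearFieldCLM (S.basis i).1).continuous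

theorem vecMul_saitoMatrix (v x : Fin n → ℂ) :
    Matrix.vecMul v (S.saitoMatrix x) = evalField Δ x (∑ i, v i • S.basis i) := by
  simp only [Matrix.vecMul_eq_sum, map_sum, map_smul]
  rfl

theorem det_saitoMatrix_smul (v x : Fin n → ℂ) : (S.saitoMatrix x).det • v =
    evalField Δ x (∑ i, Matrix.vecMul v (S.saitoMatrix x).adjugate i • S.basis i) := by
  rw [← vecMul_saitoMatrix, Matrix.vecMul_vecMul, Matrix.adjugate_mul, Matrix.vecMul_smul,
    Matrix.vecMul_one]

theorem det_saitoMatrix_eq_zero (h0 : Δ ≠ 0) {x : Fin n → ℂ} (hx : Δ.1 x = 0) :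
    (S.saitoMatrix x).det = 0 := by
  choose α hα using fun i => exists_fderiv_evalField_eq_mul (S.basis i)
  have hcont := S.continuous_saitoMatrix
  refine vanishes_of_dvd_mul_fderiv h0 hcont.matrix_det (fun v =>
    ⟨fun y => ∑ i, Matrix.vecMul v (S.saitoMatrix y).adjugate i * (α i).1 y,
      continuous_finsetSum _ fun i _ => ?_, fun y => ?_⟩) hx
  · exact ((continuous_apply i).comp
      (Continuous.matrix_vecMul continuous_const hcont.matrix_adjugate)).mul
        (entire_continuous (α i))
  · have cramer := congrArg (fderiv ℂ Δ.1 y) (S.det_saitoMatrix_smul v y)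
    simp only [map_smul, map_sum, smul_eq_mul, hα] at cramer
    rw [mul_comm, cramer, Finset.mul_sum]
    exact Finset.sum_congr rfl fun i _ => by ring

theorem not_surjective_of_eq_zero (h0 : Δ ≠ 0) {x : Fin n → ℂ} (hx : Δ.1 x = 0) :
    ¬ Function.Surjective (evalField Δ x) := by
  rw [← S.evalField_injective_iff_surjective]
  intro hinj
  obtain ⟨v, hv, hv0⟩ := Matrix.exists_vecMul_eq_zero_iff.2 (S.det_saitoMatrix_eq_zero h0 hx)
  rw [vecMul_saitoMatrix, map_eq_zero_iff _ hinj] at hv0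
  exact hv (funext (Fintype.linearIndependent_iff.1 S.basis.linearIndependent v hv0))

theorem eq_zero_iff_not_surjective (h0 : Δ ≠ 0) {x : Fin n → ℂ} :
    Δ.1 x = 0 ↔ ¬ Function.Surjective (evalField Δ x) :=
  ⟨S.not_surjective_of_eq_zero h0, fun h => by_contra fun hx => h (S.evalField_bijective hx).2⟩

theorem smul_mem_divisor_iff (h0 : Δ ≠ 0) {x : Fin n → ℂ} {t : ℂ} (ht : t ≠ 0) :
    Δ.1 (t • x) = 0 ↔ Δ.1 x = 0 := by
  rw [S.eq_zero_iff_not_surjective h0, S.eq_zero_iff_not_surjective h0, evalField_smul,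
    ← LinearMap.range_eq_top, ← LinearMap.range_eq_top, LinearMap.range_smul _ _ ht]

theorem one_mem (hΔ : IsReducedEquation Δ) :
    (1 : Matrix (Fin n) (Fin n) ℂ) ∈ linearLogFields Δ := by
  refine (mem_linearLogFields_iff hΔ).2 fun x hx => ?_
  have hline : (fun t : ℂ => Δ.1 (t • x)) =ᶠ[nhds 1] fun _ => 0 := by
    filter_upwards [isOpen_ne.mem_nhds (one_ne_zero : (1 : ℂ) ≠ 0)] with t ht
    exact (S.smul_mem_divisor_iff hΔ.ne_zero ht).2 hx
  have hderiv := (hasDerivAt_comp_smul Δ.2 x 1).unique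
    ((hasDerivAt_const (1 : ℂ) (0 : ℂ)).congr_of_eventuallyEq hline)
  rw [linearField_one]
  rwa [one_smul] at hderiv

end LinearFrame

end LinearFrame

section Alternating

variable {ι 𝕜 E F : Type*} [Finite ι] [Nonempty ι] [DecidableEq ι] [Field 𝕜]
  [AddCommGroup E] [Module 𝕜 E] [FiniteDimensional 𝕜 E] [AddCommGroup F] [Module 𝕜 F]

/-- In a basis adapted to a hyperplane, an injective family has at most one member outside it. -/
theorem alternatingMap_eq_zero_of_update_ker {φ : E [⋀^ι]→ₗ[𝕜] F} {ℓ : E →ₗ[𝕜] 𝕜} {w : E}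
    (hw : ℓ w ≠ 0) (h : ∀ (u : ι → E) (i : ι) (v : E), (∀ j, u j ∈ LinearMap.ker ℓ) →
      φ (Function.update u i v) = 0) : φ = 0 := by
  let b := Module.finBasis 𝕜 (LinearMap.ker ℓ)
  let e := Module.Basis.mkFinCons w b
    (fun c x hx hc => by
      have := congrArg ℓ hc
      rw [map_add, map_smul, LinearMap.mem_ker.1 hx, map_zero, add_zero, smul_eq_mul] at this
      exact (mul_eq_zero.1 this).resolve_right hw)
    (fun z => ⟨-(ℓ z / ℓ w), by
      rw [LinearMap.mem_ker, map_add, map_smul, smul_eq_mul]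
      field_simp
      ring⟩)
  have mem_ker (j) (hj : j ≠ 0) : e j ∈ LinearMap.ker ℓ := by
    obtain ⟨j, rfl⟩ := Fin.exists_succ_eq.2 hj
    simp [e, b]
  refine Module.Basis.ext_alternating e fun v hv => ?_
  obtain ⟨i, hi⟩ : ∃ i, ∀ j, j ≠ i → v j ≠ 0 := by
    by_cases h0 : ∃ i, v i = 0
    · exact h0.imp fun i hi j hj hvj => hj (hv (hvj.trans hi.symm))
    · exact ⟨Classical.arbitrary ι, fun j _ hj => h0 ⟨j, hj⟩⟩
  have := h (Function.update (fun j => e (v j)) i 0) i (e (v i)) fun j => by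
    obtain rfl | hj := eq_or_ne j i
    · simp
    · rw [Function.update_of_ne hj]
      exact mem_ker _ (hi j hj)
  rwa [Function.update_idem, Function.update_eq_self] at this

end Alternating

section ExteriorDerivative

variable {𝕜 E : Type*} [NontriviallyNormedField 𝕜] [NormedAddCommGroup E] [NormedSpace 𝕜 E]
  {k : ℕ} {f : E → 𝕜} {ω η : E → E [⋀^Fin k]→L[𝕜] 𝕜} {x : E}

theorem extDeriv_fun_smul_apply (hf : DifferentiableAt 𝕜 f x) (hω : DifferentiableAt 𝕜 ω x)
    (v : Fin (k + 1) → E) : extDeriv (fun y => f y • ω y) x v = f x * extDeriv ω x v +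
      ∑ i : Fin (k + 1), (-1) ^ (i : ℕ) * (fderiv 𝕜 f x (v i) * ω x (i.removeNth v)) := by
  rw [extDeriv, extDeriv, ContinuousAlternatingMap.alternatizeUncurryFin_apply,
    ContinuousAlternatingMap.alternatizeUncurryFin_apply,
    (hf.hasFDerivAt.fun_smul hω.hasFDerivAt).fderiv, Finset.mul_sum, ← Finset.sum_add_distrib]
  refine Finset.sum_congr rfl fun i _ => ?_
  simp only [add_apply, smul_apply, ContinuousLinearMap.smulRight_apply,
    ContinuousAlternatingMap.add_apply, ContinuousAlternatingMap.smul_apply, smul_eq_mul,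
    zsmul_eq_mul, Int.cast_pow, Int.cast_neg, Int.cast_one]
  ring

/-- If all but the first of the vectors `v i` are logarithmic for `f` at `x`, then up to multiples
of `f x` only the first term of `df ∧ ω` survives. -/
theorem fderiv_mul_apply_removeNth_zero (hf : DifferentiableAt 𝕜 f x)
    (hω : DifferentiableAt 𝕜 ω x) (hη : η =ᶠ[nhds x] fun y => f y • ω y)
    {v : Fin (k + 1) → E} {α : Fin k → 𝕜} (hv : ∀ j, fderiv 𝕜 f x (v j.succ) = α j * f x) :
    fderiv 𝕜 f x (v 0) * η x (Fin.removeNth 0 v) = f x * (extDeriv η x v - f x * extDeriv ω x v +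
      ∑ j : Fin k, (-1) ^ (j : ℕ) * (α j * η x (j.succ.removeNth v))) := by
  have hηx (u) : η x u = f x * ω x u := by rw [hη.eq_of_nhds]; rfl
  have hsum : ∑ j : Fin k, (-1 : 𝕜) ^ (j.succ : ℕ) * (fderiv 𝕜 f x (v j.succ) *
      ω x (j.succ.removeNth v)) =
        - ∑ j : Fin k, (-1) ^ (j : ℕ) * (α j * η x (j.succ.removeNth v)) := by
    rw [← Finset.sum_neg_distrib]
    refine Finset.sum_congr rfl fun j _ => ?_
    rw [hv, hηx, Fin.val_succ, pow_succ]
    ring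
  rw [hη.extDeriv_eq, extDeriv_fun_smul_apply hf hω, Fin.sum_univ_succ, hsum, hηx]
  simp only [Fin.val_zero, pow_zero, one_mul]
  ring

end ExteriorDerivative

section Coefficients

variable {n : ℕ} {Δ : entireFunctions n} {k : ℕ}

theorem entire_ext_off_divisor (h : Δ ≠ 0) {f g : entireFunctions n}
    (hfg : ∀ x, Δ.1 x ≠ 0 → f.1 x = g.1 x) : f = g :=
  Subtype.ext (eq_of_eq_off_divisorSet h (entire_continuous f) (entire_continuous g) hfg)

/-- The entire functions `a A` are the values of the form `ω` on tuples of linear logarithmic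
fields. -/
def HasCoeff (ω : FormOn n k) (a : linearLogFields Δ [⋀^Fin k]→ₗ[ℂ] entireFunctions n) : Prop :=
  ∀ x, Δ.1 x ≠ 0 → ∀ A, (a A).1 x = ω x fun i => evalField Δ x (A i)

theorem exists_hasCoeff (h0 : Δ ≠ 0) {ω : FormOn n k}
    (h : ∀ A : Fin k → linearLogFields Δ, ∃ f : entireFunctions n, ∀ x, Δ.1 x ≠ 0 →
      f.1 x = ω x fun i => evalField Δ x (A i)) :
    ∃ a : linearLogFields Δ [⋀^Fin k]→ₗ[ℂ] entireFunctions n, HasCoeff ω a := by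
  choose f hf using h
  let φ (x : Fin n → ℂ) : linearLogFields Δ [⋀^Fin k]→ₗ[ℂ] ℂ :=
    (ω x).toAlternatingMap.compLinearMap (evalField Δ x)
  have hφ : ∀ A x, Δ.1 x ≠ 0 → (f A).1 x = φ x A := hf
  refine ⟨{ toFun := f, map_update_add' := ?_, map_update_smul' := ?_,
            map_eq_zero_of_eq' := ?_ }, fun x hx A => hf A x hx⟩
  · intro _ v i A B
    refine entire_ext_off_divisor h0 fun x hx => ?_
    change _ = (f _).1 x + (f _).1 x
    rw [hφ _ x hx, hφ _ x hx, hφ _ x hx]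
    exact (φ x).map_update_add v i A B
  · intro _ v i c A
    refine entire_ext_off_divisor h0 fun x hx => ?_
    change _ = c • (f _).1 x
    rw [hφ _ x hx, hφ _ x hx]
    exact (φ x).map_update_smul v i c A
  · intro v i j hv hij
    refine entire_ext_off_divisor h0 fun x hx => ?_
    rw [hφ _ x hx]
    exact (φ x).map_eq_zero_of_eq v hv hij

theorem HasCoeff.unique (h0 : Δ ≠ 0) {ω : FormOn n k}
    {a b : linearLogFields Δ [⋀^Fin k]→ₗ[ℂ] entireFunctions n} (ha : HasCoeff ω a)
    (hb : HasCoeff ω b) : a = b := by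
  ext1 A
  exact entire_ext_off_divisor h0 fun x hx => (ha x hx A).trans (hb x hx A).symm

theorem HasCoeff.eq_form (S : LinearFrame Δ) {ω η : FormOn n k}
    {a : linearLogFields Δ [⋀^Fin k]→ₗ[ℂ] entireFunctions n} (hω : HasCoeff ω a)
    (hη : HasCoeff η a) {x : Fin n → ℂ} (hx : Δ.1 x ≠ 0) : ω x = η x := by
  ext v
  choose A hA using fun i => (S.evalField_bijective hx).2 (v i)
  have := (hω x hx A).symm.trans (hη x hx A)
  simpa only [hA] using this

theorem exists_fderiv_mul_apply_evalField_eq (h0 : Δ ≠ 0) {ω η : FormOn n k}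
    {θ : FormOn n (k + 1)} (hω : ∀ x, Δ.1 x ≠ 0 → AnalyticAt ℂ ω x)
    (hη : AnalyticOnNhd ℂ η Set.univ) (hηω : ∀ x, Δ.1 x ≠ 0 → Δ.1 x • ω x = η x)
    (hθ : AnalyticOnNhd ℂ θ Set.univ) (hθω : ∀ x, Δ.1 x ≠ 0 → Δ.1 x • extDeriv ω x = θ x)
    (A : Fin k → linearLogFields Δ) (v : Fin n → ℂ) :
    ∃ g : (Fin n → ℂ) → ℂ, Continuous g ∧ ∀ x,
      fderiv ℂ Δ.1 x v * (η x fun i => evalField Δ x (A i)) = Δ.1 x * g x := by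
  choose α hα using fun i => exists_fderiv_evalField_eq_mul (A i)
  let V : Fin (k + 1) → (Fin n → ℂ) → (Fin n → ℂ) :=
    Matrix.vecCons (fun _ => v) fun i y => evalField Δ y (A i)
  have hV (i) : AnalyticOnNhd ℂ (V i) Set.univ :=
    Fin.cases analyticOnNhd_const (fun i => evalField_analyticOnNhd (A i)) i
  have hη' {l : ℕ} {ψ : FormOn n l} (hψ : AnalyticOnNhd ℂ ψ Set.univ)
      {W : Fin l → (Fin n → ℂ) → (Fin n → ℂ)} (hW : ∀ i, AnalyticOnNhd ℂ (W i) Set.univ) :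
      AnalyticOnNhd ℂ (fun y => ψ y fun i => W i y) Set.univ := fun y hy =>
    analyticAt_alternatingMap_apply (hψ y hy) fun i => hW i y hy
  let g : entireFunctions n := ⟨fun y => (extDeriv η y fun i => V i y) - (θ y fun i => V i y) +
    ∑ j : Fin k, (-1) ^ (j : ℕ) * ((α j).1 y * η y fun i => V (j.succ.succAbove i) y),
    fun y hy => ((hη' (fun y hy => extDeriv_analyticAt (hη y hy)) hV y hy).sub
      (hη' hθ hV y hy)).add (Finset.analyticAt_fun_sum _ fun j _ => analyticAt_const.mul
        (((α j).2 y hy).mul (hη' hη (fun i => hV _) y hy)))⟩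
  have heval : AnalyticOnNhd ℂ (fun y => η y fun i => evalField Δ y (A i)) Set.univ :=
    hη' hη fun i => hV i.succ
  refine ⟨g.1, entire_continuous g, congrFun (eq_of_eq_off_divisorSet h0
    ((entire_continuous ⟨_, fderiv_apply_analyticOnNhd Δ (v := fun _ => v)
      analyticOnNhd_const⟩).mul (entire_continuous ⟨_, heval⟩))
    ((entire_continuous Δ).mul (entire_continuous g)) fun y hy => ?_)⟩
  have hnear : η =ᶠ[nhds y] fun z => Δ.1 z • ω z := by
    filter_upwards [compl_divisor_nhds Δ hy] with z hz
    exact (hηω z hz).symm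
  have key := fderiv_mul_apply_removeNth_zero (entire_differentiable Δ y)
    (hω y hy).differentiableAt hnear (v := fun i => V i y) fun j => hα j y
  rwa [← smul_eq_mul (Δ.1 y) (extDeriv ω y _), ← ContinuousAlternatingMap.smul_apply,
    hθω y hy] at key

theorem exists_entire_of_mem_logForms (hΔ : IsReducedEquation Δ) {ω : FormOn n k}
    (hω : ω ∈ logForms Δ k) (A : Fin k → linearLogFields Δ) :
    ∃ f : entireFunctions n, ∀ x, Δ.1 x ≠ 0 → f.1 x = ω x fun i => evalField Δ x (A i) := by
  obtain ⟨-, hωa, ⟨η, hη, hηω⟩, θ, hθ, hθω⟩ := hω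
  let ηA : entireFunctions n := ⟨fun x => η x fun i => evalField Δ x (A i), fun x hx =>
    analyticAt_alternatingMap_apply (hη x hx) fun i => evalField_analyticOnNhd (A i) x hx⟩
  obtain ⟨f, hf⟩ := hΔ.dvd_of_vanishing ηA fun x hx =>
    vanishes_of_dvd_mul_fderiv hΔ.ne_zero (entire_continuous ηA)
      (exists_fderiv_mul_apply_evalField_eq hΔ.ne_zero hωa hη hηω hθ hθω A) hx
  refine ⟨f, fun x hx => (mul_left_cancel₀ hx ?_).symm⟩
  have h : (η x fun i => evalField Δ x (A i)) = Δ.1 x * f.1 x :=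
    congrFun (congrArg Subtype.val hf) x
  rwa [← hηω x hx] at h

theorem exists_hasCoeff_of_mem_logForms (hΔ : IsReducedEquation Δ) {ω : FormOn n k}
    (hω : ω ∈ logForms Δ k) :
    ∃ a : linearLogFields Δ [⋀^Fin k]→ₗ[ℂ] entireFunctions n, HasCoeff ω a :=
  exists_hasCoeff hΔ.ne_zero (exists_entire_of_mem_logForms hΔ hω)

/-- Evaluation of entire functions at a point. -/
def evalAt (x : Fin n → ℂ) : entireFunctions n →ₗ[ℂ] ℂ where
  toFun f := f.1 x
  map_add' _ _ := rfl
  map_smul' _ _ := rfl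

section FormOfCoeff

variable (S : LinearFrame Δ) (a : linearLogFields Δ [⋀^Fin k]→ₗ[ℂ] entireFunctions n)

/-- The entire form whose value on vectors `v i` is that of `a` on the fields `S.cof x (v i)`. -/
def cofForm (x : Fin n → ℂ) : (Fin n → ℂ) [⋀^Fin k]→L[ℂ] ℂ :=
  toContinuousAlternatingMap (((evalAt x).compAlternatingMap a).compLinearMap (S.cof x))

theorem cofForm_apply (x : Fin n → ℂ) (v : Fin k → Fin n → ℂ) :
    cofForm S a x v = (a fun i => S.cof x (v i)).1 x := rfl

/-- The form on the complement of the divisor with prescribed values on linear logarithmic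
fields. -/
def formOfCoeff : FormOn n k := fun x => if Δ.1 x = 0 then 0 else (Δ.1 x)⁻¹ ^ k • cofForm S a x

theorem cofForm_eq_smul_formOfCoeff {x : Fin n → ℂ} (hx : Δ.1 x ≠ 0) :
    cofForm S a x = Δ.1 x ^ k • formOfCoeff S a x := by
  rw [formOfCoeff, if_neg hx, smul_smul, ← mul_pow, mul_inv_cancel₀ hx, one_pow, one_smul]

theorem hasCoeff_formOfCoeff : HasCoeff (formOfCoeff S a) a := by
  intro x hx A
  refine mul_left_cancel₀ (pow_ne_zero k hx) ?_
  have hmap := ((evalAt x).compAlternatingMap a).toMultilinearMap.map_smul_univ (fun _ => Δ.1 x) A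
  rw [Finset.prod_const, Finset.card_univ, Fintype.card_fin] at hmap
  rw [← smul_eq_mul (Δ.1 x ^ k) (formOfCoeff S a x _), ← ContinuousAlternatingMap.smul_apply,
    ← cofForm_eq_smul_formOfCoeff S a hx, cofForm_apply]
  simp only [S.cof_evalField hx]
  exact hmap.symm

theorem cofForm_analyticOnNhd : AnalyticOnNhd ℂ (cofForm S a) Set.univ := by
  refine fun x hx => analyticAt_of_forall_apply fun v => ?_
  have expansion : (fun y => cofForm S a y v) = fun y => ∑ r : Fin k → Fin n,
      (∏ i, S.basis.repr (S.cof y (v i)) (r i)) • (a fun i => S.basis (r i)).1 y := by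
    funext y
    let φ := ((evalAt y).compAlternatingMap a).toMultilinearMap
    change φ (fun i => S.cof y (v i)) = _
    conv_lhs => rw [show (fun i => S.cof y (v i)) = fun i =>
      ∑ j, S.basis.repr (S.cof y (v i)) j • S.basis j from
        funext fun i => (S.basis.sum_repr _).symm]
    exact (φ.map_sum _).trans (Finset.sum_congr rfl fun r _ => φ.map_smul_univ _ _)
  rw [expansion]
  exact Finset.analyticAt_fun_sum _ fun r _ => AnalyticAt.fun_smul
    (Finset.analyticAt_fun_prod _ fun i _ => S.cof_analytic _ _ x hx) ((a _).2 x hx)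

theorem formOfCoeff_analyticAt {x : Fin n → ℂ} (hx : Δ.1 x ≠ 0) :
    AnalyticAt ℂ (formOfCoeff S a) x := by
  refine AnalyticAt.congr ((((Δ.2 x (Set.mem_univ x)).inv hx).pow k).fun_smul
    (cofForm_analyticOnNhd S a x (Set.mem_univ x))) ?_
  filter_upwards [compl_divisor_nhds Δ hx] with y hy
  simp [formOfCoeff, hy]

end FormOfCoeff

theorem LinearFrame.exists_evalField_eq_of_fderiv_eq_zero (S : LinearFrame Δ)
    (hΔ : IsReducedEquation Δ) {x v w : Fin n → ℂ} (hw : fderiv ℂ Δ.1 x w ≠ 0)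
    (hv : fderiv ℂ Δ.1 x v = 0) :
    ∃ A, evalField Δ x A = v := by
  have hd (u : Fin n → ℂ) : AnalyticOnNhd ℂ (fun y => fderiv ℂ Δ.1 y u) Set.univ :=
    fderiv_apply_analyticOnNhd Δ (v := fun _ => u) analyticOnNhd_const
  have hK : (fun y => fderiv ℂ Δ.1 y w • v - fderiv ℂ Δ.1 y v • w) ∈ logVectorFields Δ := by
    refine (mem_logVectorFields_iff hΔ).2 ⟨fun y hy => ((hd w y hy).fun_smul analyticAt_const).sub
      ((hd v y hy).fun_smul analyticAt_const), fun y _ => ?_⟩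
    simp [mul_comm]
  obtain ⟨c, hc⟩ := S.span _ hK
  have hx := hc x
  rw [hv, zero_smul, sub_zero] at hx
  refine ⟨(fderiv ℂ Δ.1 x w)⁻¹ • ∑ i, (c i).1 x • S.basis i, ?_⟩
  simp only [map_smul, map_sum]
  rw [← hx, inv_smul_smul₀ hw]

section SimplePole

variable (S : LinearFrame Δ) (a : linearLogFields Δ [⋀^Fin k]→ₗ[ℂ] entireFunctions n)

theorem mul_formOfCoeff_update_evalField (B : Fin k → linearLogFields Δ) (i : Fin k)
    (v : Fin n → ℂ) {x : Fin n → ℂ} (hx : Δ.1 x ≠ 0) :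
    Δ.1 x * formOfCoeff S a x (Function.update (fun j => evalField Δ x (B j)) i v) =
      ∑ l, S.basis.repr (S.cof x v) l * (a (Function.update B i (S.basis l))).1 x := by
  have hupdate : Function.update (fun j => evalField Δ x (B j)) i (evalField Δ x (S.cof x v)) =
      fun j => evalField Δ x (Function.update B i (S.cof x v) j) :=
    (funext fun j => Function.apply_update (fun _ => evalField Δ x) B i _ j).symm
  rw [← smul_eq_mul, ← ContinuousAlternatingMap.map_update_smul, ← S.evalField_cof, hupdate,
    ← hasCoeff_formOfCoeff S a x hx]
  conv_lhs => rw [← S.basis.sum_repr (S.cof x v)]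
  change (evalAt x).compAlternatingMap a _ = _
  rw [AlternatingMap.map_update_sum]
  exact Finset.sum_congr rfl fun l _ => AlternatingMap.map_update_smul ..

variable {a} {η : FormOn n k} (hη : AnalyticOnNhd ℂ η Set.univ) {m : ℕ}
  (h : ∀ x, Δ.1 x ≠ 0 → η x = Δ.1 x ^ (m + 2) • formOfCoeff S a x) {x : Fin n → ℂ}

include hη h

theorem apply_update_evalField_eq_zero (h0 : Δ ≠ 0) (B : Fin k → linearLogFields Δ) (i : Fin k)
    (v : Fin n → ℂ) (hx : Δ.1 x = 0) :
    η x (Function.update (fun j => evalField Δ x (B j)) i v) = 0 := by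
  let q : entireFunctions n := ⟨fun y => ∑ l, S.basis.repr (S.cof y v) l *
    (a (Function.update B i (S.basis l))).1 y, fun y hy => Finset.analyticAt_fun_sum _ fun l _ =>
      (S.cof_analytic v l y hy).mul ((a _).2 y hy)⟩
  have hcont : Continuous fun y => η y (Function.update (fun j => evalField Δ y (B j)) i v) := by
    refine entire_continuous ⟨_, fun y hy => analyticAt_alternatingMap_apply (hη y hy)
      (v := fun j y => Function.update (fun j => evalField Δ y (B j)) i v j) fun j => ?_⟩
    obtain rfl | hj := eq_or_ne j i
    · simp only [Function.update_self]
      exact analyticAt_const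
    · simp only [Function.update_of_ne hj]
      exact evalField_analyticOnNhd (B j) y hy
  have factor := congrFun (eq_of_eq_off_divisorSet h0 hcont
    (((entire_continuous Δ).pow (m + 1)).mul (entire_continuous q)) fun y hy => by
      rw [h y hy, Pi.mul_apply, Pi.pow_apply, ContinuousAlternatingMap.smul_apply, smul_eq_mul,
        pow_succ, mul_assoc, mul_formOfCoeff_update_evalField S a B i v hy]) x
  rw [factor, Pi.mul_apply, Pi.pow_apply, hx, zero_pow m.succ_ne_zero, zero_mul]

theorem form_vanishes_on_divisor [NeZero k] (hΔ : IsReducedEquation Δ) (hx : Δ.1 x = 0) :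
    η x = 0 := by
  ext v
  have hηv : AnalyticOnNhd ℂ (fun y => η y v) Set.univ := fun y hy =>
    analyticAt_alternatingMap_apply (hη y hy) (v := fun i _ => v i) fun j => analyticAt_const
  have hproduct (w y) (hy : Δ.1 y = 0) : fderiv ℂ Δ.1 y w * η y v = 0 := by
    obtain hw | hw := eq_or_ne (fderiv ℂ Δ.1 y w) 0
    · exact mul_eq_zero_of_left hw _
    have hzero : (η y).toAlternatingMap = 0 :=
      alternatingMap_eq_zero_of_update_ker (ℓ := (fderiv ℂ Δ.1 y).toLinearMap) hw fun u i v hu => by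
        choose B hB using fun j => S.exists_evalField_eq_of_fderiv_eq_zero hΔ hw (hu j)
        obtain rfl : (fun j => evalField Δ y (B j)) = u := funext hB
        exact apply_update_evalField_eq_zero S hη h hΔ.ne_zero B i v hy
    exact mul_eq_zero_of_right _ (congrArg (fun φ => φ v) hzero)
  refine vanishes_of_dvd_mul_fderiv hΔ.ne_zero (entire_continuous ⟨_, hηv⟩) (fun w => ?_) hx
  obtain ⟨g, hg⟩ := hΔ.dvd_of_vanishing ⟨fun y => fderiv ℂ Δ.1 y w * η y v, fun y hy =>
    (fderiv_apply_analyticOnNhd Δ (v := fun _ => w) analyticOnNhd_const y hy).mul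
      (hηv y hy)⟩ (hproduct w)
  exact ⟨g.1, entire_continuous g, fun y => congrFun (congrArg Subtype.val hg) y⟩

omit hη h in
theorem exists_mul_formOfCoeff_extends_of_pow [NeZero k] (hΔ : IsReducedEquation Δ) (m : ℕ)
    {η : FormOn n k} (hη : AnalyticOnNhd ℂ η Set.univ)
    (h : ∀ x, Δ.1 x ≠ 0 → η x = Δ.1 x ^ (m + 1) • formOfCoeff S a x) :
    ∃ η : FormOn n k, AnalyticOnNhd ℂ η Set.univ ∧
      ∀ x, Δ.1 x ≠ 0 → Δ.1 x • formOfCoeff S a x = η x := by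
  induction m generalizing η with
  | zero => exact ⟨η, hη, fun x hx => by rw [h x hx, zero_add, pow_one]⟩
  | succ m ih =>
    obtain ⟨θ, hθ, hθη⟩ := hΔ.exists_eq_smul_of_vanishes hη
      fun x hx => form_vanishes_on_divisor S hη h hΔ hx
    refine ih hθ fun x hx => smul_right_injective _ hx ?_
    change Δ.1 x • θ x = Δ.1 x • _
    rw [← hθη x, h x hx, smul_smul, ← pow_succ']

omit hη h in
theorem exists_mul_formOfCoeff_extends (hΔ : IsReducedEquation Δ)
    (a : linearLogFields Δ [⋀^Fin k]→ₗ[ℂ] entireFunctions n) :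
    ∃ η : FormOn n k, AnalyticOnNhd ℂ η Set.univ ∧
      ∀ x, Δ.1 x ≠ 0 → Δ.1 x • formOfCoeff S a x = η x := by
  cases k with
  | zero =>
    exact ⟨_, fun x hx => (Δ.2 x hx).fun_smul (cofForm_analyticOnNhd S a x hx), fun x hx => by
      rw [cofForm_eq_smul_formOfCoeff S a hx, pow_zero, one_smul]⟩
  | succ k =>
    exact exists_mul_formOfCoeff_extends_of_pow S hΔ k (cofForm_analyticOnNhd S a)
      fun x hx => cofForm_eq_smul_formOfCoeff S a hx

end SimplePole

end Coefficients

section BracketPart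

variable {L M N : Type*} [LieRing L] [LieAlgebra ℂ L] [AddCommGroup M] [Module ℂ M]
  [AddCommGroup N] [Module ℂ N]

/-- The part of the Chevalley--Eilenberg differential that involves brackets, for cochains with
values in an arbitrary vector space; the pairs of indices are encoded as in `ceDiffSucc`. -/
def bracketPart : ∀ k : ℕ, (L [⋀^Fin k]→ₗ[ℂ] M) → (Fin (k + 1) → L) → M
  | 0, _, _ => 0
  | k + 1, a, A => -∑ i : Fin (k + 1), ∑ j ≥ i, (-1 : ℂ) ^ (i + j : ℕ) •
      a (Matrix.vecCons ⁅A i.castSucc, A j.succ⁆ (j.removeNth (i.castSucc.removeNth A)))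

theorem map_bracketPart (f : M →ₗ[ℂ] N) {k : ℕ} (a : L [⋀^Fin k]→ₗ[ℂ] M) (A : Fin (k + 1) → L) :
    f (bracketPart k a A) = bracketPart k (f.compAlternatingMap a) A := by
  cases k with
  | zero => exact map_zero f
  | succ k =>
    simp only [bracketPart, map_neg, map_sum, map_smul, LinearMap.compAlternatingMap_apply]

theorem bracketPart_eq_ceDiff {L : Type} [LieRing L] [LieAlgebra ℂ L] {k : ℕ}
    (φ : L [⋀^Fin k]→ₗ[ℂ] ℂ) (A : Fin (k + 1) → L) : bracketPart k φ A = ceDiff L k φ A := by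
  cases k <;> rfl

end BracketPart

section Forms

variable {n : ℕ} {Δ : entireFunctions n} {k : ℕ}

section Differential

theorem lieBracket_linearField (A B : Matrix (Fin n) (Fin n) ℂ) (x : Fin n → ℂ) :
    VectorField.lieBracket ℂ (linearField A) (linearField B) x = linearField ⁅A, B⁆ x := by
  have hfderiv (C : Matrix (Fin n) (Fin n) ℂ) : fderiv ℂ (linearField C) x = linearFieldCLM C :=
    (linearFieldCLM C).hasFDerivAt.fderiv
  rw [VectorField.lieBracket_eq]
  simp only [hfderiv, linearFieldCLM_apply]
  simp [linearField, Ring.lie_def, Matrix.vecMul_sub, Matrix.vecMul_vecMul]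

/-- The derivative of an entire function along a linear field. -/
def fieldDeriv (A : Matrix (Fin n) (Fin n) ℂ) : entireFunctions n →ₗ[ℂ] entireFunctions n where
  toFun f := ⟨fun x => fderiv ℂ f.1 x (linearField A x),
    fderiv_apply_analyticOnNhd f (linearField_analyticOnNhd A)⟩
  map_add' f g := by
    ext x
    exact DFunLike.congr_fun (fderiv_add (entire_differentiable f x) (entire_differentiable g x))
      (linearField A x)
  map_smul' c f := by
    ext x
    exact DFunLike.congr_fun (fderiv_const_smul (entire_differentiable f x) c) (linearField A x)

theorem fieldDeriv_apply (A : Matrix (Fin n) (Fin n) ℂ) (f : entireFunctions n) (x : Fin n → ℂ) :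
    (fieldDeriv A f).1 x = fderiv ℂ f.1 x (linearField A x) := rfl

/-- The Chevalley--Eilenberg differential with coefficients in the entire functions, on which the
linear fields act by derivations. -/
def coeffDiff (k : ℕ) (a : linearLogFields Δ [⋀^Fin k]→ₗ[ℂ] entireFunctions n)
    (A : Fin (k + 1) → linearLogFields Δ) : entireFunctions n :=
  ∑ i : Fin (k + 1), (-1 : ℂ) ^ (i : ℕ) • fieldDeriv (A i).1 (a (i.removeNth A)) + bracketPart k a A

theorem coeffDiff_apply (a : linearLogFields Δ [⋀^Fin k]→ₗ[ℂ] entireFunctions n)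
    (A : Fin (k + 1) → linearLogFields Δ) (x : Fin n → ℂ) :
    (coeffDiff k a A).1 x =
      ∑ i : Fin (k + 1), (-1 : ℂ) ^ (i : ℕ) * fderiv ℂ (a (i.removeNth A)).1 x (evalField Δ x (A i))
        + bracketPart k ((evalAt x).compAlternatingMap a) A := by
  change evalAt x (_ + _) = _
  rw [map_add, map_sum, map_bracketPart]
  rfl

namespace HasCoeff

variable {ω : FormOn n k} {a : linearLogFields Δ [⋀^Fin k]→ₗ[ℂ] entireFunctions n}

theorem fderiv_apply (h : HasCoeff ω a) {x : Fin n → ℂ} (hx : Δ.1 x ≠ 0)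
    (A : Fin k → linearLogFields Δ) :
    fderiv ℂ (fun y => ω y fun i => evalField Δ y (A i)) x = fderiv ℂ (a A).1 x := by
  refine Filter.EventuallyEq.fderiv_eq ?_
  filter_upwards [compl_divisor_nhds Δ hx] with y hy
  exact (h y hy A).symm

theorem sum_fderiv_apply {x : Fin n → ℂ} (h : HasCoeff ω a) (hx : Δ.1 x ≠ 0)
    (A : Fin (k + 1) → linearLogFields Δ) :
    ∑ i : Fin (k + 1), (-1) ^ (i : ℕ) • fderiv ℂ (fun y => ω y (i.removeNth
        fun j => linearField (A j).1 y)) x (linearField (A i).1 x) =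
      ∑ i : Fin (k + 1),
        (-1 : ℂ) ^ (i : ℕ) * fderiv ℂ (a (i.removeNth A)).1 x (evalField Δ x (A i)) := by
  refine Finset.sum_congr rfl fun i _ => ?_
  rw [← h.fderiv_apply hx (i.removeNth A), zsmul_eq_mul]
  push_cast
  rfl

theorem sum_lieBracket_apply {k : ℕ} {ω : FormOn n (k + 1)}
    {a : linearLogFields Δ [⋀^Fin (k + 1)]→ₗ[ℂ] entireFunctions n} {x : Fin n → ℂ}
    (h : HasCoeff ω a) (hx : Δ.1 x ≠ 0) (A : Fin (k + 2) → linearLogFields Δ) :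
    ∑ i : Fin (k + 1), ∑ j ≥ i, (-1) ^ (i + j : ℕ) • ω x (Matrix.vecCons
        (VectorField.lieBracket ℂ (linearField (A i.castSucc).1) (linearField (A j.succ).1) x)
        (j.removeNth (i.castSucc.removeNth fun l => linearField (A l).1 x))) =
      -bracketPart (k + 1) ((evalAt x).compAlternatingMap a) A := by
  rw [bracketPart, neg_neg]
  refine Finset.sum_congr rfl fun i _ => Finset.sum_congr rfl fun j _ => ?_
  have hvec : (fun l => evalField Δ x ((Matrix.vecCons ⁅A i.castSucc, A j.succ⁆
      (j.removeNth (i.castSucc.removeNth A)) : Fin (k + 1) → _) l)) =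
      Matrix.vecCons (linearField ⁅(A i.castSucc).1, (A j.succ).1⁆ x)
        (j.removeNth (i.castSucc.removeNth fun l => linearField (A l).1 x)) :=
    funext (Fin.cases rfl fun _ => rfl)
  rw [lieBracket_linearField, ← hvec, ← h x hx, zsmul_eq_mul]
  push_cast
  rfl

theorem extDeriv_apply (h : HasCoeff ω a) {x : Fin n → ℂ} (hx : Δ.1 x ≠ 0)
    (hω : AnalyticAt ℂ ω x) (A : Fin (k + 1) → linearLogFields Δ) :
    (extDeriv ω x fun i => evalField Δ x (A i)) = (coeffDiff k a A).1 x := by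
  have hV (i) : DifferentiableAt ℂ (linearField (A i).1) x :=
    (linearField_analyticOnNhd (A i).1 x (Set.mem_univ x)).differentiableAt
  rw [coeffDiff_apply, ← h.sum_fderiv_apply hx]
  cases k with
  | zero =>
    refine (extDeriv_apply_vectorField_of_pairwise_commute (V := fun i => linearField (A i).1)
      hω.differentiableAt hV fun i j hij => (hij (Subsingleton.elim (α := Fin 1) i j)).elim).trans
      (add_zero _).symm
  | succ k =>
    refine (extDeriv_apply_vectorField (V := fun i => linearField (A i).1)
      hω.differentiableAt hV).trans ?_
    rw [h.sum_lieBracket_apply hx, sub_neg_eq_add]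

theorem logExtDeriv (h0 : Δ ≠ 0) (h : HasCoeff ω a) (hω : ∀ x, Δ.1 x ≠ 0 → AnalyticAt ℂ ω x) :
    ∃ b : linearLogFields Δ [⋀^Fin (k + 1)]→ₗ[ℂ] entireFunctions n,
      HasCoeff (logExtDeriv Δ ω) b ∧ ∀ A, b A = coeffDiff k a A := by
  have hdiff (A : Fin (k + 1) → linearLogFields Δ) (x) (hx : Δ.1 x ≠ 0) :
      (coeffDiff k a A).1 x = LFD.logExtDeriv Δ ω x fun i => evalField Δ x (A i) := by
    rw [← h.extDeriv_apply hx (hω x hx), LFD.logExtDeriv, if_neg hx]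
  obtain ⟨b, hb⟩ := exists_hasCoeff h0 fun A => ⟨coeffDiff k a A, hdiff A⟩
  exact ⟨b, hb, fun A =>
    entire_ext_off_divisor h0 fun x hx => (hb x hx A).trans (hdiff A x hx).symm⟩

end HasCoeff

end Differential

section LinearFree

variable (S : LinearFrame Δ) (hΔ : IsReducedEquation Δ)

include hΔ in
theorem formOfCoeff_mem_logForms (a : linearLogFields Δ [⋀^Fin k]→ₗ[ℂ] entireFunctions n) :
    formOfCoeff S a ∈ logForms Δ k := by
  refine ⟨fun x hx => by rw [formOfCoeff, if_pos hx], fun x hx => formOfCoeff_analyticAt S a hx,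
    exists_mul_formOfCoeff_extends S hΔ a, ?_⟩
  obtain ⟨b, hb, -⟩ := (hasCoeff_formOfCoeff S a).logExtDeriv hΔ.ne_zero
    fun x hx => formOfCoeff_analyticAt S a hx
  obtain ⟨θ, hθ, h⟩ := exists_mul_formOfCoeff_extends S hΔ b
  refine ⟨θ, hθ, fun x hx => ?_⟩
  rw [← h x hx, (hasCoeff_formOfCoeff S b).eq_form S hb hx, logExtDeriv, if_neg hx]

/-- Logarithmic forms are the alternating maps on the linear logarithmic fields with entire
values. -/
def coeffEquiv (k : ℕ) :
    logForms Δ k ≃ₗ[ℂ] (linearLogFields Δ [⋀^Fin k]→ₗ[ℂ] entireFunctions n) where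
  toFun ω := (exists_hasCoeff_of_mem_logForms hΔ ω.2).choose
  map_add' ω η := by
    refine (exists_hasCoeff_of_mem_logForms hΔ (ω + η).2).choose_spec.unique hΔ.ne_zero
      fun x hx A => ?_
    exact congrArg₂ (· + ·) ((exists_hasCoeff_of_mem_logForms hΔ ω.2).choose_spec x hx A)
      ((exists_hasCoeff_of_mem_logForms hΔ η.2).choose_spec x hx A)
  map_smul' c ω :=
    (exists_hasCoeff_of_mem_logForms hΔ (c • ω).2).choose_spec.unique hΔ.ne_zero fun x hx A =>
      congrArg (c • ·) ((exists_hasCoeff_of_mem_logForms hΔ ω.2).choose_spec x hx A)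
  invFun a := ⟨formOfCoeff S a, formOfCoeff_mem_logForms S hΔ a⟩
  left_inv ω := by
    ext1
    funext x
    by_cases hx : Δ.1 x = 0
    · exact ((formOfCoeff_mem_logForms S hΔ _).1 x hx).trans (ω.2.1 x hx).symm
    · exact (hasCoeff_formOfCoeff S _).eq_form S
        (exists_hasCoeff_of_mem_logForms hΔ ω.2).choose_spec hx
  right_inv a := (exists_hasCoeff_of_mem_logForms hΔ
    (formOfCoeff_mem_logForms S hΔ a)).choose_spec.unique hΔ.ne_zero (hasCoeff_formOfCoeff S a)

theorem hasCoeff_coeffEquiv (ω : logForms Δ k) : HasCoeff ω.1 (coeffEquiv S hΔ k ω) :=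
  (exists_hasCoeff_of_mem_logForms hΔ ω.2).choose_spec

theorem coeffEquiv_logD (ω : logForms Δ k) (A : Fin (k + 1) → linearLogFields Δ) :
    coeffEquiv S hΔ (k + 1) (logD Δ k ω) A = coeffDiff k (coeffEquiv S hΔ k ω) A := by
  obtain ⟨b, hb, h⟩ := (hasCoeff_coeffEquiv S hΔ ω).logExtDeriv hΔ.ne_zero ω.2.2.1
  rw [← h, hb.unique hΔ.ne_zero (hasCoeff_coeffEquiv S hΔ (logD Δ k ω))]

/-- The values at the origin of the coefficients of a logarithmic form. -/
def coeffAtZero (k : ℕ) : logForms Δ k →ₗ[ℂ] (linearLogFields Δ [⋀^Fin k]→ₗ[ℂ] ℂ) where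
  toFun ω := (evalAt 0).compAlternatingMap (coeffEquiv S hΔ k ω)
  map_add' ω η := by rw [map_add]; rfl
  map_smul' c ω := by rw [map_smul]; ext1 A; rfl

theorem linearField_zero_right (A : Matrix (Fin n) (Fin n) ℂ) : linearField A 0 = 0 :=
  Matrix.zero_vecMul A

theorem coeffAtZero_logD (ω : logForms Δ k) :
    coeffAtZero S hΔ (k + 1) (logD Δ k ω) =
      ceDiff (linearLogFields Δ) k (coeffAtZero S hΔ k ω) := by
  ext1 A
  change (coeffEquiv S hΔ (k + 1) (logD Δ k ω) A).1 0 = _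
  rw [coeffEquiv_logD, coeffDiff_apply, bracketPart_eq_ceDiff]
  simp only [evalField_apply, linearField_zero_right, map_zero, mul_zero,
    Finset.sum_const_zero, zero_add]
  rfl

end LinearFree

section DegreeZero

theorem eq_const_of_homogeneous (S : LinearFrame Δ) (h0 : Δ ≠ 0) {f : entireFunctions n}
    (h : ∀ (t : ℂ) (x : Fin n → ℂ), t ≠ 0 → Δ.1 x ≠ 0 → Δ.1 (t • x) ≠ 0 → f.1 (t • x) = f.1 x)
    (x : Fin n → ℂ) : f.1 x = f.1 0 := by
  refine congrFun (eq_of_eq_off_divisorSet h0 (entire_continuous f)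
    (g := fun _ => f.1 0) continuous_const fun y hy => ?_) x
  have hscale (t : ℂ) (ht : t ∈ ({0}ᶜ : Set ℂ)) : f.1 (t • y) = f.1 y :=
    h t y ht hy fun h => hy ((S.smul_mem_divisor_iff h0 ht).1 h)
  have := congrFun (Continuous.ext_on (dense_compl_singleton (0 : ℂ))
    ((entire_continuous f).comp (by fun_prop : Continuous fun t : ℂ => t • y))
    continuous_const hscale) 0
  simpa using this.symm

theorem apply_smul_evalField (ω : FormOn n k) (t : ℂ) (x y : Fin n → ℂ)
    (A : Fin k → linearLogFields Δ) :
    (ω y fun i => evalField Δ (t • x) (A i)) = t ^ k * ω y fun i => evalField Δ x (A i) := by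
  simpa [evalField_smul] using
    (ω y).toMultilinearMap.map_smul_univ (fun _ => t) fun i => evalField Δ x (A i)

variable (S : LinearFrame Δ) {ω : FormOn n k}
  {a : linearLogFields Δ [⋀^Fin k]→ₗ[ℂ] entireFunctions n}

include S in
theorem coeff_eq_const (hΔ : IsReducedEquation Δ) (hω : ω ∈ degZeroForms Δ k)
    (ha : HasCoeff ω a) (A : Fin k → linearLogFields Δ) (x : Fin n → ℂ) :
    (a A).1 x = (a A).1 0 := by
  refine eq_const_of_homogeneous S hΔ.ne_zero (fun t y ht hy hty => ?_) x
  rw [ha _ hty, ha _ hy, ← hω.2 t y ht hy hty, apply_smul_evalField]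
  rfl

include S in
theorem mem_degZeroForms_of_const (hω : ω ∈ logForms Δ k) (ha : HasCoeff ω a)
    (hconst : ∀ A x, (a A).1 x = (a A).1 0) : ω ∈ degZeroForms Δ k := by
  refine ⟨hω, fun t x _ hx htx => ?_⟩
  ext v
  choose A hA using fun i => (S.evalField_bijective hx).2 (v i)
  obtain rfl : (fun i => evalField Δ x (A i)) = v := funext hA
  rw [← ha _ hx, hconst, ← hconst A (t • x), ha _ htx, apply_smul_evalField]
  rfl

/-- Constant functions as entire functions. -/
def constEntire (n : ℕ) : ℂ →ₗ[ℂ] entireFunctions n := Algebra.linearMap ℂ (entireFunctions n)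

variable (hΔ : IsReducedEquation Δ)

/-- Logarithmic forms of degree zero are the alternating forms on the Lie algebra of linear
logarithmic fields. -/
def degZeroEquiv (k : ℕ) : degZeroForms Δ k ≃ₗ[ℂ] (linearLogFields Δ [⋀^Fin k]→ₗ[ℂ] ℂ) :=
  LinearEquiv.ofBijective
    ((coeffAtZero S hΔ k).comp (Submodule.inclusion (degZeroForms_le Δ k))) <| by
    constructor
    · refine (injective_iff_map_eq_zero _).2 fun ω hω => ?_
      let η := Submodule.inclusion (degZeroForms_le Δ k) ω
      have hcoeff : coeffEquiv S hΔ k η = 0 := by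
        ext A x
        exact (coeff_eq_const S hΔ ω.2 (hasCoeff_coeffEquiv S hΔ η) A x).trans
          (congrArg (fun φ => φ A) hω)
      exact Submodule.inclusion_injective _
        (((coeffEquiv S hΔ k).map_eq_zero_iff.1 hcoeff).trans (map_zero _).symm)
    · intro c
      let a := (constEntire n).compAlternatingMap c
      refine ⟨⟨formOfCoeff S a, mem_degZeroForms_of_const S (formOfCoeff_mem_logForms S hΔ a)
        (hasCoeff_formOfCoeff S a) fun A x => rfl⟩, ?_⟩
      ext1 A
      exact congrArg (fun φ : linearLogFields Δ [⋀^Fin k]→ₗ[ℂ] entireFunctions n => (φ A).1 0)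
        ((coeffEquiv S hΔ k).apply_symm_apply a)

theorem degZeroEquiv_apply (ω : degZeroForms Δ k) (A : Fin k → linearLogFields Δ)
    {x : Fin n → ℂ} (hx : Δ.1 x ≠ 0) :
    degZeroEquiv S hΔ k ω A = ω.1 x fun i => evalField Δ x (A i) := by
  have h := hasCoeff_coeffEquiv S hΔ (Submodule.inclusion (degZeroForms_le Δ k) ω)
  exact (coeff_eq_const S hΔ ω.2 h A x).symm.trans (h x hx A)

/-- Evaluation of the coefficients at the origin, as a morphism of complexes. -/
def coeffAtZeroHom : logComplex Δ ⟶ ceComplex (linearLogFields Δ) :=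
  CochainComplex.ofHom (fun k => ModuleCat.ofHom (coeffAtZero S hΔ k)) (fun k => by
    simp only [logComplex, ceComplex, CochainComplex.of_d]
    ext ω : 2
    exact (coeffAtZero_logD S hΔ ω).symm)

theorem isIso_degZeroInclusion_comp : IsIso (degZeroInclusion Δ ≫ coeffAtZeroHom S hΔ) := by
  have (k : ℕ) : IsIso ((degZeroInclusion Δ ≫ coeffAtZeroHom S hΔ).f k) :=
    (ConcreteCategory.isIso_iff_bijective _).2 (degZeroEquiv S hΔ k).bijective
  exact HomologicalComplex.Hom.isIso_of_components _

/-- The complex of logarithmic forms of degree zero is the Chevalley--Eilenberg complex. -/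
def degZeroIso : degZeroComplex Δ ≅ ceComplex (linearLogFields Δ) :=
  have := isIso_degZeroInclusion_comp S hΔ
  asIso (degZeroInclusion Δ ≫ coeffAtZeroHom S hΔ)

theorem degZeroIso_hom_apply (k : ℕ) (ω : degZeroForms Δ k) (A : Fin k → linearLogFields Δ)
    {x : Fin n → ℂ} (hx : x ∉ divisorSet Δ) :
    (show linearLogFields Δ [⋀^Fin k]→ₗ[ℂ] ℂ from ((degZeroIso S hΔ).hom.f k).hom ω) A =
      ω.1 x (fun i => linearField (A i).1 x) :=
  degZeroEquiv_apply S hΔ ω A hx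

end DegreeZero

end Forms

section Central

theorem sum_ge_succ {M : Type*} [AddCommMonoid M] {m : ℕ} (i : Fin m) (f : Fin (m + 1) → M) :
    ∑ j ≥ i.succ, f j = ∑ j ≥ i, f j.succ := by
  rw [← Fin.map_succEmb_Ici, Finset.sum_map]
  rfl

theorem alternatingMap_swap_vecCons {R E F : Type*} [CommRing R] [AddCommGroup E] [Module R E]
    [AddCommGroup F] [Module R F] {k : ℕ} (b : E [⋀^Fin (k + 2)]→ₗ[R] F) (x y : E) (v : Fin k → E) :
    b (Matrix.vecCons x (Matrix.vecCons y v)) = -b (Matrix.vecCons y (Matrix.vecCons x v)) := by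
  have hself (z : E) : b (Matrix.vecCons z (Matrix.vecCons z v)) = 0 :=
    b.map_eq_zero_of_eq _ (i := 0) (j := 1) rfl zero_ne_one
  have hadd (z : E) : b (Matrix.vecCons z (Matrix.vecCons (x + y) v)) =
      b (Matrix.vecCons z (Matrix.vecCons x v)) + b (Matrix.vecCons z (Matrix.vecCons y v)) :=
    (b.curryLeft z).map_vecCons_add v x y
  have hsum := hself (x + y)
  rw [b.map_vecCons_add, hadd, hadd, hself, hself, zero_add, add_zero] at hsum
  exact eq_neg_of_add_eq_zero_left hsum

variable {L M : Type} [LieRing L] [LieAlgebra ℂ L] [AddCommGroup M] [Module ℂ M] {k : ℕ} {z : L}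

theorem bracketPart_vecCons_of_central (hz : ∀ x : L, ⁅z, x⁆ = 0)
    (b : L [⋀^Fin (k + 1)]→ₗ[ℂ] M) (A : Fin (k + 1) → L) :
    bracketPart (k + 1) b (Matrix.vecCons z A) = -bracketPart k (b.curryLeft z) A := by
  have hzero : ∑ j ≥ (0 : Fin (k + 1)), (-1 : ℂ) ^ (((0 : Fin (k + 1)) : ℕ) + (j : ℕ)) •
      b (Matrix.vecCons ⁅(Matrix.vecCons z A : Fin (k + 2) → L) (Fin.castSucc 0),
        (Matrix.vecCons z A : Fin (k + 2) → L) j.succ⁆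
        (j.removeNth ((Fin.castSucc 0).removeNth (Matrix.vecCons z A)))) = 0 :=
    Finset.sum_eq_zero fun j _ => by
      rw [Fin.castSucc_zero, Matrix.cons_val_zero, hz, b.map_coord_zero 0 rfl, smul_zero]
  rw [bracketPart, Fin.sum_univ_succ, hzero, zero_add]
  cases k with
  | zero => simp [bracketPart]
  | succ k =>
    rw [bracketPart, neg_neg, ← Finset.sum_neg_distrib]
    refine Finset.sum_congr rfl fun i _ => ?_
    rw [sum_ge_succ, ← Finset.sum_neg_distrib]
    refine Finset.sum_congr rfl fun j _ => ?_
    have hsign : (-1 : ℂ) ^ ((i.succ : ℕ) + (j.succ : ℕ)) = (-1) ^ ((i : ℕ) + (j : ℕ)) := by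
      rw [Fin.val_succ, Fin.val_succ]
      ring
    rw [← Fin.succ_castSucc, removeNth_succ_vecCons, removeNth_succ_vecCons, hsign]
    simp only [Matrix.cons_val_succ, AlternatingMap.curryLeft_apply_apply]
    rw [alternatingMap_swap_vecCons, smul_neg, neg_neg]

end Central

section EulerField

variable {n : ℕ} {Δ : entireFunctions n} {k : ℕ}

section EulerInverse

theorem fieldDeriv_one_apply (f : entireFunctions n) (x : Fin n → ℂ) :
    (fieldDeriv 1 f).1 x = fderiv ℂ f.1 x x := by
  rw [fieldDeriv_apply, linearField_one]

theorem eq_of_euler_eq {f g : entireFunctions n} (h : fieldDeriv 1 f = fieldDeriv 1 g)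
    (h0 : f.1 0 = g.1 0) : f = g := by
  refine sub_eq_zero.1 (Subtype.ext (funext fun x => ?_))
  have hconst := eq_apply_zero_of_fderiv_self_eq_zero (f - g).2 (fun y => by
    rw [← fieldDeriv_one_apply, map_sub, h, sub_self]
    rfl) x
  exact hconst.trans (sub_eq_zero.2 h0)

theorem exists_euler_primitive (f : entireFunctions n) :
    ∃ g : entireFunctions n, fieldDeriv 1 g = f - constEntire n (f.1 0) ∧ g.1 0 = 0 := by
  obtain ⟨g, hg, hderiv, h0⟩ := exists_fderiv_self_eq_sub f.2
  exact ⟨⟨g, hg⟩, Subtype.ext (funext fun x => (fieldDeriv_one_apply _ x).trans (hderiv x)), h0⟩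

/-- The inverse of the Euler derivation on entire functions without constant term, extended by
zero to the constants: it divides the homogeneous part of degree `m` by `m`. -/
def eulerInv (n : ℕ) : entireFunctions n →ₗ[ℂ] entireFunctions n where
  toFun f := (exists_euler_primitive f).choose
  map_add' f g := by
    have hf := (exists_euler_primitive f).choose_spec
    have hg := (exists_euler_primitive g).choose_spec
    have hfg := (exists_euler_primitive (f + g)).choose_spec
    refine eq_of_euler_eq ?_ ?_
    · rw [hfg.1, map_add, hf.1, hg.1,
        show constEntire n ((f + g).1 0) = constEntire n (f.1 0) + constEntire n (g.1 0) from
          map_add _ _ _]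
      abel
    · rw [hfg.2]
      exact ((congrArg₂ (· + ·) hf.2 hg.2).trans (add_zero 0)).symm
  map_smul' c f := by
    have hf := (exists_euler_primitive f).choose_spec
    have hcf := (exists_euler_primitive (c • f)).choose_spec
    refine eq_of_euler_eq ?_ ?_
    · rw [hcf.1, RingHom.id_apply, map_smul, hf.1,
        show constEntire n ((c • f).1 0) = c • constEntire n (f.1 0) from
          (constEntire n).map_smul c (f.1 0), smul_sub]
    · rw [hcf.2]
      exact ((congrArg (c • ·) hf.2).trans (smul_zero c)).symm

theorem fieldDeriv_eulerInv (f : entireFunctions n) :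
    fieldDeriv 1 (eulerInv n f) = f - constEntire n (f.1 0) :=
  (exists_euler_primitive f).choose_spec.1

theorem eulerInv_apply_zero (f : entireFunctions n) : (eulerInv n f).1 0 = 0 :=
  (exists_euler_primitive f).choose_spec.2

theorem fieldDeriv_apply_zero (A : Matrix (Fin n) (Fin n) ℂ) (f : entireFunctions n) :
    (fieldDeriv A f).1 0 = 0 := by
  rw [fieldDeriv_apply, linearField_zero_right, ContinuousLinearMap.map_zero]

theorem fieldDeriv_const (A : Matrix (Fin n) (Fin n) ℂ) (c : ℂ) :
    fieldDeriv A (constEntire n c) = 0 := by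
  ext x
  change fderiv ℂ (fun _ => c) x _ = 0
  simp

theorem fieldDeriv_one_comm (A : Matrix (Fin n) (Fin n) ℂ) (f : entireFunctions n) :
    fieldDeriv 1 (fieldDeriv A f) = fieldDeriv A (fieldDeriv 1 f) := by
  ext x
  have hsym : IsSymmSndFDerivAt ℂ f.1 x :=
    ((f.2 x (Set.mem_univ x)).contDiffAt (n := ⊤)).isSymmSndFDerivAt (by simp)
  refine (fderiv_dir_linearField f.2 A x (linearField 1 x)).trans
    (Eq.trans ?_ (fderiv_dir_linearField f.2 1 x (linearField A x)).symm)
  rw [hsym.eq]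
  simp only [linearField_one]

theorem eulerInv_fieldDeriv (A : Matrix (Fin n) (Fin n) ℂ) (f : entireFunctions n) :
    eulerInv n (fieldDeriv A f) = fieldDeriv A (eulerInv n f) := by
  refine eq_of_euler_eq ?_ ?_
  · rw [fieldDeriv_eulerInv, fieldDeriv_one_comm, fieldDeriv_eulerInv, map_sub,
      fieldDeriv_apply_zero, fieldDeriv_const, map_zero]
  · rw [eulerInv_apply_zero, fieldDeriv_apply_zero]

theorem eulerInv_fieldDeriv_one (f : entireFunctions n) :
    eulerInv n (fieldDeriv 1 f) = f - constEntire n (f.1 0) := by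
  rw [eulerInv_fieldDeriv, fieldDeriv_eulerInv]

end EulerInverse

section EulerHomotopy

variable (S : LinearFrame Δ) (hΔ : IsReducedEquation Δ)

/-- The Euler field as an element of the Lie algebra of linear logarithmic fields. -/
def eulerField : linearLogFields Δ :=
  ⟨1, S.one_mem hΔ⟩

theorem eulerField_lie (A : linearLogFields Δ) :
    ⁅eulerField S hΔ, A⁆ = 0 := by
  apply Subtype.ext
  change ⁅(1 : Matrix (Fin n) (Fin n) ℂ), A.1⁆ = 0
  rw [Ring.lie_def, one_mul, mul_one, sub_self]

theorem coeffDiff_euler (b : linearLogFields Δ [⋀^Fin (k + 1)]→ₗ[ℂ] entireFunctions n)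
    (A : Fin (k + 1) → linearLogFields Δ) :
    coeffDiff (k + 1) b (Matrix.vecCons (eulerField S hΔ) A) =
      fieldDeriv 1 (b A) - coeffDiff k (b.curryLeft (eulerField S hΔ)) A := by
  have hsucc : ∑ i : Fin (k + 1), (-1 : ℂ) ^ (i.succ : ℕ) •
      fieldDeriv ((Matrix.vecCons (eulerField S hΔ) A : Fin (k + 2) → _) i.succ).1
        (b (Fin.removeNth i.succ (Matrix.vecCons (eulerField S hΔ) A : Fin (k + 2) → _))) =
      -∑ i : Fin (k + 1), (-1 : ℂ) ^ (i : ℕ) •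
        fieldDeriv (A i).1 (b.curryLeft (eulerField S hΔ) (i.removeNth A)) := by
    rw [← Finset.sum_neg_distrib]
    refine Finset.sum_congr rfl fun i _ => ?_
    rw [removeNth_succ_vecCons, Fin.val_succ, pow_succ, mul_neg_one, neg_smul]
    rfl
  rw [coeffDiff, coeffDiff, bracketPart_vecCons_of_central (eulerField_lie S hΔ),
    Fin.sum_univ_succ, hsucc, Fin.val_zero, pow_zero, one_smul, sub_eq_add_neg, neg_add, add_assoc]
  rfl

theorem coeffDiff_eulerInv (b : linearLogFields Δ [⋀^Fin k]→ₗ[ℂ] entireFunctions n)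
    (A : Fin (k + 1) → linearLogFields Δ) :
    coeffDiff k ((eulerInv n).compAlternatingMap b) A = eulerInv n (coeffDiff k b A) := by
  simp only [coeffDiff, map_add, map_sum, map_smul, map_bracketPart, eulerInv_fieldDeriv,
    LinearMap.compAlternatingMap_apply]

/-- Contraction with `x` followed by `eulerInv`. -/
def eulerContraction (x : linearLogFields Δ) (k : ℕ) :
    (linearLogFields Δ [⋀^Fin (k + 1)]→ₗ[ℂ] entireFunctions n) →ₗ[ℂ]
      (linearLogFields Δ [⋀^Fin k]→ₗ[ℂ] entireFunctions n) where
  toFun b := (eulerInv n).compAlternatingMap (b.curryLeft x)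
  map_add' b c := by
    ext1 A
    exact map_add (eulerInv n) _ _
  map_smul' c b := by
    ext1 A
    exact map_smul (eulerInv n) c _

/-- The homotopy operator: contraction with the Euler field followed by `eulerInv`. -/
def eulerHomotopy (k : ℕ) :
    logForms Δ (k + 1) →ₗ[ℂ] logForms Δ k :=
  (coeffEquiv S hΔ k).symm.toLinearMap ∘ₗ eulerContraction (eulerField S hΔ) k ∘ₗ
    (coeffEquiv S hΔ (k + 1)).toLinearMap

theorem coeffEquiv_eulerHomotopy
    (ω : logForms Δ (k + 1)) (A : Fin k → linearLogFields Δ) :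
    coeffEquiv S hΔ k (eulerHomotopy S hΔ k ω) A =
      eulerInv n (coeffEquiv S hΔ (k + 1) ω (Matrix.vecCons (eulerField S hΔ) A)) := by
  change coeffEquiv S hΔ k ((coeffEquiv S hΔ k).symm _) A = _
  rw [LinearEquiv.apply_symm_apply]
  rfl

/-- The morphism from the Chevalley--Eilenberg complex to the logarithmic forms. -/
def constCoeffHom :
    ceComplex (linearLogFields Δ) ⟶ logComplex Δ :=
  (degZeroIso S hΔ).inv ≫ degZeroInclusion Δ

/-- The logarithmic form with given constant coefficients. -/
def constCoeff (k : ℕ)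
    (c : linearLogFields Δ [⋀^Fin k]→ₗ[ℂ] ℂ) : logForms Δ k :=
  ((constCoeffHom S hΔ).f k).hom c

theorem constCoeffHom_comp :
    constCoeffHom S hΔ ≫ coeffAtZeroHom S hΔ = 𝟙 _ := by
  rw [constCoeffHom, Category.assoc]
  exact (degZeroIso S hΔ).inv_hom_id

theorem coeffEquiv_constCoeff
    (c : linearLogFields Δ [⋀^Fin k]→ₗ[ℂ] ℂ) (A : Fin k → linearLogFields Δ) :
    coeffEquiv S hΔ k (constCoeff S hΔ k c) A = constEntire n (c A) := by
  let ω : degZeroForms Δ k := ((degZeroIso S hΔ).inv.f k).hom c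
  have hω : coeffAtZero S hΔ k (Submodule.inclusion (degZeroForms_le Δ k) ω) = c :=
    congrArg (fun φ : ceComplex (linearLogFields Δ) ⟶ ceComplex (linearLogFields Δ) =>
      (φ.f k).hom c) (degZeroIso S hΔ).inv_hom_id
  ext x
  refine (coeff_eq_const S hΔ ω.2 (hasCoeff_coeffEquiv S hΔ
    (Submodule.inclusion (degZeroForms_le Δ k) ω)) A x).trans ?_
  exact congrArg (fun φ => φ A) hω

theorem coeffEquiv_sub_apply (ω η : logForms Δ k)
    (A : Fin k → linearLogFields Δ) :
    coeffEquiv S hΔ k (ω - η) A = coeffEquiv S hΔ k ω A - coeffEquiv S hΔ k η A :=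
  congrArg (fun φ : linearLogFields Δ [⋀^Fin k]→ₗ[ℂ] entireFunctions n => φ A)
    ((coeffEquiv S hΔ k).toLinearMap.map_sub ω η)

theorem sub_constCoeff_zero (ω : logForms Δ 0) :
    ω - constCoeff S hΔ 0 (coeffAtZero S hΔ 0 ω) =
      eulerHomotopy S hΔ 0 (logD Δ 0 ω) := by
  apply (coeffEquiv S hΔ 0).injective
  ext1 A
  rw [coeffEquiv_eulerHomotopy, coeffEquiv_logD, coeffDiff, bracketPart, add_zero,
    Fin.sum_univ_succ, Fin.sum_univ_zero, add_zero, Fin.val_zero, pow_zero, one_smul]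
  rw [coeffEquiv_sub_apply, coeffEquiv_constCoeff]
  exact (eulerInv_fieldDeriv_one (coeffEquiv S hΔ 0 ω A)).symm

theorem sub_constCoeff_succ
    (ω : logForms Δ (k + 1)) :
    ω - constCoeff S hΔ (k + 1) (coeffAtZero S hΔ (k + 1) ω) =
      logD Δ k (eulerHomotopy S hΔ k ω) + eulerHomotopy S hΔ (k + 1) (logD Δ (k + 1) ω) := by
  apply (coeffEquiv S hΔ (k + 1)).injective
  ext1 A
  have hdh : coeffEquiv S hΔ (k + 1) (logD Δ k (eulerHomotopy S hΔ k ω)) A =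
      eulerInv n (coeffDiff k ((coeffEquiv S hΔ (k + 1) ω).curryLeft (eulerField S hΔ)) A) := by
    rw [coeffEquiv_logD, ← coeffDiff_eulerInv]
    congr 1
    ext1 B
    exact coeffEquiv_eulerHomotopy S hΔ ω B
  rw [coeffEquiv_sub_apply, coeffEquiv_constCoeff, map_add, AlternatingMap.add_apply, hdh,
    coeffEquiv_eulerHomotopy, coeffEquiv_logD, coeffDiff_euler, map_sub, eulerInv_fieldDeriv_one,
    add_sub_cancel]
  rfl

/-- The components of the homotopy between the identity and the projection to degree zero. -/
def eulerHomotopyHom :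
    ∀ i j, (ComplexShape.up ℕ).Rel j i → ((logComplex Δ).X i ⟶ (logComplex Δ).X j) :=
  fun i j h => by
    obtain rfl : j + 1 = i := h
    exact ModuleCat.ofHom (eulerHomotopy S hΔ j)

theorem id_sub_eq_nullHomotopicMap :
    𝟙 (logComplex Δ) - coeffAtZeroHom S hΔ ≫ constCoeffHom S hΔ =
      Homotopy.nullHomotopicMap' (eulerHomotopyHom S hΔ) := by
  have hd (k : ℕ) : (logComplex Δ).d k (k + 1) = ModuleCat.ofHom (logD Δ k) := by
    simp only [logComplex, CochainComplex.of_d]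
  ext k : 1
  cases k with
  | zero =>
    rw [Homotopy.nullHomotopicMap'_f_of_not_rel_right
      (show (ComplexShape.up ℕ).Rel 0 1 from rfl) (by simp), hd]
    ext ω : 2
    exact sub_constCoeff_zero S hΔ ω
  | succ k =>
    rw [Homotopy.nullHomotopicMap'_f (show (ComplexShape.up ℕ).Rel k (k + 1) from rfl)
      (show (ComplexShape.up ℕ).Rel (k + 1) (k + 2) from rfl), hd, hd]
    ext ω : 2
    refine (sub_constCoeff_succ S hΔ ω).trans (add_comm _ _)

/-- The logarithmic complex is homotopy equivalent to the Chevalley--Eilenberg complex. -/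
def logHomotopyEquiv :
    HomotopyEquiv (logComplex Δ) (ceComplex (linearLogFields Δ)) where
  hom := coeffAtZeroHom S hΔ
  inv := constCoeffHom S hΔ
  homotopyHomInvId := (Homotopy.equivSubZero.symm ((Homotopy.ofEq
    (id_sub_eq_nullHomotopicMap S hΔ)).trans (Homotopy.nullHomotopy' _))).symm
  homotopyInvHomId := Homotopy.ofEq (constCoeffHom_comp S hΔ)

include S hΔ in
theorem quasiIso_degZeroInclusion :
    QuasiIso (degZeroInclusion Δ) := by
  have : QuasiIso (coeffAtZeroHom S hΔ) :=
    (inferInstance : QuasiIso (logHomotopyEquiv S hΔ).hom)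
  have := isIso_degZeroInclusion_comp S hΔ
  exact quasiIso_of_comp_right (degZeroInclusion Δ) (coeffAtZeroHom S hΔ)

include S hΔ in
theorem nonempty_logCohomology_iso (k : ℕ) :
    Nonempty (logCohomology Δ k ≅ lieCohomology (linearLogFields Δ) k) :=
  ⟨(logHomotopyEquiv S hΔ).toHomologyIso k⟩

end EulerHomotopy

end EulerField

section Symmetries

open Matrix NormedSpace

variable {n : ℕ} {Δ : entireFunctions n}

/-- The transposes of the matrices in `L_D`: the matrices `M` for which the vector field
`x ↦ M x` is logarithmic. -/
def logMatrices (Δ : entireFunctions n) : LieSubalgebra ℂ (Matrix (Fin n) (Fin n) ℂ) where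
  carrier := {M | Mᵀ ∈ linearLogFields Δ}
  add_mem' h1 h2 := by
    simpa only [Set.mem_ofPred_eq, transpose_add] using add_mem h1 h2
  zero_mem' := by
    simp
  smul_mem' c M h := by
    simpa only [Set.mem_ofPred_eq, transpose_smul] using (linearLogFields Δ).smul_mem c h
  lie_mem' {M N} h1 h2 := by
    have h := (linearLogFields Δ).lie_mem h2 h1
    simpa only [Set.mem_ofPred_eq, Ring.lie_def, transpose_sub, transpose_mul] using! h

theorem mem_logMatrices {M : Matrix (Fin n) (Fin n) ℂ} :
    M ∈ logMatrices Δ ↔ Mᵀ ∈ linearLogFields Δ := Iff.rfl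

/-- Transposition as an isomorphism of Lie algebras; the sign makes up for its reversing
products. -/
def logMatricesEquiv (Δ : entireFunctions n) : logMatrices Δ ≃ₗ⁅ℂ⁆ linearLogFields Δ where
  toFun M := ⟨-M.1ᵀ, neg_mem M.2⟩
  invFun A := ⟨-A.1ᵀ, by
    rw [mem_logMatrices, transpose_neg, transpose_transpose]; exact neg_mem A.2⟩
  left_inv M := by ext; simp
  right_inv A := by ext; simp
  map_add' M N := by ext; simp [add_comm]
  map_smul' c M := by ext; simp
  map_lie' {M N} := by ext1; simp [Ring.lie_def]

theorem linearField_transpose (M : Matrix (Fin n) (Fin n) ℂ) (x : Fin n → ℂ) :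
    linearField Mᵀ x = M *ᵥ x := vecMul_transpose M x

theorem mem_logMatrices_iff (hΔ : IsReducedEquation Δ) {M : Matrix (Fin n) (Fin n) ℂ} :
    M ∈ logMatrices Δ ↔ ∀ x, Δ.1 x = 0 → fderiv ℂ Δ.1 x (M *ᵥ x) = 0 := by
  rw [mem_logMatrices, mem_linearLogFields_iff hΔ]
  simp only [linearField_transpose]

/-- The derivative at the identity of the orbit map `g ↦ g x`, that is, evaluation of the linear
logarithmic vector fields at `x`. -/
def orbitMap (Δ : entireFunctions n) (x : Fin n → ℂ) : logMatrices Δ →ₗ[ℂ] (Fin n → ℂ) where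
  toFun M := M.1 *ᵥ x
  map_add' _ _ := add_mulVec _ _ _
  map_smul' _ _ := smul_mulVec _ _ _

@[simp]
theorem orbitMap_apply (x : Fin n → ℂ) (M : logMatrices Δ) : orbitMap Δ x M = M.1 *ᵥ x := rfl

theorem orbitMap_eq (x : Fin n → ℂ) (M : logMatrices Δ) :
    orbitMap Δ x M = evalField Δ x (-logMatricesEquiv Δ M) := by
  change _ = linearField _ x
  rw [orbitMap_apply, ← linearField_transpose]
  change _ = linearField (-(-M.1ᵀ)) x
  rw [neg_neg]

theorem coe_orbitMap (x : Fin n → ℂ) : (orbitMap Δ x : logMatrices Δ → _) =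
    evalField Δ x ∘ ((logMatricesEquiv Δ).toLinearEquiv.toEquiv.trans (Equiv.neg _)) :=
  funext (orbitMap_eq x)

theorem orbitMap_surjective_iff (x : Fin n → ℂ) :
    Function.Surjective (orbitMap Δ x) ↔ Function.Surjective (evalField Δ x) := by
  rw [coe_orbitMap, EquivLike.surjective_comp]

theorem orbitMap_bijective_iff (x : Fin n → ℂ) :
    Function.Bijective (orbitMap Δ x) ↔ Function.Bijective (evalField Δ x) := by
  rw [coe_orbitMap, EquivLike.bijective_comp]

theorem inv_mulVec_mulVec (g : GL (Fin n) ℂ) (x : Fin n → ℂ) : g⁻¹.1 *ᵥ g.1 *ᵥ x = x := by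
  rw [mulVec_mulVec, Units.inv_mul, one_mulVec]

theorem mulVec_inv_mulVec (g : GL (Fin n) ℂ) (x : Fin n → ℂ) : g.1 *ᵥ g⁻¹.1 *ᵥ x = x := by
  rw [mulVec_mulVec, Units.mul_inv, one_mulVec]

theorem mem_stabilizerGroup_iff {g : GL (Fin n) ℂ} :
    g ∈ stabilizerGroup (divisorSet Δ) ↔ ∀ x, Δ.1 (g.1 *ᵥ x) = 0 ↔ Δ.1 x = 0 := by
  change (fun x => g.1 *ᵥ x) '' {x | Δ.1 x = 0} = {x | Δ.1 x = 0} ↔ _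
  rw [Set.image_eq_preimage_of_inverse (inv_mulVec_mulVec g) (mulVec_inv_mulVec g), Set.ext_iff]
  refine ⟨fun h x => ?_, fun h x => ?_⟩
  · simpa only [Set.mem_preimage, Set.mem_ofPred_eq, inv_mulVec_mulVec] using (h (g.1 *ᵥ x)).symm
  · simpa only [Set.mem_preimage, Set.mem_ofPred_eq, mulVec_inv_mulVec] using (h (g⁻¹.1 *ᵥ x)).symm

theorem mem_logMatrices_of_exp (hΔ : IsReducedEquation Δ) {A : Matrix (Fin n) (Fin n) ℂ}
    (h : ∀ (t : ℝ) x, Δ.1 x = 0 → Δ.1 (exp ((t : ℂ) • A) *ᵥ x) = 0) : A ∈ logMatrices Δ := by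
  rw [mem_logMatrices_iff hΔ]
  intro x hx
  have start : exp (((0 : ℝ) : ℂ) • A) *ᵥ x = x := by simp
  have hderiv := (start ▸
    (entire_differentiable Δ x).hasFDerivAt.restrictScalars ℝ).comp_hasDerivAt (0 : ℝ)
      (hasDerivAt_exp_mulVec A x)
  have hconst : (Δ.1 ∘ fun t : ℝ => exp ((t : ℂ) • A) *ᵥ x) = fun _ => 0 :=
    funext fun t => h t x hx
  rw [hconst, start] at hderiv
  exact hderiv.unique (hasDerivAt_const _ _)

theorem conj_mem_logMatrices (hΔ : IsReducedEquation Δ) {g : GL (Fin n) ℂ}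
    (hg : g ∈ stabilizerGroup (divisorSet Δ)) {A : Matrix (Fin n) (Fin n) ℂ}
    (hA : A ∈ logMatrices Δ) : g.1 * A * g⁻¹.1 ∈ logMatrices Δ := by
  rw [mem_stabilizerGroup_iff] at hg
  rw [mem_logMatrices_iff hΔ] at hA ⊢
  let T : (Fin n → ℂ) →L[ℂ] (Fin n → ℂ) := LinearMap.toContinuousLinearMap (Matrix.mulVecLin g.1)
  have hT : ∀ x, T x = g.1 *ᵥ x := fun x => rfl
  let f : entireFunctions n := ⟨fun x => Δ.1 (T x), fun x _ =>
    (Δ.2 (T x) (Set.mem_univ _)).comp (T.analyticAt x)⟩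
  obtain ⟨u, hu⟩ := hΔ.dvd_of_vanishing f fun x hx => (hg x).2 hx
  have fderiv_comp (x) : fderiv ℂ f.1 x (A *ᵥ x) = fderiv ℂ Δ.1 (T x) (T (A *ᵥ x)) :=
    congrArg (· (A *ᵥ x))
      ((entire_differentiable Δ (T x)).hasFDerivAt.comp x T.hasFDerivAt).fderiv
  have tangent : ∀ x, Δ.1 x = 0 → fderiv ℂ Δ.1 (T x) (T (A *ᵥ x)) = 0 := by
    intro x hx
    rw [← fderiv_comp, hu]
    change fderiv ℂ (Δ.1 * u.1) x (A *ᵥ x) = 0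
    rw [fderiv_mul (entire_differentiable Δ x) (entire_differentiable u x)]
    simp [hx, hA x hx]
  intro y hy
  have hinv := tangent (g⁻¹.1 *ᵥ y) (by rw [← hg, mulVec_inv_mulVec]; exact hy)
  rw [hT, hT, mulVec_inv_mulVec] at hinv
  simpa only [mulVec_mulVec, mul_assoc] using hinv

namespace LinearFrame

theorem orbitMap_bijective (S : LinearFrame Δ) {x : Fin n → ℂ} (hx : Δ.1 x ≠ 0) :
    Function.Bijective (orbitMap Δ x) :=
  (orbitMap_bijective_iff x).2 (S.evalField_bijective hx)

theorem ne_zero_iff (S : LinearFrame Δ) (h0 : Δ ≠ 0) (x : Fin n → ℂ) :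
    Δ.1 x ≠ 0 ↔ Function.Surjective (orbitMap Δ x) := by
  rw [orbitMap_surjective_iff, ne_eq, S.eq_zero_iff_not_surjective h0, not_not]

theorem ne_zero_of_conj (S : LinearFrame Δ) (h0 : Δ ≠ 0) {g : GL (Fin n) ℂ}
    (hg : ∀ A ∈ logMatrices Δ, g.1 * A * g⁻¹.1 ∈ logMatrices Δ) {x : Fin n → ℂ}
    (hx : Δ.1 x ≠ 0) : Δ.1 (g.1 *ᵥ x) ≠ 0 := by
  rw [S.ne_zero_iff h0] at hx ⊢
  intro v
  obtain ⟨A, hA⟩ := hx (g⁻¹.1 *ᵥ v)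
  refine ⟨⟨_, hg A.1 A.2⟩, ?_⟩
  rw [orbitMap_apply] at hA ⊢
  rw [mulVec_mulVec, mul_assoc, Units.inv_mul, mul_one, ← mulVec_mulVec, hA,
    mulVec_inv_mulVec]

theorem mem_stabilizerGroup_of_conj (S : LinearFrame Δ) (h0 : Δ ≠ 0) {g : GL (Fin n) ℂ}
    (hg : ∀ A ∈ logMatrices Δ, g.1 * A * g⁻¹.1 ∈ logMatrices Δ)
    (hg' : ∀ A ∈ logMatrices Δ, g⁻¹.1 * A * g.1 ∈ logMatrices Δ) :
    g ∈ stabilizerGroup (divisorSet Δ) := by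
  rw [mem_stabilizerGroup_iff]
  refine fun x => not_iff_not.1 ⟨fun h => ?_, S.ne_zero_of_conj h0 hg⟩
  simpa only [inv_mulVec_mulVec] using S.ne_zero_of_conj h0 (g := g⁻¹)
    (by simpa only [inv_inv] using hg') h

end LinearFrame

/-- The exponential of a matrix as an element of `GLₙ(ℂ)`. -/
def expGL (A : Matrix (Fin n) (Fin n) ℂ) : GL (Fin n) ℂ where
  val := exp A
  inv := exp (-A)
  val_inv := matrix_exp_mul_exp_neg A
  inv_val := by simpa using matrix_exp_mul_exp_neg (-A)

theorem expGL_val (A : Matrix (Fin n) (Fin n) ℂ) : (expGL A).1 = exp A := rfl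

theorem expGL_inv (A : Matrix (Fin n) (Fin n) ℂ) : (expGL A)⁻¹ = expGL (-A) := by
  ext1; rfl

theorem continuous_expGL : Continuous (expGL (n := n)) :=
  Units.continuous_iff.2 ⟨matrix_exp_continuous, matrix_exp_continuous.comp continuous_neg⟩

namespace LinearFrame

theorem expGL_mem_of_normalizes (S : LinearFrame Δ) (h0 : Δ ≠ 0) {X : Matrix (Fin n) (Fin n) ℂ}
    (hX : ∀ B ∈ logMatrices Δ, X * B - B * X ∈ logMatrices Δ) :
    expGL X ∈ stabilizerGroup (divisorSet Δ) := by
  refine S.mem_stabilizerGroup_of_conj h0 (fun A hA => ?_) (fun A hA => ?_)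
  · rw [expGL_inv]
    exact matrix_exp_conj_mem (K := (logMatrices Δ).toSubmodule) hX hA
  · rw [expGL_inv]
    have hneg : ∀ B ∈ logMatrices Δ, -X * B - B * -X ∈ logMatrices Δ := fun B hB => by
      simpa [sub_eq_add_neg, add_comm] using neg_mem (hX B hB)
    simpa [expGL_val] using
      matrix_exp_conj_mem (K := (logMatrices Δ).toSubmodule) (X := -X) hneg hA

theorem mem_logMatrices_of_normalizes (S : LinearFrame Δ) (hΔ : IsReducedEquation Δ)
    {X : Matrix (Fin n) (Fin n) ℂ}
    (hX : ∀ B ∈ logMatrices Δ, X * B - B * X ∈ logMatrices Δ) : X ∈ logMatrices Δ := by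
  refine mem_logMatrices_of_exp hΔ fun t x hx => ?_
  refine (mem_stabilizerGroup_iff.1 (S.expGL_mem_of_normalizes hΔ.ne_zero
    (X := (t : ℂ) • X) fun B hB => ?_) x).2 hx
  simpa [smul_sub] using (logMatrices Δ).smul_mem (t : ℂ) (hX B hB)

theorem expGL_mem (S : LinearFrame Δ) (h0 : Δ ≠ 0) {A : Matrix (Fin n) (Fin n) ℂ}
    (hA : A ∈ logMatrices Δ) : expGL A ∈ stabilizerGroup (divisorSet Δ) :=
  S.expGL_mem_of_normalizes h0 fun _ hB => (logMatrices Δ).lie_mem hA hB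

theorem linearGroupLieAlgebra_eq (S : LinearFrame Δ) (hΔ : IsReducedEquation Δ) :
    linearGroupLieAlgebra (stabilizerGroup (divisorSet Δ)) = logMatrices Δ := by
  have h : {A : Matrix (Fin n) (Fin n) ℂ | ∀ t : ℝ, ∃ g ∈ stabilizerGroup (divisorSet Δ),
      (g : Matrix (Fin n) (Fin n) ℂ) = exp ((t : ℂ) • A)} = logMatrices Δ := by
    ext A
    constructor
    · intro h
      refine mem_logMatrices_of_exp hΔ fun t x hx => ?_
      obtain ⟨g, hg, hgA⟩ := h t
      rw [← hgA]
      exact (mem_stabilizerGroup_iff.1 hg x).2 hx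
    · exact fun h t => ⟨_, S.expGL_mem hΔ.ne_zero ((logMatrices Δ).smul_mem (t : ℂ) h), rfl⟩
  rw [linearGroupLieAlgebra, h, LieSubalgebra.lieSpan_eq]

end LinearFrame

end Symmetries

section AlgebraicSets

open Matrix MvPolynomial

/-- The polynomial functions on the affine space `R^σ`. -/
def polyFunctions (R σ : Type*) [CommRing R] : Subalgebra R ((σ → R) → R) :=
  (AlgHom.pi fun z : σ → R => (aeval z : MvPolynomial σ R →ₐ[R] R)).range

/-- A matrix of functions on `R^σ` all of whose entries are polynomial. -/
def IsPolyMatrix {R σ a b : Type*} [CommRing R] (M : (σ → R) → Matrix a b R) : Prop :=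
  ∀ i j, (fun z => M z i j) ∈ polyFunctions R σ

/-- Algebraic subsets of an affine space: the common zero sets of polynomials. -/
def IsAlgebraicSet {R σ : Type*} [CommRing R] (Z : Set (σ → R)) : Prop :=
  ∃ P : Set (MvPolynomial σ R), Z = {z | ∀ p ∈ P, eval z p = 0}

variable {R σ a b c : Type*} [CommRing R]

theorem coord_mem_polyFunctions (i : σ) : (fun z => z i) ∈ polyFunctions R σ :=
  ⟨X i, by ext; simp⟩

theorem const_mem_polyFunctions (r : R) : (fun _ => r) ∈ polyFunctions R σ :=
  (polyFunctions R σ).algebraMap_mem r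

theorem IsPolyMatrix.mul [Fintype b] {M : (σ → R) → Matrix a b R} {N : (σ → R) → Matrix b c R}
    (hM : IsPolyMatrix M) (hN : IsPolyMatrix N) : IsPolyMatrix fun z => M z * N z := fun i j => by
  have h := sum_mem fun k (_ : k ∈ Finset.univ) => mul_mem (hM i k) (hN k j)
  convert! h
  simp [mul_apply]

theorem IsPolyMatrix.sub {M N : (σ → R) → Matrix a b R} (hM : IsPolyMatrix M)
    (hN : IsPolyMatrix N) : IsPolyMatrix fun z => M z - N z := fun i j =>
  sub_mem (hM i j) (hN i j)

theorem IsPolyMatrix.const (M : Matrix a b R) : IsPolyMatrix (fun _ : σ → R => M) :=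
  fun _ _ => const_mem_polyFunctions _

theorem IsPolyMatrix.mulVec [Fintype b] {M : (σ → R) → Matrix a b R} (hM : IsPolyMatrix M)
    (v : b → R) (i : a) : (fun z => (M z *ᵥ v) i) ∈ polyFunctions R σ := by
  have h := sum_mem fun k (_ : k ∈ Finset.univ) =>
    mul_mem (hM i k) (const_mem_polyFunctions (σ := σ) (v k))
  convert! h
  simp [Matrix.mulVec, dotProduct]

theorem isPolyMatrix_linearMap [Finite a] {v : (σ → R) → a → R}
    (hv : ∀ i, (fun z => v z i) ∈ polyFunctions R σ) (T : (a → R) →ₗ[R] Matrix b c R) :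
    IsPolyMatrix fun z => T (v z) := fun i j => by
  classical
  have := Fintype.ofFinite a
  have expand (z) : T (v z) i j = ∑ k, v z k * T (Pi.single k 1) i j := by
    conv_lhs => rw [pi_eq_sum_univ' (v z), map_sum]
    simp [Matrix.sum_apply]
  have h := sum_mem fun k (_ : k ∈ Finset.univ) =>
    mul_mem (hv k) (const_mem_polyFunctions (σ := σ) (T (Pi.single k 1) i j))
  convert! h
  simp [expand]

theorem isAlgebraicSet_setOf_eq_zero {f : (σ → R) → R} (hf : f ∈ polyFunctions R σ) :
    IsAlgebraicSet {z | f z = 0} := by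
  obtain ⟨p, rfl⟩ := hf
  exact ⟨{p}, by simp [aeval_eq_eval]⟩

theorem isAlgebraicSet_iInter {ι : Sort*} {Z : ι → Set (σ → R)} (hZ : ∀ i, IsAlgebraicSet (Z i)) :
    IsAlgebraicSet (⋂ i, Z i) := by
  choose P hP using hZ
  refine ⟨⋃ i, P i, ?_⟩
  ext z
  simp only [hP, Set.mem_iInter, Set.mem_ofPred_eq, Set.mem_iUnion]
  exact ⟨fun h p ⟨i, hp⟩ => h i p hp, fun h i p hp => h p ⟨i, hp⟩⟩

theorem IsAlgebraicSet.inter {Y Z : Set (σ → R)} (hY : IsAlgebraicSet Y) (hZ : IsAlgebraicSet Z) :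
    IsAlgebraicSet (Y ∩ Z) := by
  rw [Set.inter_eq_iInter]
  exact isAlgebraicSet_iInter (Bool.rec hZ hY)

theorem IsPolyMatrix.isAlgebraicSet_setOf_eq {M N : (σ → R) → Matrix a b R} (hM : IsPolyMatrix M)
    (hN : IsPolyMatrix N) : IsAlgebraicSet {z | M z = N z} := by
  have h := isAlgebraicSet_iInter fun i => isAlgebraicSet_iInter fun j =>
    isAlgebraicSet_setOf_eq_zero ((hM.sub hN) i j)
  convert! h
  simp [Set.ext_iff, ← Matrix.ext_iff, sub_eq_zero]

theorem IsPolyMatrix.isAlgebraicSet_setOf_mulVec_eq [Fintype b] {M : (σ → R) → Matrix a b R}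
    (hM : IsPolyMatrix M) (v : b → R) (w : a → R) : IsAlgebraicSet {z | M z *ᵥ v = w} := by
  have h := isAlgebraicSet_iInter fun i =>
    isAlgebraicSet_setOf_eq_zero (sub_mem (hM.mulVec v i) (const_mem_polyFunctions (w i)))
  convert! h
  simp [Set.ext_iff, funext_iff, sub_eq_zero]

theorem IsAlgebraicSet.finite_of_countable {k : Type*} [Field k] [IsAlgClosed k] [Uncountable k]
    [Finite σ] {Z : Set (σ → k)} (hZ : IsAlgebraicSet Z) (h : Z.Countable) : Z.Finite := by
  obtain ⟨P, rfl⟩ := hZ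
  exact finite_zeroLocus_of_countable h

end AlgebraicSets

section Isotropy

open Matrix

variable {n : ℕ} {Δ : entireFunctions n}

/-- The isotropy group of `p` in `G_D`. -/
def isotropy (Δ : entireFunctions n) (p : Fin n → ℂ) : Subgroup (GL (Fin n) ℂ) where
  carrier := {g | g ∈ stabilizerGroup (divisorSet Δ) ∧ g.1 *ᵥ p = p}
  mul_mem' {g h} hg hh := ⟨mul_mem hg.1 hh.1, by
    rw [Units.val_mul, ← mulVec_mulVec, hh.2, hg.2]⟩
  one_mem' := ⟨(stabilizerGroup (divisorSet Δ)).one_mem, one_mulVec p⟩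
  inv_mem' {g} hg := ⟨inv_mem hg.1, by conv_lhs => rw [← hg.2, inv_mulVec_mulVec]⟩

namespace LinearFrame

variable (S : LinearFrame Δ) {p : Fin n → ℂ} (hp : Δ.1 p ≠ 0)

/-- The basis of `logMatrices Δ` given by the frame. -/
def matrixBasis : Module.Basis (Fin n) ℂ (logMatrices Δ) :=
  S.basis.map (logMatricesEquiv Δ).symm.toLinearEquiv

/-- The inverse of `orbitMap Δ p`: the matrix in `logMatrices Δ` with a given value at `p`. -/
def fieldAt : (Fin n → ℂ) →ₗ[ℂ] Matrix (Fin n) (Fin n) ℂ :=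
  (logMatrices Δ).toSubmodule.subtype ∘ₗ
    (LinearEquiv.ofBijective (orbitMap Δ p) (S.orbitMap_bijective hp)).symm.toLinearMap

theorem fieldAt_mem (v : Fin n → ℂ) : S.fieldAt hp v ∈ logMatrices Δ :=
  ((LinearEquiv.ofBijective (orbitMap Δ p) (S.orbitMap_bijective hp)).symm v).2

theorem fieldAt_mulVec (v : Fin n → ℂ) : S.fieldAt hp v *ᵥ p = v :=
  (LinearEquiv.ofBijective (orbitMap Δ p) (S.orbitMap_bijective hp)).apply_symm_apply v

theorem fieldAt_of_mem {A : Matrix (Fin n) (Fin n) ℂ} (hA : A ∈ logMatrices Δ) :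
    S.fieldAt hp (A *ᵥ p) = A :=
  congrArg Subtype.val ((S.orbitMap_bijective hp).1 (a₁ := ⟨_, S.fieldAt_mem hp (A *ᵥ p)⟩)
    (a₂ := ⟨A, hA⟩) (S.fieldAt_mulVec hp _))

/-- Both `g A g⁻¹` and `S.fieldAt hp (g A p)` are the element of `logMatrices Δ` with value `g A p`
at `p`. This turns membership in the isotropy group into a polynomial equation in `g`. -/
theorem mul_eq_fieldAt_mul (hΔ : IsReducedEquation Δ) {g : GL (Fin n) ℂ} (hg : g ∈ isotropy Δ p)
    {A : Matrix (Fin n) (Fin n) ℂ} (hA : A ∈ logMatrices Δ) :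
    g.1 * A = S.fieldAt hp (g.1 *ᵥ A *ᵥ p) * g.1 := by
  have hconj := S.fieldAt_of_mem hp (conj_mem_logMatrices hΔ hg.1 hA)
  rw [← mulVec_mulVec, ← mulVec_mulVec, (inv_mem hg).2] at hconj
  rw [hconj, mul_assoc, Units.inv_mul, mul_one]

theorem mem_isotropy_of_mul_eq (hΔ : IsReducedEquation Δ) {g : GL (Fin n) ℂ}
    (hgp : g.1 *ᵥ p = p)
    (hg : ∀ A : logMatrices Δ, g.1 * A.1 = S.fieldAt hp (g.1 *ᵥ A.1 *ᵥ p) * g.1)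
    (hginv : ∀ A : logMatrices Δ, g⁻¹.1 * A.1 = S.fieldAt hp (g⁻¹.1 *ᵥ A.1 *ᵥ p) * g⁻¹.1) :
    g ∈ isotropy Δ p := by
  refine ⟨S.mem_stabilizerGroup_of_conj hΔ.ne_zero (fun A hA => ?_) (fun A hA => ?_), hgp⟩
  · rw [hg ⟨A, hA⟩, mul_assoc, Units.mul_inv, mul_one]
    exact S.fieldAt_mem hp _
  · rw [hginv ⟨A, hA⟩, mul_assoc, Units.inv_mul, mul_one]
    exact S.fieldAt_mem hp _

theorem mem_logMatrices_of_basis (hΔ : IsReducedEquation Δ) {ι : Type*}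
    (b : Module.Basis ι ℂ (logMatrices Δ)) (S : LinearFrame Δ) {X : Matrix (Fin n) (Fin n) ℂ}
    (hX : ∀ i, X * (b i).1 - (b i).1 * X ∈ logMatrices Δ) : X ∈ logMatrices Δ := by
  let bracket : Matrix (Fin n) (Fin n) ℂ →ₗ[ℂ] Matrix (Fin n) (Fin n) ℂ :=
    LinearMap.mulLeft ℂ X - LinearMap.mulRight ℂ X
  let K : Submodule ℂ (logMatrices Δ) :=
    ((logMatrices Δ).toSubmodule.comap bracket).comap (logMatrices Δ).toSubmodule.subtype
  have hspan : Submodule.span ℂ (Set.range b) ≤ K :=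
    Submodule.span_le.2 (Set.range_subset_iff.2 hX)
  have hK (B : logMatrices Δ) : B ∈ K := hspan (b.mem_span B)
  exact S.mem_logMatrices_of_normalizes hΔ fun B hB => hK ⟨B, hB⟩

/-- The defect of the equation `S.mul_eq_fieldAt_mul` for `A` at an arbitrary matrix. -/
def conjDefect (A M : Matrix (Fin n) (Fin n) ℂ) : Matrix (Fin n) (Fin n) ℂ :=
  M * A - S.fieldAt hp (M *ᵥ A *ᵥ p) * M

/-- The derivative of `S.conjDefect hp A` at the identity, for `A` in `logMatrices Δ`. -/
def conjDefectDeriv (A : Matrix (Fin n) (Fin n) ℂ) :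
    Matrix (Fin n) (Fin n) ℂ →ₗ[ℂ] Matrix (Fin n) (Fin n) ℂ :=
  LinearMap.mulRight ℂ A -
    (S.fieldAt hp ∘ₗ (mulVecBilin ℂ ℂ).flip (A *ᵥ p) + LinearMap.mulLeft ℂ A)

open scoped Matrix.Norms.Operator in
theorem hasFDerivAt_conjDefect {A : Matrix (Fin n) (Fin n) ℂ} (hA : A ∈ logMatrices Δ) :
    HasFDerivAt (S.conjDefect hp A) (LinearMap.toContinuousLinearMap (S.conjDefectDeriv hp A))
      1 := by
  let U : Matrix (Fin n) (Fin n) ℂ →L[ℂ] Matrix (Fin n) (Fin n) ℂ :=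
    LinearMap.toContinuousLinearMap (S.fieldAt hp ∘ₗ (mulVecBilin ℂ ℂ).flip (A *ᵥ p))
  have hU : U 1 = A := by
    change S.fieldAt hp (1 *ᵥ A *ᵥ p) = A
    rw [one_mulVec, S.fieldAt_of_mem hp hA]
  have hmul := (LinearMap.toContinuousLinearMap (LinearMap.mulRight ℂ A)).hasFDerivAt
    (x := (1 : Matrix (Fin n) (Fin n) ℂ))
  refine (hmul.sub (U.hasFDerivAt.mul' (hasFDerivAt_id 1))).congr_fderiv ?_
  ext1 X
  change X * A - (U 1 * X + U X * 1) = X * A - (U X + A * X)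
  rw [hU, mul_one, add_comm]

/-- The defect of the equations satisfied by the elements of the isotropy group of `p`. -/
def isotropyMap (M : Matrix (Fin n) (Fin n) ℂ) :
    (Fin n → ℂ) × (Fin n → Matrix (Fin n) (Fin n) ℂ) :=
  (M *ᵥ p - p, fun i => S.conjDefect hp (S.matrixBasis i).1 M)

/-- The derivative of `isotropyMap` at the identity. -/
def isotropyDeriv : Matrix (Fin n) (Fin n) ℂ →ₗ[ℂ]
    (Fin n → ℂ) × (Fin n → Matrix (Fin n) (Fin n) ℂ) :=
  ((mulVecBilin ℂ ℂ).flip p).prod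
    (LinearMap.pi fun i => S.conjDefectDeriv hp (S.matrixBasis i).1)

theorem isotropyMap_eq_zero (hΔ : IsReducedEquation Δ) {g : GL (Fin n) ℂ}
    (hg : g ∈ isotropy Δ p) : S.isotropyMap hp g.1 = 0 :=
  Prod.ext (sub_eq_zero.2 hg.2)
    (funext fun i => sub_eq_zero.2 (S.mul_eq_fieldAt_mul hp hΔ hg (S.matrixBasis i).2))

open scoped Matrix.Norms.Operator in
theorem hasFDerivAt_isotropyMap :
    HasFDerivAt (S.isotropyMap hp) (LinearMap.toContinuousLinearMap (S.isotropyDeriv hp)) 1 :=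
  HasFDerivAt.prodMk
    ((LinearMap.toContinuousLinearMap ((mulVecBilin ℂ ℂ).flip p)).hasFDerivAt.sub_const p)
    (hasFDerivAt_pi.2 fun i => S.hasFDerivAt_conjDefect hp (S.matrixBasis i).2)

theorem ker_isotropyDeriv (hΔ : IsReducedEquation Δ) : LinearMap.ker (S.isotropyDeriv hp) = ⊥ := by
  rw [LinearMap.ker_eq_bot']
  intro X hX
  have hXp : X *ᵥ p = 0 := congrArg Prod.fst hX
  have hmem : X ∈ logMatrices Δ := by
    refine mem_logMatrices_of_basis hΔ S.matrixBasis S fun i => ?_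
    have hXi : X * (S.matrixBasis i).1 - (S.fieldAt hp (X *ᵥ (S.matrixBasis i).1 *ᵥ p) +
        (S.matrixBasis i).1 * X) = 0 := congrFun (congrArg Prod.snd hX) i
    rw [sub_eq_zero] at hXi
    rw [hXi, add_sub_cancel_right]
    exact S.fieldAt_mem hp _
  rw [← S.fieldAt_of_mem hp hmem, hXp, map_zero]

include S hp in
theorem eventually_eq_one_of_mem_isotropy (hΔ : IsReducedEquation Δ) :
    ∀ᶠ M in nhds (1 : Matrix (Fin n) (Fin n) ℂ), ∀ g ∈ isotropy Δ p, g.1 = M → g = 1 := by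
  open scoped Matrix.Norms.Operator in
  obtain ⟨C, -, hC⟩ := (S.isotropyDeriv hp).exists_antilipschitzWith (S.ker_isotropyDeriv hp hΔ)
  have hne := eventually_nhdsWithin_iff.1
    ((S.hasFDerivAt_isotropyMap hp).eventually_ne (c := 0) ⟨C, hC⟩)
  refine hne.mono fun M hM g hg hgM => ?_
  by_contra h
  exact hM (fun hM1 => h (Units.ext (hgM.trans hM1))) (hgM ▸ S.isotropyMap_eq_zero hp hΔ hg)

include S hp in
theorem discreteTopology_isotropy (hΔ : IsReducedEquation Δ) :
    DiscreteTopology (isotropy Δ p) := by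
  have hcont : Continuous fun g : isotropy Δ p => g.1.1 :=
    Units.continuous_val.comp continuous_subtype_val
  have hone : {(1 : isotropy Δ p)} ∈ nhds (1 : isotropy Δ p) := by
    filter_upwards [hcont.continuousAt.eventually (S.eventually_eq_one_of_mem_isotropy hp hΔ)]
      with g hg
    exact Subtype.ext (hg g.1 g.2 rfl)
  exact discreteTopology_of_isOpen_singleton_one (isOpen_singleton_iff_nhds_eq_pure _ |>.2
    (le_antisymm (Filter.le_pure_iff.2 hone) (pure_le_nhds _)))

end LinearFrame

instance secondCountableTopology_GL (m : Type*) [Fintype m] [DecidableEq m] :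
    SecondCountableTopology (GL m ℂ) := by
  have : SecondCountableTopology (Matrix m m ℂ) :=
    inferInstanceAs (SecondCountableTopology (m → m → ℂ))
  have : SecondCountableTopology (Matrix m m ℂ)ᵐᵒᵖ :=
    MulOpposite.opHomeomorph.symm.secondCountableTopology
  exact Units.isEmbedding_embedProduct.secondCountableTopology

/-- The entries of `g` and of `g⁻¹`, which embed `GLₙ(ℂ)` into an affine space as an algebraic
subset. -/
def glCoord (g : GL (Fin n) ℂ) : Bool × Fin n × Fin n → ℂ :=
  fun q => (bif q.1 then g else g⁻¹).1 q.2.1 q.2.2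

/-- The two square matrices with entries the coordinates of a point. -/
def coordMatrix (s : Bool) (z : Bool × Fin n × Fin n → ℂ) : Matrix (Fin n) (Fin n) ℂ :=
  Matrix.of fun i j => z (s, i, j)

theorem isPolyMatrix_coordMatrix (s : Bool) : IsPolyMatrix (coordMatrix (n := n) s) :=
  fun i j => coord_mem_polyFunctions (s, i, j)

theorem coordMatrix_glCoord (s : Bool) (g : GL (Fin n) ℂ) :
    coordMatrix s (glCoord g) = (bif s then g else g⁻¹).1 := rfl

theorem glCoord_injective : Function.Injective (glCoord (n := n)) := fun _ _ hgh =>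
  Units.ext (congrArg (coordMatrix true) hgh)

namespace LinearFrame

variable (S : LinearFrame Δ) {p : Fin n → ℂ} (hp : Δ.1 p ≠ 0)

theorem glCoord_image_isotropy (hΔ : IsReducedEquation Δ) : glCoord '' (isotropy Δ p) =
    {z | coordMatrix true z * coordMatrix false z = 1} ∩ {z | coordMatrix true z *ᵥ p = p} ∩
      ⋂ s, ⋂ A : logMatrices Δ, {z | coordMatrix s z * A.1 =
        S.fieldAt hp (coordMatrix s z *ᵥ A.1 *ᵥ p) * coordMatrix s z} := by
  ext z
  simp only [Set.mem_inter_iff, Set.mem_iInter, Set.mem_ofPred_eq]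
  constructor
  · rintro ⟨g, hg, rfl⟩
    refine ⟨⟨g.mul_inv, hg.2⟩, fun s A => ?_⟩
    rw [coordMatrix_glCoord]
    cases s
    exacts [S.mul_eq_fieldAt_mul hp hΔ (inv_mem hg) A.2, S.mul_eq_fieldAt_mul hp hΔ hg A.2]
  · rintro ⟨⟨hinv, hfix⟩, hconj⟩
    refine ⟨⟨_, _, hinv, _root_.mul_eq_one_comm.1 hinv⟩,
      S.mem_isotropy_of_mul_eq hp hΔ hfix (hconj true) (hconj false), ?_⟩
    ext ⟨s, i, j⟩
    cases s <;> rfl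

include S hp in
theorem isAlgebraicSet_glCoord_image_isotropy (hΔ : IsReducedEquation Δ) :
    IsAlgebraicSet (glCoord '' (isotropy Δ p : Set (GL (Fin n) ℂ))) := by
  have hG := isPolyMatrix_coordMatrix (n := n)
  rw [S.glCoord_image_isotropy hp hΔ]
  exact (((hG true).mul (hG false)).isAlgebraicSet_setOf_eq (.const 1)).inter
    ((hG true).isAlgebraicSet_setOf_mulVec_eq p p) |>.inter <|
      isAlgebraicSet_iInter fun s => isAlgebraicSet_iInter fun A =>
        ((hG s).mul (.const A.1)).isAlgebraicSet_setOf_eq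
          ((isPolyMatrix_linearMap ((hG s).mulVec (A.1 *ᵥ p)) (S.fieldAt hp)).mul (hG s))

include S hp in
/-- The isotropy group is discrete, hence countable, and a countable algebraic set is finite. -/
theorem finite_isotropy (hΔ : IsReducedEquation Δ) : Finite (isotropy Δ p) := by
  have := S.discreteTopology_isotropy hp hΔ
  have : Countable (isotropy Δ p) := countable_of_Lindelof_of_discrete
  have : Uncountable ℂ := Set.not_countable_univ_iff.1 not_countable_complex
  have hcountable := (Set.to_countable (isotropy Δ p : Set (GL (Fin n) ℂ))).image glCoord
  exact ((S.isAlgebraicSet_glCoord_image_isotropy hp hΔ).finite_of_countable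
    hcountable).of_finite_image glCoord_injective.injOn

end LinearFrame

end Isotropy

section Orbit

open Matrix NormedSpace Topology

variable {n : ℕ} {Δ : entireFunctions n}

theorem countable_zeros {f : ℂ → ℂ} (hf : AnalyticOnNhd ℂ f Set.univ) {a : ℂ} (ha : f a ≠ 0) :
    {z | f z = 0}.Countable := by
  have hcodiscrete := (mem_codiscrete'.1 (hf.preimage_zero_mem_codiscrete ha)).2
  rw [← Set.preimage_compl, compl_compl] at hcodiscrete
  have : DiscreteTopology {z | f z = 0} := hcodiscrete.to_subtype
  exact Set.countable_coe_iff.1 countable_of_Lindelof_of_discrete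

/-- On the complex line through two points of the complement, the divisor is a countable set. -/
theorem isPathConnected_compl_divisorSet (h0 : Δ ≠ 0) : IsPathConnected (divisorSet Δ)ᶜ := by
  obtain ⟨a, ha⟩ : ∃ a, Δ.1 a ≠ 0 := by
    by_contra! h
    exact h0 (Subtype.ext (funext h))
  refine ⟨a, ha, fun {b} hb => ?_⟩
  let line : ℂ → (Fin n → ℂ) := fun z => a + z • (b - a)
  have hline : Continuous line := by fun_prop
  have line_zero : line 0 = a := by simp [line]
  have line_one : line 1 = b := by simp [line]
  have hcountable : {z | Δ.1 (line z) = 0}.Countable :=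
    countable_zeros (a := 0) (fun z _ =>
      (Δ.2 (line z) (Set.mem_univ _)).comp (f := line) (by fun_prop)) (by rwa [line_zero])
  have hconn : IsPathConnected {z | Δ.1 (line z) = 0}ᶜ :=
    hcountable.isPathConnected_compl_of_one_lt_rank (by rw [Complex.rank_real_complex]; norm_num)
  have hjoined := (hconn.image hline).joinedIn a ⟨0, by simpa [line_zero] using ha, line_zero⟩ b
    ⟨1, by rw [Set.mem_compl_iff, Set.mem_ofPred_eq, line_one]; exact hb, line_one⟩
  exact hjoined.mono (Set.image_subset_iff.2 fun z hz => hz)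

theorem continuous_coe_identityComponent :
    Continuous fun g : identityComponent (divisorSet Δ) => g.1.1.1 :=
  Units.continuous_val.comp (continuous_subtype_val.comp continuous_subtype_val)

theorem continuous_coe_mulVec (q : Fin n → ℂ) :
    Continuous fun g : identityComponent (divisorSet Δ) => g.1.1.1 *ᵥ q :=
  continuous_coe_identityComponent.matrix_mulVec continuous_const

theorem coe_mul_mulVec (g h : identityComponent (divisorSet Δ)) (q : Fin n → ℂ) :
    (g * h).1.1.1 *ᵥ q = g.1.1.1 *ᵥ h.1.1.1 *ᵥ q := (mulVec_mulVec _ _ _).symm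

theorem coe_inv_mulVec_mulVec (g : identityComponent (divisorSet Δ)) (q : Fin n → ℂ) :
    g⁻¹.1.1.1 *ᵥ g.1.1.1 *ᵥ q = q := inv_mulVec_mulVec g.1.1 q

theorem mulVec_ne_zero (g : identityComponent (divisorSet Δ)) {q : Fin n → ℂ} (hq : Δ.1 q ≠ 0) :
    Δ.1 (g.1.1.1 *ᵥ q) ≠ 0 := fun h => hq ((mem_stabilizerGroup_iff.1 g.1.2 q).1 h)

instance : ConnectedSpace (identityComponent (divisorSet Δ)) :=
  Subtype.connectedSpace isConnected_connectedComponent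

namespace LinearFrame

variable (S : LinearFrame Δ) (hΔ : IsReducedEquation Δ)

/-- The exponential map from the Lie algebra `logMatrices Δ` to `G_D°`. -/
def expG (A : logMatrices Δ) : identityComponent (divisorSet Δ) :=
  ⟨⟨expGL A.1, S.expGL_mem hΔ.ne_zero A.2⟩, by
    let f : ℝ → stabilizerGroup (divisorSet Δ) := fun t =>
      ⟨expGL ((t : ℂ) • A.1), S.expGL_mem hΔ.ne_zero ((logMatrices Δ).smul_mem _ A.2)⟩
    have hf : Continuous f := Continuous.subtype_mk (continuous_expGL.comp (by fun_prop)) _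
    have f_zero : f 0 = 1 := by
      ext1; ext1; simp [f, expGL_val]
    have hrange := (isPreconnected_range hf).subset_connectedComponent (x := 1) ⟨0, f_zero⟩
    simpa [f] using! hrange ⟨1, rfl⟩⟩

theorem expG_val (A : logMatrices Δ) : (S.expG hΔ A).1.1.1 = exp A.1 := rfl

theorem continuous_expG : Continuous (S.expG hΔ) :=
  Continuous.subtype_mk (Continuous.subtype_mk (continuous_expGL.comp continuous_subtype_val) _) _

theorem expG_zero : S.expG hΔ 0 = 1 := by
  ext1; ext1; ext1
  exact exp_zero

theorem joined_one_expG (A : logMatrices Δ) : Joined 1 (S.expG hΔ A) := by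
  refine ⟨⟨⟨fun t => S.expG hΔ ((t : ℂ) • A), ?_⟩, ?_, ?_⟩⟩
  · exact (S.continuous_expG hΔ).comp (by fun_prop)
  · simp [S.expG_zero hΔ]
  · simp

/-- The exponential map in the coordinates of the frame. -/
def expCoord (c : Fin n → ℂ) : identityComponent (divisorSet Δ) :=
  S.expG hΔ (∑ i, c i • S.matrixBasis i)

theorem coe_sum_smul_matrixBasis (c : Fin n → ℂ) :
    (∑ i, c i • S.matrixBasis i).1 = ∑ i, c i • (S.matrixBasis i).1 := by simp

theorem continuous_expCoord : Continuous (S.expCoord hΔ) :=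
  (S.continuous_expG hΔ).comp (continuous_induced_rng.2 (by
    rw [show Subtype.val ∘ (fun c : Fin n → ℂ => ∑ i, c i • S.matrixBasis i) = _ from
      funext S.coe_sum_smul_matrixBasis]
    fun_prop))

theorem expCoord_zero : S.expCoord hΔ 0 = 1 := by simp [expCoord, S.expG_zero hΔ]

theorem map_expCoord_mulVec_nhds {q : Fin n → ℂ} (hq : Δ.1 q ≠ 0) :
    Filter.map (fun c => (S.expCoord hΔ c).1.1.1 *ᵥ q) (𝓝 0) = 𝓝 q := by
  have hfun : (fun c => (S.expCoord hΔ c).1.1.1 *ᵥ q) = fun c =>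
      exp (∑ i, c i • (S.matrixBasis i).1) *ᵥ q := by
    funext c
    rw [expCoord, expG_val, coe_sum_smul_matrixBasis]
  have hmap := (hasStrictFDerivAt_exp_mulVec (fun i => (S.matrixBasis i).1)
      q).map_nhds_eq_of_surj (by
    rw [LinearMap.coe_toContinuousLinearMap, LinearMap.range_eq_top]
    intro v
    obtain ⟨A, rfl⟩ := (S.orbitMap_bijective hq).2 v
    refine ⟨S.matrixBasis.repr A, ?_⟩
    conv_rhs => rw [orbitMap_apply, ← S.matrixBasis.sum_repr A, coe_sum_smul_matrixBasis,
      sum_mulVec]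
    simp [smul_mulVec])
  rw [hfun, hmap]
  simp

include S hΔ in
theorem image_mulVec_mem_nhds {q : Fin n → ℂ} (hq : Δ.1 q ≠ 0)
    {U : Set (identityComponent (divisorSet Δ))} (hU : U ∈ 𝓝 1) :
    (fun g : identityComponent (divisorSet Δ) => g.1.1.1 *ᵥ q) '' U ∈ 𝓝 q := by
  rw [← S.map_expCoord_mulVec_nhds hΔ hq]
  have hpre : S.expCoord hΔ ⁻¹' U ∈ 𝓝 0 :=
    (S.continuous_expCoord hΔ).continuousAt.preimage_mem_nhds (by rwa [S.expCoord_zero hΔ])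
  refine Filter.mem_of_superset (Filter.image_mem_map hpre) ?_
  rintro _ ⟨c, hc, rfl⟩
  exact ⟨_, hc, rfl⟩

variable {p : Fin n → ℂ} (hp : Δ.1 p ≠ 0)

include S hΔ hp in
theorem eventually_eq_one_of_mulVec_eq :
    ∀ᶠ g in 𝓝 (1 : identityComponent (divisorSet Δ)), g.1.1.1 *ᵥ p = p → g = 1 := by
  filter_upwards [continuous_coe_identityComponent.continuousAt.eventually
    (S.eventually_eq_one_of_mem_isotropy hp hΔ)] with g hg hgp
  exact Subtype.ext (Subtype.ext (hg g.1.1 ⟨g.1.2, hgp⟩ rfl))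

include hp in
/-- For `g` near the identity, `g p = exp(A) p` with `A` small, and `exp(-A) g` is then an element
of the discrete isotropy group near the identity. -/
theorem eventually_exists_expCoord :
    ∀ᶠ g in 𝓝 (1 : identityComponent (divisorSet Δ)), ∃ c, S.expCoord hΔ c = g := by
  have hcont : ContinuousAt (fun x : (Fin n → ℂ) × identityComponent (divisorSet Δ) =>
      (S.expCoord hΔ x.1)⁻¹ * x.2) (0, 1) :=
    (((S.continuous_expCoord hΔ).comp continuous_fst).inv.mul continuous_snd).continuousAt
  have hev := hcont.eventually (by
    simpa only [S.expCoord_zero hΔ, inv_one, mul_one] using S.eventually_eq_one_of_mulVec_eq hΔ hp)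
  rw [nhds_prod_eq] at hev
  obtain ⟨P, hP, Q, hQ, hPQ⟩ := Filter.eventually_prod_iff.1 hev
  have himage : (fun c => (S.expCoord hΔ c).1.1.1 *ᵥ p) '' {c | P c} ∈ 𝓝 p := by
    rw [← S.map_expCoord_mulVec_nhds hΔ hp]
    exact Filter.image_mem_map hP
  have horbit : ∀ᶠ g in 𝓝 (1 : identityComponent (divisorSet Δ)),
      g.1.1.1 *ᵥ p ∈ (fun c => (S.expCoord hΔ c).1.1.1 *ᵥ p) '' {c | P c} :=
    (continuous_coe_mulVec p).continuousAt.preimage_mem_nhds (by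
      rwa [show (1 : identityComponent (divisorSet Δ)).1.1.1 *ᵥ p = p from one_mulVec p])
  filter_upwards [hQ, horbit] with g hg ⟨c, hc, hcp⟩
  refine ⟨c, inv_mul_eq_one.1 (hPQ hc hg ?_)⟩
  rw [coe_mul_mulVec, ← hcp, coe_inv_mulVec_mulVec]

include S hΔ hp in
theorem joined_one (g : identityComponent (divisorSet Δ)) : Joined 1 g := by
  let pathComponent := Subgroup.pathComponentOne (identityComponent (divisorSet Δ))
  have hopen : IsOpen (pathComponent : Set (identityComponent (divisorSet Δ))) := by
    refine Subgroup.isOpen_of_mem_nhds (g := 1) _ ?_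
    filter_upwards [S.eventually_exists_expCoord hΔ hp] with g ⟨c, hc⟩
    exact hc ▸ S.joined_one_expG hΔ _
  have huniv := IsClopen.eq_univ ⟨Subgroup.isClosed_of_isOpen _ hopen, hopen⟩
    ⟨1, Subgroup.one_mem _⟩
  have hg : g ∈ (pathComponent : Set _) := huniv ▸ Set.mem_univ g
  exact hg

end LinearFrame

variable {p : Fin n → ℂ} (hp : Δ.1 p ≠ 0)

/-- The orbit map `G_D° → ℂⁿ ∖ D`. -/
def groupOrbit (hp : Δ.1 p ≠ 0) (g : identityComponent (divisorSet Δ)) : ↥(divisorSet Δ)ᶜ :=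
  ⟨g.1.1.1 *ᵥ p, mulVec_ne_zero g hp⟩

theorem continuous_groupOrbit : Continuous (groupOrbit hp) :=
  (continuous_coe_mulVec p).subtype_mk _

/-- The isotropy group of `p` in `G_D°`. -/
def isotropyG (Δ : entireFunctions n) (p : Fin n → ℂ) :
    Subgroup (identityComponent (divisorSet Δ)) :=
  (isotropy Δ p).comap ((stabilizerGroup (divisorSet Δ)).subtype.comp
    (identityComponent (divisorSet Δ)).subtype)

theorem groupOrbit_eq_iff {g h : identityComponent (divisorSet Δ)} :
    groupOrbit hp g = groupOrbit hp h ↔ g⁻¹ * h ∈ isotropyG Δ p := by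
  have hmem : g⁻¹ * h ∈ isotropyG Δ p ↔ (g⁻¹ * h).1.1.1 *ᵥ p = p :=
    ⟨fun H => H.2, fun H => ⟨(g⁻¹ * h).1.2, H⟩⟩
  rw [hmem, coe_mul_mulVec, Subtype.ext_iff]
  change g.1.1.1 *ᵥ p = h.1.1.1 *ᵥ p ↔ _
  refine ⟨fun H => by rw [← H, coe_inv_mulVec_mulVec], fun H => ?_⟩
  conv_lhs => rw [← H]
  rw [← coe_mul_mulVec, ← coe_mul_mulVec, mul_inv_cancel, one_mul]

namespace LinearFrame

variable (S : LinearFrame Δ) (hΔ : IsReducedEquation Δ)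

include S hΔ

theorem isOpenMap_groupOrbit : IsOpenMap (groupOrbit hp) := by
  intro U hU
  rw [isOpen_iff_mem_nhds]
  rintro _ ⟨g, hg, rfl⟩
  have htranslate : (fun h => h * g) ⁻¹' U ∈ 𝓝 (1 : identityComponent (divisorSet Δ)) :=
    (continuous_mul_const g).continuousAt.preimage_mem_nhds (hU.mem_nhds (by simpa using hg))
  filter_upwards [continuous_subtype_val.continuousAt.preimage_mem_nhds
    (S.image_mulVec_mem_nhds hΔ (groupOrbit hp g).2 htranslate)] with x ⟨h, hh, hx⟩
  exact ⟨h * g, hh, Subtype.ext ((coe_mul_mulVec h g p).trans hx)⟩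

theorem surjective_groupOrbit : Function.Surjective (groupOrbit hp) := by
  have hconn : ConnectedSpace ↥(divisorSet Δ)ᶜ :=
    Subtype.connectedSpace (isPathConnected_compl_divisorSet hΔ.ne_zero).isConnected
  have hclosed : IsClosed (Set.range (groupOrbit hp)) := by
    rw [← isOpen_compl_iff, isOpen_iff_mem_nhds]
    intro q hq
    filter_upwards [continuous_subtype_val.continuousAt.preimage_mem_nhds
      (S.image_mulVec_mem_nhds hΔ q.2 Filter.univ_mem)] with x ⟨h, _, hx⟩
    rintro ⟨g, rfl⟩
    refine hq ⟨h⁻¹ * g, Subtype.ext ?_⟩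
    change (h⁻¹ * g).1.1.1 *ᵥ p = q.1
    change h.1.1.1 *ᵥ q.1 = g.1.1.1 *ᵥ p at hx
    rw [coe_mul_mulVec, ← hx, coe_inv_mulVec_mulVec]
  exact Set.range_eq_univ.1 (IsClopen.eq_univ
    ⟨hclosed, (S.isOpenMap_groupOrbit hp hΔ).isOpen_range⟩ (Set.range_nonempty _))

include hp in
theorem finite_isotropyG : Finite (isotropyG Δ p) := by
  have := S.finite_isotropy hp hΔ
  refine Finite.of_injective (β := isotropy Δ p) (fun g => ⟨g.1.1.1, g.2⟩) fun g h hgh => ?_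
  have hval : g.1.1.1 = h.1.1.1 := congrArg (fun x : isotropy Δ p => x.1) hgh
  exact Subtype.ext (Subtype.ext (Subtype.ext hval))

theorem isCoveringMap_groupOrbit : IsCoveringMap (groupOrbit hp) := by
  have := S.finite_isotropyG hp hΔ
  have hquot : IsQuotientMap (groupOrbit hp) := (S.isOpenMap_groupOrbit hp hΔ).isQuotientMap
    (continuous_groupOrbit hp) (S.surjective_groupOrbit hp hΔ)
  exact (hquot.isQuotientCoveringMap_of_subgroupOp (isotropyG Δ p)
    ⟨inferInstanceAs (DiscreteTopology (isotropyG Δ p))⟩ (groupOrbit_eq_iff hp)).isCoveringMap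

end LinearFrame

end Orbit

section DualComplex

open Homotopy

universe u

variable {R : Type u} [CommRing R] {A B C : ModuleCat.{u} R}
  {K L M : ChainComplex (ModuleCat.{u} R) ℕ}

/-- The transpose of a linear map. -/
def dualHom (f : A ⟶ B) :
    ModuleCat.of R (Module.Dual R B) ⟶ ModuleCat.of R (Module.Dual R A) :=
  ModuleCat.ofHom f.hom.dualMap

theorem dualHom_comp (f : A ⟶ B) (g : B ⟶ C) : dualHom (f ≫ g) = dualHom g ≫ dualHom f := rfl

theorem dualHom_add (f g : A ⟶ B) : dualHom (f + g) = dualHom f + dualHom g := by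
  ext : 1
  exact LinearMap.ext fun a => LinearMap.ext fun _ => map_add a _ _

theorem dualHom_zero : dualHom (0 : A ⟶ B) = 0 := by
  ext : 1
  exact LinearMap.ext fun a => LinearMap.ext fun _ => map_zero a

theorem dualHom_nsmul (N : ℕ) (f : A ⟶ B) : dualHom (N • f) = N • dualHom f := by
  induction N with
  | zero => rw [zero_smul, zero_smul, dualHom_zero]
  | succ N ih => rw [succ_nsmul, succ_nsmul, dualHom_add, ih]

/-- The dual cochain complex of a chain complex of modules. -/
def dualComplex (K : ChainComplex (ModuleCat.{u} R) ℕ) : CochainComplex (ModuleCat.{u} R) ℕ :=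
  CochainComplex.of (fun k => ModuleCat.of R (Module.Dual R (K.X k)))
    (fun k => dualHom (K.d (k + 1) k))
    (fun k => by rw [← dualHom_comp, K.d_comp_d, dualHom_zero])

theorem dualComplex_d (k : ℕ) : (dualComplex K).d k (k + 1) = dualHom (K.d (k + 1) k) := by
  simp only [dualComplex, CochainComplex.of_d]

/-- The transpose of a chain map. -/
def dualComplexMap (φ : K ⟶ L) : dualComplex L ⟶ dualComplex K :=
  CochainComplex.ofHom (fun k => dualHom (φ.f k)) fun k => by
    rw [dualComplex_d, dualComplex_d]
    exact congrArg dualHom (φ.comm (k + 1) k).symm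

theorem dualComplexMap_f (φ : K ⟶ L) (k : ℕ) : (dualComplexMap φ).f k = dualHom (φ.f k) := rfl

theorem dualComplexMap_comp (φ : K ⟶ L) (ψ : L ⟶ M) :
    dualComplexMap (φ ≫ ψ) = dualComplexMap ψ ≫ dualComplexMap φ := by
  ext k : 1
  rfl

theorem dualComplexMap_nsmul_id (N : ℕ) :
    dualComplexMap (N • 𝟙 K) = N • 𝟙 (dualComplex K) := by
  ext k : 1
  rw [dualComplexMap_f, HomologicalComplex.nsmul_f_apply, HomologicalComplex.nsmul_f_apply]
  exact dualHom_nsmul N _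

/-- The transpose of a family of maps between the terms of two complexes. -/
def dualFamily (f : ∀ i j, K.X i ⟶ L.X j) (i j : ℕ) :
    (dualComplex L).X i ⟶ (dualComplex K).X j :=
  dualHom (f j i)

/-- The transpose of a chain homotopy. -/
def dualComplexHomotopy {φ ψ : K ⟶ L} (h : Homotopy φ ψ) :
    Homotopy (dualComplexMap φ) (dualComplexMap ψ) where
  hom := dualFamily h.hom
  zero i j hij := by
    rw [dualFamily, h.zero j i hij]
    exact dualHom_zero
  comm i := by
    have hcomm := h.comm i
    cases i with
    | zero =>
      rw [dNext_zero_chainComplex, zero_add, prevD_chainComplex] at hcomm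
      rw [prevD_zero_cochainComplex, dNext_cochainComplex, add_zero, dualComplex_d,
        dualComplexMap_f, dualComplexMap_f]
      exact (congrArg dualHom hcomm).trans (dualHom_add _ _)
    | succ i =>
      rw [dNext_succ_chainComplex, prevD_chainComplex, add_comm (K.d _ _ ≫ _)] at hcomm
      rw [prevD_succ_cochainComplex, dNext_cochainComplex, dualComplex_d, dualComplex_d,
        dualComplexMap_f, dualComplexMap_f]
      exact ((congrArg dualHom hcomm).trans (dualHom_add _ _)).trans
        (congrArg (· + dualHom (ψ.f (i + 1))) (dualHom_add _ _))

theorem homologyMap_nsmul_id (D : CochainComplex (ModuleCat.{u} R) ℕ) (N k : ℕ) :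
    HomologicalComplex.homologyMap (N • 𝟙 D) k = N • 𝟙 (D.homology k) := by
  rw [← HomologicalComplex.homologyMap_id]
  exact (HomologicalComplex.homologyFunctor _ _ k).map_nsmul

theorem isIso_of_comp_eq_nsmul {N : ℕ} (hN : IsUnit (N : R)) {f : A ⟶ B} {g : B ⟶ A}
    (hfg : f ≫ g = N • 𝟙 A) (hgf : g ≫ f = N • 𝟙 B) : IsIso f := by
  obtain ⟨c, hc⟩ := hN.exists_left_inv
  have smul_nsmul_id (M : ModuleCat.{u} R) : c • N • 𝟙 M = 𝟙 M := by
    rw [← Nat.cast_smul_eq_nsmul R, smul_smul, hc, one_smul]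
  refine ⟨c • g, ?_, ?_⟩
  · rw [Linear.comp_smul, hfg, smul_nsmul_id]
  · rw [Linear.smul_comp, hgf, smul_nsmul_id]

theorem nonempty_homology_dualComplex_iso {N : ℕ} (hN : IsUnit (N : R)) (φ : K ⟶ L) (ψ : L ⟶ K)
    (hψφ : ψ ≫ φ = N • 𝟙 L) (hφψ : Homotopy (φ ≫ ψ) (N • 𝟙 K)) (k : ℕ) :
    Nonempty ((dualComplex K).homology k ≅ (dualComplex L).homology k) := by
  let α := HomologicalComplex.homologyMap (dualComplexMap φ) k
  let β := HomologicalComplex.homologyMap (dualComplexMap ψ) k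
  have hαβ : α ≫ β = N • 𝟙 _ := by
    rw [← homologyMap_nsmul_id, ← dualComplexMap_nsmul_id, ← hψφ, dualComplexMap_comp,
      HomologicalComplex.homologyMap_comp]
  have hβα : β ≫ α = N • 𝟙 _ := by
    rw [← homologyMap_nsmul_id, ← dualComplexMap_nsmul_id, ← HomologicalComplex.homologyMap_comp,
      ← dualComplexMap_comp]
    exact (dualComplexHomotopy hφψ).homologyMap_eq k
  have : IsIso α := isIso_of_comp_eq_nsmul hN hαβ hβα
  exact ⟨(asIso α).symm⟩

end DualComplex

section Transfer

open Simplicial Limits Opposite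

universe u v w

theorem nonempty_homotopy_sum {C : Type u} [Category.{v} C] [Preadditive C] {ι κ : Type*}
    {c : ComplexShape κ} (s : Finset ι) {K L : HomologicalComplex C c} {φ ψ : ι → (K ⟶ L)}
    (h : ∀ f, Nonempty (Homotopy (φ f) (ψ f))) :
    Nonempty (Homotopy (∑ f ∈ s, φ f) (∑ f ∈ s, ψ f)) := by
  classical
  induction s using Finset.induction_on with
  | empty => exact ⟨Homotopy.ofEq (by simp)⟩
  | insert a s ha ih =>
    rw [Finset.sum_insert ha, Finset.sum_insert ha]
    exact ⟨(h a).some.add ih.some⟩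

/-- A surjection of simplicial sets whose fibres are permuted simply transitively by a family of
endomorphisms over the base. -/
structure SimplicialCover {A B : SSet.{w}} (π : A ⟶ B) (ι : Type*) where
  act : ι → (A ⟶ A)
  act_comp : ∀ f, act f ≫ π = π
  surjective : ∀ k : ℕ, Function.Surjective (π.app (op ⦋k⦌))
  existsUnique : ∀ (k : ℕ) (a b : A _⦋k⦌), π.app _ a = π.app _ b → ∃! f, (act f).app _ a = b

namespace SimplicialCover

variable {A B : SSet.{w}} {π : A ⟶ B} {ι : Type*} (T : SimplicialCover π ι)

theorem app_act {k : ℕ} (f : ι) (a : A _⦋k⦌) : π.app _ ((T.act f).app _ a) = π.app _ a :=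
  congrArg (fun φ : A ⟶ B => φ.app (op ⦋k⦌) a) (T.act_comp f)

/-- A chosen simplex above a simplex of the base. -/
def lift {k : ℕ} (b : B _⦋k⦌) : A _⦋k⦌ := (T.surjective k b).choose

theorem app_lift {k : ℕ} (b : B _⦋k⦌) : π.app _ (T.lift b) = b := (T.surjective k b).choose_spec

variable [Fintype ι]

theorem sum_act_eq {k : ℕ} {a b : A _⦋k⦌} (hab : π.app _ a = π.app _ b) {M : Type*}
    [AddCommMonoid M] (φ : A _⦋k⦌ → M) :
    ∑ f, φ ((T.act f).app _ a) = ∑ f, φ ((T.act f).app _ b) := by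
  choose σ hσ hσ_unique using fun f =>
    T.existsUnique k b ((T.act f).app _ a) (by rw [app_act, hab])
  have hbij : Function.Bijective σ := by
    refine ⟨fun f g hfg => ?_, fun g => ?_⟩
    · have hact : (T.act f).app _ a = (T.act g).app _ a := by rw [← hσ, ← hσ, hfg]
      exact (T.existsUnique k a _ (T.app_act g a).symm).unique hact rfl
    · obtain ⟨f, hf, -⟩ := T.existsUnique k a ((T.act g).app _ b) (by rw [app_act, hab])
      exact ⟨f, (hσ_unique f g hf.symm).symm⟩
  exact Fintype.sum_bijective σ hbij _ _ fun f => by rw [hσ]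

variable {C : Type u} [Category.{v} C] [Preadditive C] [HasCoproducts.{w} C] (R : C)

/-- The transfer in a given degree: a simplex is sent to the sum of its lifts. -/
def transferX (k : ℕ) : (B.chainComplex R).X k ⟶ (A.chainComplex R).X k :=
  Cofan.IsColimit.desc (B.isColimitChainComplexXCofan R k) fun b =>
    ∑ f, A.ιChainComplex ((T.act f).app _ (T.lift b))

theorem ι_transferX {k : ℕ} (b : B _⦋k⦌) : B.ιChainComplex b ≫ T.transferX R k =
    ∑ f, A.ιChainComplex ((T.act f).app _ (T.lift b)) :=
  Cofan.IsColimit.fac (B.isColimitChainComplexXCofan R k) _ b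

theorem ι_transferX_app {k : ℕ} (a : A _⦋k⦌) :
    B.ιChainComplex (π.app _ a) ≫ T.transferX R k =
      ∑ f, A.ιChainComplex (R := R) ((T.act f).app _ a) := by
  rw [ι_transferX]
  exact T.sum_act_eq (T.app_lift _) fun a => A.ιChainComplex (R := R) a

/-- The transfer map of simplicial chain complexes. -/
def transfer : B.chainComplex R ⟶ A.chainComplex R where
  f := T.transferX R
  comm' i j hij := by
    obtain rfl : j + 1 = i := hij
    refine SSet.chainComplex_hom_ext fun b => ?_
    obtain ⟨a, rfl⟩ := T.surjective _ b
    rw [← Category.assoc, ι_transferX_app, SSet.ιChainComplex_d_assoc, Preadditive.sum_comp,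
      Preadditive.sum_comp]
    simp only [SSet.ιChainComplex_d, Preadditive.zsmul_comp]
    rw [Finset.sum_comm]
    refine Finset.sum_congr rfl fun i _ => ?_
    have hδ : B.δ i (π.app _ a) = π.app _ (A.δ i a) := (SSet.δ_naturality_apply π i a).symm
    rw [← Finset.smul_sum, hδ, ι_transferX_app]
    congr 1
    exact Finset.sum_congr rfl fun f _ => by rw [SSet.δ_naturality_apply]

theorem transfer_comp : T.transfer R ≫ SSet.chainComplexMap π R = Fintype.card ι • 𝟙 _ := by
  ext k : 1
  refine SSet.chainComplex_hom_ext fun b => ?_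
  rw [HomologicalComplex.comp_f]
  change _ ≫ T.transferX R k ≫ _ = _
  rw [← Category.assoc, ι_transferX, Preadditive.sum_comp]
  simp [app_act, app_lift]

theorem comp_transfer :
    SSet.chainComplexMap π R ≫ T.transfer R = ∑ f, SSet.chainComplexMap (T.act f) R := by
  ext k : 1
  refine SSet.chainComplex_hom_ext fun a => ?_
  have hsum : (∑ f, SSet.chainComplexMap (T.act f) R).f k =
      ∑ f, (SSet.chainComplexMap (T.act f) R).f k :=
    (HomologicalComplex.eval C (ComplexShape.down ℕ) k).map_sum _ _
  rw [HomologicalComplex.comp_f, hsum, Preadditive.comp_sum]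
  change _ ≫ _ ≫ T.transferX R k = _
  rw [SSet.ι_chainComplexMap_f_assoc, ι_transferX_app]
  exact Finset.sum_congr rfl fun f _ => (SSet.ι_chainComplexMap_f ..).symm

end SimplicialCover

end Transfer

section CoveringCohomology

open Simplicial Opposite

instance simplyConnectedSpace_toTop (m : SimplexCategory) :
    SimplyConnectedSpace (SimplexCategory.toTop.{0}.obj m) := by
  have : ContractibleSpace (stdSimplex ℝ (Fin (m.len + 1))) :=
    (convex_stdSimplex ℝ _).contractibleSpace ⟨_, single_mem_stdSimplex ℝ 0⟩
  have : ContractibleSpace (ULift.{0} (stdSimplex ℝ (Fin (m.len + 1)))) :=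
    Homeomorph.ulift.contractibleSpace
  exact inferInstanceAs (SimplyConnectedSpace (ULift.{0} (stdSimplex ℝ (Fin (m.len + 1)))))

instance locallyPathConnectedSpace_toTop (m : SimplexCategory) :
    LocallyPathConnectedSpace (SimplexCategory.toTop.{0}.obj m) := by
  have : LocallyPathConnectedSpace (stdSimplex ℝ (Fin (m.len + 1))) :=
    (convex_stdSimplex ℝ _).locallyPathConnectedSpace
  have hopen := (Homeomorph.ulift.{0} (X := stdSimplex ℝ (Fin (m.len + 1)))).isOpenEmbedding
  exact hopen.locallyPathConnectedSpace

variable {E X : Type} [TopologicalSpace E] [TopologicalSpace X] {p : C(E, X)} {ι : Type*}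

/-- The cover of singular simplicial sets given by a covering whose fibres are permuted simply
transitively by the deck transformations `r`. -/
def simplicialCoverOfCovering (hp : IsCoveringMap p) (hsurj : Function.Surjective p)
    (r : ι → C(E, E)) (hr : ∀ f e, p (r f e) = p e)
    (hunique : ∀ e e', p e = p e' → ∃! f, r f e = e') :
    SimplicialCover (TopCat.toSSet.map (TopCat.ofHom p)) ι where
  act f := TopCat.toSSet.map (TopCat.ofHom (r f))
  act_comp f := by
    rw [← Functor.map_comp]
    congr 1
    ext e
    exact hr f e
  surjective k := by
    rintro ⟨b⟩
    let vertex : SimplexCategory.toTop.{0}.obj ⦋k⦌ := Classical.arbitrary _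
    obtain ⟨e, he⟩ := hsurj (b.hom vertex)
    obtain ⟨a, ⟨-, ha⟩, -⟩ := hp.existsUnique_continuousMap_lifts
      (A := SimplexCategory.toTop.{0}.obj ⦋k⦌) b.hom vertex e he
    refine ⟨⟨TopCat.ofHom a⟩, ULift.ext _ _ ?_⟩
    exact TopCat.hom_ext (ContinuousMap.ext fun x => congrFun ha x)
  existsUnique k := by
    rintro ⟨a⟩ ⟨b⟩ hab
    have hp_eq (x) : p (a.hom x) = p (b.hom x) :=
      congrArg (fun s : (TopCat.toSSet.obj (TopCat.of X)).obj (op ⦋k⦌) => s.down.hom x) hab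
    let vertex : SimplexCategory.toTop.{0}.obj ⦋k⦌ := Classical.arbitrary _
    obtain ⟨f, hf, hf_unique⟩ := hunique _ _ (hp_eq vertex)
    refine ⟨f, ULift.ext _ _ (TopCat.hom_ext (ContinuousMap.ext (congrFun ?_))),
      fun g hg => hf_unique g ?_⟩
    · exact hp.eq_of_comp_eq (A := SimplexCategory.toTop.{0}.obj ⦋k⦌)
        ((r f).continuous.comp a.hom.continuous) b.hom.continuous
        (funext fun x => (hr f _).trans (hp_eq x)) vertex hf
    · exact congrArg
        (fun s : (TopCat.toSSet.obj (TopCat.of E)).obj (op ⦋k⦌) => s.down.hom vertex) hg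

/-- The transfer inverts the projection up to homotopy and multiplication by the number of deck
transformations. -/
theorem nonempty_singularCohomology_iso [Finite ι] [Nonempty ι] (hp : IsCoveringMap p)
    (hsurj : Function.Surjective p) (r : ι → C(E, E)) (hr : ∀ f e, p (r f e) = p e)
    (hunique : ∀ e e', p e = p e' → ∃! f, r f e = e')
    (hid : ∀ f, (r f).Homotopic (ContinuousMap.id E)) (k : ℕ) :
    Nonempty (singularCohomology E k ≅ singularCohomology X k) := by
  have := Fintype.ofFinite ι
  let T := simplicialCoverOfCovering hp hsurj r hr hunique
  have hact (f) : Nonempty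
      (Homotopy (SSet.chainComplexMap (T.act f) (ModuleCat.of ℂ ℂ)) (𝟙 _)) := by
    let H : TopCat.Homotopy (TopCat.ofHom (r f)) (𝟙 (TopCat.of E)) := (hid f).some
    refine ⟨(H.singularChainComplexFunctorObjMap (ModuleCat.of ℂ ℂ)).trans (Homotopy.ofEq ?_)⟩
    exact CategoryTheory.Functor.map_id _ _
  obtain ⟨hsum⟩ := nonempty_homotopy_sum Finset.univ hact
  rw [← T.comp_transfer, Finset.sum_const, Finset.card_univ] at hsum
  exact nonempty_homology_dualComplex_iso (Nat.cast_ne_zero.2 Fintype.card_ne_zero).isUnit _ _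
    (T.transfer_comp (ModuleCat.of ℂ ℂ)) hsum k

end CoveringCohomology

section LieCohomology

variable {L L' : Type} [LieRing L] [LieAlgebra ℂ L] [LieRing L'] [LieAlgebra ℂ L']

theorem ceDiff_compLinearMap (e : L →ₗ⁅ℂ⁆ L') : ∀ (k : ℕ) (ω : L' [⋀^Fin k]→ₗ[ℂ] ℂ),
    ceDiff L k (ω.compLinearMap (e : L →ₗ[ℂ] L')) =
      (ceDiff L' k ω).compLinearMap (e : L →ₗ[ℂ] L')
  | 0, ω => by ext; rfl
  | k + 1, ω => by
    ext v
    change ceDiffSucc L k (ω.compLinearMap (e : L →ₗ[ℂ] L')) v =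
      ceDiffSucc L' k ω (fun i => e (v i))
    rw [ceDiffSucc_apply, ceDiffSucc_apply]
    congr 1
    refine Finset.sum_congr rfl fun i _ => Finset.sum_congr rfl fun j _ => ?_
    congr 1
    rw [AlternatingMap.compLinearMap_apply]
    congr 1
    ext a
    refine Fin.cases ?_ (fun a => ?_) a
    · exact e.map_lie _ _
    · rfl

/-- Isomorphic Lie algebras have isomorphic Chevalley--Eilenberg complexes. -/
def ceComplexIso (e : L ≃ₗ⁅ℂ⁆ L') : ceComplex L ≅ ceComplex L' :=
  HomologicalComplex.Hom.isoOfComponents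
    (fun k => (AlternatingMap.domLCongr ℂ ℂ (Fin k) ℂ e.toLinearEquiv).toModuleIso)
    (by
      rintro k _ rfl
      simp only [ceComplex, CochainComplex.of_d]
      ext : 1
      refine LinearMap.ext fun ω => ?_
      exact ceDiff_compLinearMap (e.symm : L' →ₗ⁅ℂ⁆ L) k ω)

/-- Isomorphic Lie algebras have isomorphic cohomology. -/
def lieCohomologyIso (e : L ≃ₗ⁅ℂ⁆ L') (k : ℕ) : lieCohomology L k ≅ lieCohomology L' k :=
  HomologicalComplex.homologyMapIso (ceComplexIso e) k

end LieCohomology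

namespace LinearFrame

variable {n : ℕ} {Δ : entireFunctions n}

theorem nonempty_lieCohomology_iso (S : LinearFrame Δ) (hΔ : IsReducedEquation Δ) (k : ℕ) :
    Nonempty (lieCohomology (linearGroupLieAlgebra (stabilizerGroup (divisorSet Δ))) k ≅
      lieCohomology (linearLogFields Δ) k) := by
  rw [S.linearGroupLieAlgebra_eq hΔ]
  exact ⟨lieCohomologyIso (logMatricesEquiv Δ) k⟩

theorem nonempty_singularCohomology_iso (S : LinearFrame Δ) (hΔ : IsReducedEquation Δ) (k : ℕ) :
    Nonempty (singularCohomology (identityComponent (divisorSet Δ)) k ≅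
      singularCohomology ↥(divisorSet Δ)ᶜ k) := by
  obtain ⟨p, hp⟩ := (isPathConnected_compl_divisorSet hΔ.ne_zero).nonempty
  have := S.finite_isotropyG hp hΔ
  refine LFD.nonempty_singularCohomology_iso (ι := isotropyG Δ p)
    (p := ⟨groupOrbit hp, continuous_groupOrbit hp⟩) (S.isCoveringMap_groupOrbit hp hΔ)
    (S.surjective_groupOrbit hp hΔ) (fun f => ⟨fun g => g * f.1, continuous_mul_const f.1⟩)
    (fun f g => ?_) (fun g h hgh => ?_) (fun f => ?_) k
  · refine ((groupOrbit_eq_iff hp).2 ?_).symm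
    simp
  · refine ⟨⟨g⁻¹ * h, (groupOrbit_eq_iff hp).1 hgh⟩, mul_inv_cancel_left g h, fun f hf => ?_⟩
    exact Subtype.ext (eq_inv_mul_of_mul_eq hf)
  · obtain ⟨γ⟩ := (S.joined_one hΔ hp f.1).symm
    exact ⟨{ toFun := fun x => x.2 * γ x.1
             continuous_toFun := by fun_prop
             map_zero_left := fun g => by simp
             map_one_left := fun g => by simp }⟩

end LinearFrame

end LFD

end

theorem proposition84 (n : ℕ) (Δ : entireFunctions n)
    (hΔ : IsReducedEquation Δ) (hD : IsLinearFree Δ) :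
    QuasiIso (degZeroInclusion Δ) ∧
    (∃ e : degZeroComplex Δ ≅ ceComplex (linearLogFields Δ),
      ∀ (k : ℕ) (ω : degZeroForms Δ k) (A : Fin k → linearLogFields Δ) (x : Fin n → ℂ),
        x ∉ divisorSet Δ →
        (show linearLogFields Δ [⋀^Fin k]→ₗ[ℂ] ℂ from (e.hom.f k).hom ω) A =
          ω.1 x (fun i => linearField (A i).1 x)) ∧
    (∀ k, Nonempty (logCohomology Δ k ≅ lieCohomology (linearLogFields Δ) k)) ∧
    (SatisfiesGLCT Δ ↔
      ∀ k, Nonempty (singularCohomology (identityComponent (divisorSet Δ)) k ≅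
        lieCohomology (linearGroupLieAlgebra (stabilizerGroup (divisorSet Δ))) k)) := by
  obtain ⟨S⟩ := hD.nonempty_frame
  refine ⟨quasiIso_degZeroInclusion S hΔ, ⟨degZeroIso S hΔ, fun k ω A x hx =>
    degZeroIso_hom_apply S hΔ k ω A hx⟩, nonempty_logCohomology_iso S hΔ,
    forall_congr' fun k => ?_⟩
  obtain ⟨logIso⟩ := nonempty_logCohomology_iso S hΔ k
  obtain ⟨lieIso⟩ := S.nonempty_lieCohomology_iso hΔ k
  obtain ⟨orbitIso⟩ := S.nonempty_singularCohomology_iso hΔ k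
  exact ⟨fun ⟨e⟩ => ⟨orbitIso ≪≫ e.symm ≪≫ logIso ≪≫ lieIso.symm⟩,
    fun ⟨e⟩ => ⟨logIso ≪≫ lieIso.symm ≪≫ e.symm ≪≫ orbitIso⟩⟩
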